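/- **Setting.** A decision tree over $\{0,1\}^n$ is a rooted binary tree whose internal nodes are labelled by coordinates $i\in\{1,\dots,n\}$ (no coordinate twice on a root-to-leaf path; one child is followed if $x_i=0$, the other if $x_i=1$) and whose leaves are labelled by $\pm1$; its size is its number of leaves, and $f:\{0,1\}^n\to\{-1,1\}$ is computed by a size-$s$ tree if it is computed by such a tree with at most $s$ leaves. For $\mu\in[0,1]^n$, $\mathcal P_\mu$ is the product distribution on $\{0,1\}^n$ with $\mathrm E[x_i]=\mu_i$. **Algorithm $L$** works in $\pm1$-notation: $x\in\{0,1\}^n$ is replaced by $2x-1\in\{-1,1\}^n$ and the mean vector $\mu$ by $\nu=2\mu-1$. Its input is the exact mean vector $\nu\in(-1,1)^n$ and labelled examples $(x^1,y^1),\dots,(x^m,y^m)\in\mathbb R^n\times\{-1,1\}$. For $x\in\mathbb R^n$ put $z_i(x)=(x_i-\nu_i)/\sqrt{1-\nu_i^2}$, and for $S\subseteq\{1,\dots,n\}$ put $z_S(x)=\prod_{i\in S}z_i(x)$ and $e(S)=\frac1m\sum_{j=1}^m y^j z_S(x^j)$. 1. Let $\mathcal S_0=\{\emptyset\}$. 2.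 For each integer $d=1,2,\dots$ with $d\le\frac{\ln m}{12}\bigl(1-\max_i|\nu_i|\bigr)$: let $\mathcal S_d=\mathcal S_{d-1}\cup\bigl\{S\cup\{i\} : S\in\mathcal S_{d-1},\ 1\le i\le n,\ |e(S\cup\{i\})|\ge m^{-1/3}\bigr\}$; if $|\mathcal S_d|>m$, abort and output FAIL. 3. With $\mathcal S$ the last family obtained, let $p(x)=\sum_{S\in\mathcal S}e(S)\,z_S(x)$ and output the polynomial threshold function $h=\operatorname{sgn}(p)$ (with $\operatorname{sgn}0=1$), given by $p$. As a function on $\{0,1\}^n$, $h(x)$ means $\operatorname{sgn}(p(2x-1))$. **Theorem.** (i) Let $c\in(0,1/4)$. Then there is a univariate polynomial $q$ such that, for all integers $n,s\ge1$, reals $0<\varepsilon\le1$ and $\delta>0$, every $f:\{0,1\}^n\to\{-1,1\}$ computed by a size-$s$ decision tree, every $\bar\mu\in[2c,1-2c]^n$ and every integer $m\ge q(ns/(\delta\varepsilon))$, the following holds with probability at least $1-\delta$ over $\Delta$ drawn uniformly from $[-c,c]^n$ and over examples $x_1,\dots,x_m$ then drawn independently from $\mathcal P_\mu$, where $\mu=\bar\mu+\Delta$: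 given $\mu$ and $(x_1,f(x_1)),\dots,(x_m,f(x_m))$, algorithm $L$ does not fail, and its output $h$ satisfies $$\Pr_{x\sim\mathcal P_\mu}[h(x)\ne f(x)]\le\varepsilon .$$ (ii) Algorithm $L$ runs in time polynomial in $n$ and $m$. Precisely, there are one program for a real random access machine (unit-cost addition, truncated subtraction and comparison of natural numbers; unit-cost field operations, square root, logarithm and comparison of reals; no rounding of reals) and a polynomial $T$ such that, for all $n,m\ge1$ and every input of $L$ as above, the program halts after at most $T(n+m)$ steps, and has then written the output of $L$: either FAIL, or $p$ as an explicit list of at most $T(n+m)$ terms, each a coefficient times a product of affine forms $a_ix_i+b_i$. -/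

import Mathlib

open MeasureTheory

noncomputable section

namespace SmoothedLearning

/-! ## Boolean decision trees over the cube -/

/-- Boolean decision trees over `{0,1}ⁿ`: leaves carry a label `±1`; an internal node carries a
coordinate, its first child is followed when that coordinate is `0`, its second when it is `1`. -/
inductive DecisionTree (n : ℕ) : Type where
  | leaf (b : ℤˣ) : DecisionTree n
  | node (i : Fin n) (t₀ t₁ : DecisionTree n) : DecisionTree n

namespace DecisionTree

variable {n : ℕ}

/-- The function computed by a tree. -/
def eval : DecisionTree n → (Fin n → Bool) → ℤˣ
  | leaf b, _ => b
  | node i t₀ t₁, x => if x i = true then t₁.eval x else t₀.eval x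

/-- The size of a tree is its number of leaves. -/
def size : DecisionTree n → ℕ
  | leaf _ => 1
  | node _ t₀ t₁ => t₀.size + t₁.size

/-- The coordinates that occur at the internal nodes. -/
def vars : DecisionTree n → Finset (Fin n)
  | leaf _ => ∅
  | node i t₀ t₁ => insert i (t₀.vars ∪ t₁.vars)

/-- No coordinate occurs more than once on a path from the root to a leaf. -/
def ReadOnce : DecisionTree n → Prop
  | leaf _ => True
  | node i t₀ t₁ => i ∉ t₀.vars ∧ i ∉ t₁.vars ∧ t₀.ReadOnce ∧ t₁.ReadOnce

end DecisionTree

/-- `f` is computed by a decision tree with at most `s` leaves. -/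
def ComputedByTree {n : ℕ} (s : ℕ) (f : (Fin n → Bool) → ℤˣ) : Prop :=
  ∃ t : DecisionTree n, t.ReadOnce ∧ t.size ≤ s ∧ ∀ x, t.eval x = f x

/-! ## Distributions -/

/-- The product distribution on `{0,1}ⁿ` under which bit `i` is `1` with probability `μ i`. -/
def productLaw {n : ℕ} (μ : Fin n → ℝ) : Measure (Fin n → Bool) :=
  Measure.pi fun i =>
    ENNReal.ofReal (μ i) • Measure.dirac true + ENNReal.ofReal (1 - μ i) • Measure.dirac false

/-- The law of `m` independent draws from `productLaw μ`. -/
def sampleLaw {n : ℕ} (μ : Fin n → ℝ) (m : ℕ) : Measure (Fin m → Fin n → Bool) :=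
  Measure.pi fun _ => productLaw μ

/-- The uniform distribution on the cube `[-c,c]ⁿ`: normalized Lebesgue measure. -/
def uniformCube (n : ℕ) (c : ℝ) : Measure (Fin n → ℝ) :=
  ProbabilityTheory.cond volume (Set.Icc (fun _ => -c) (fun _ => c))

/-- The probability of the event `E` when `Δ` is drawn uniformly from `[-c,c]ⁿ` and then `m`
examples are drawn independently from the product distribution with mean vector `μbar + Δ`. -/
def smoothedProb {n : ℕ} (c : ℝ) (μbar : Fin n → ℝ) (m : ℕ)
    (E : (Fin n → ℝ) → (Fin m → Fin n → Bool) → Prop) : ENNReal :=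
  ∫⁻ Δ, sampleLaw (μbar + Δ) m {X | E Δ X} ∂(uniformCube n c)

/-- The affine change of notation `b ↦ 2 b - 1` from `{0,1}ⁿ` to `{-1,1}ⁿ`. -/
def toPM {n : ℕ} (x : Fin n → Bool) : Fin n → ℝ := fun i => if x i = true then 1 else -1

/-- The mean vector in `{-1,1}`-notation of a product distribution with `{0,1}`-mean `μ`. -/
def meanPM {n : ℕ} (μ : Fin n → ℝ) : Fin n → ℝ := fun i => 2 * μ i - 1

/-! ## Algorithm L

Inputs, in `{-1,1}`-notation: the mean vector `μ`, the examples `x j` and their labels `y j`. -/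

section AlgorithmL

variable {n m : ℕ}

/-- The normalized coordinates `zᵢ = (xᵢ - μᵢ) / √(1 - μᵢ²)`. -/
def normalized (μ x : Fin n → ℝ) (i : Fin n) : ℝ := (x i - μ i) / Real.sqrt (1 - μ i ^ 2)

/-- The empirical coefficient `(1/m) ∑ⱼ yʲ ∏_{i ∈ S} zᵢʲ`. -/
def estimate (μ : Fin n → ℝ) (x : Fin m → Fin n → ℝ) (y : Fin m → ℤˣ) (S : Finset (Fin n)) : ℝ :=
  (1 / (m : ℝ)) * ∑ j, ((y j : ℤ) : ℝ) * ∏ i ∈ S, normalized μ (x j) i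

/-- One round: add every `S ∪ {i}`, with `S` already found, whose empirical coefficient is at
least `m ^ (-1/3)` in absolute value. -/
def extend (μ : Fin n → ℝ) (x : Fin m → Fin n → ℝ) (y : Fin m → ℤˣ)
    (F : Finset (Finset (Fin n))) : Finset (Finset (Fin n)) :=
  F ∪ ((F ×ˢ Finset.univ).image fun a => insert a.2 a.1).filter
    fun S => (m : ℝ) ^ (-(1 / 3) : ℝ) ≤ |estimate μ x y S|

/-- The family of sets after `d` rounds; `none` means that the algorithm has aborted because
some round produced more than `m` sets. -/
def features (μ : Fin n → ℝ) (x : Fin m → Fin n → ℝ) (y : Fin m → ℤˣ) :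
    ℕ → Option (Finset (Finset (Fin n)))
  | 0 => some {∅}
  | d + 1 => (features μ x y d).bind fun F =>
      if m < (extend μ x y F).card then none else some (extend μ x y F)

/-- The number of rounds: the largest integer at most `(log m / 12) (1 - maxᵢ |μᵢ|)`. -/
def rounds (m : ℕ) (μ : Fin n → ℝ) : ℕ := ⌊Real.log m / 12 * (1 - ⨆ i, |μ i|)⌋₊

/-- The polynomial `∑_{S ∈ F} (empirical coefficient of S) · ∏_{i ∈ S} zᵢ` in the variables
`xᵢ`. -/
def hypothesisPoly (μ : Fin n → ℝ) (x : Fin m → Fin n → ℝ) (y : Fin m → ℤˣ)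
    (F : Finset (Finset (Fin n))) : MvPolynomial (Fin n) ℝ :=
  ∑ S ∈ F, MvPolynomial.C (estimate μ x y S) *
    ∏ i ∈ S, (MvPolynomial.C (1 / Real.sqrt (1 - μ i ^ 2)) *
      (MvPolynomial.X i - MvPolynomial.C (μ i)))

/-- Algorithm L. The output `none` is `FAIL`; the output `some p` is the polynomial threshold
function `x ↦ sgn (p x)`, given by the polynomial `p`. -/
def algorithmL (μ : Fin n → ℝ) (x : Fin m → Fin n → ℝ) (y : Fin m → ℤˣ) :
    Option (MvPolynomial (Fin n) ℝ) :=
  (features μ x y (rounds m μ)).map (hypothesisPoly μ x y)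

/-- The polynomial threshold function `x ↦ sgn (p x)`, with `sgn 0 = 1`. -/
def thresholdFunction (p : MvPolynomial (Fin n) ℝ) (x : Fin n → ℝ) : ℤˣ :=
  if 0 ≤ MvPolynomial.eval x p then 1 else -1

end AlgorithmL

/-- In the run of L with `{0,1}`-mean vector `μ` on the examples `X j` labelled by `f`, the output
is a polynomial threshold function `h` with `Pr[h x ≠ f x] ≤ ε` under `productLaw μ`. -/
def Success {n m : ℕ} (f : (Fin n → Bool) → ℤˣ) (ε : ℝ) (μ : Fin n → ℝ)
    (X : Fin m → Fin n → Bool) : Prop :=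
  ∃ p : MvPolynomial (Fin n) ℝ,
    algorithmL (meanPM μ) (fun j => toPM (X j)) (fun j => f (X j)) = some p ∧
    productLaw μ {x | thresholdFunction p (toPM x) ≠ f x} ≤ ENNReal.ofReal ε

/-! ## A real random access machine

Programs are finite texts, without real constants, over a memory of finitely many two-dimensional
arrays of natural numbers and of real numbers. Every memory access, arithmetic operation, test and
assignment costs one step. On natural numbers there are addition and truncated subtraction; on
real numbers the field operations, square root and logarithm. Real numbers can be compared but not
rounded. -/

namespace RealRAM

/-- The memory: `nat a i j` and `real a i j` are the entries `(i, j)` of the `a`-th arrays. -/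
structure Store where
  nat : ℕ → ℕ → ℕ → ℕ
  real : ℕ → ℕ → ℕ → ℝ

/-- Overwrite one natural-number cell. -/
def Store.setNat (σ : Store) (a i j v : ℕ) : Store :=
  { σ with nat := fun a' i' j' => if a' = a ∧ i' = i ∧ j' = j then v else σ.nat a' i' j' }

/-- Overwrite one real cell. -/
def Store.setReal (σ : Store) (a i j : ℕ) (v : ℝ) : Store :=
  { σ with real := fun a' i' j' => if a' = a ∧ i' = i ∧ j' = j then v else σ.real a' i' j' }

/-- Natural-number expressions; the name `a` of an array is a literal, the indices are computed. -/
inductive NatExpr : Type where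
  | const (k : ℕ) : NatExpr
  | get (a : ℕ) (i j : NatExpr) : NatExpr
  | add (e₁ e₂ : NatExpr) : NatExpr
  | sub (e₁ e₂ : NatExpr) : NatExpr

def NatExpr.eval (σ : Store) : NatExpr → ℕ
  | .const k => k
  | .get a i j => σ.nat a (i.eval σ) (j.eval σ)
  | .add e₁ e₂ => e₁.eval σ + e₂.eval σ
  | .sub e₁ e₂ => e₁.eval σ - e₂.eval σ

def NatExpr.cost : NatExpr → ℕ
  | .const _ => 1
  | .get _ i j => i.cost + j.cost + 1
  | .add e₁ e₂ => e₁.cost + e₂.cost + 1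
  | .sub e₁ e₂ => e₁.cost + e₂.cost + 1

/-- Real expressions. -/
inductive RealExpr : Type where
  | ofNat (e : NatExpr) : RealExpr
  | get (a : ℕ) (i j : NatExpr) : RealExpr
  | add (e₁ e₂ : RealExpr) : RealExpr
  | sub (e₁ e₂ : RealExpr) : RealExpr
  | mul (e₁ e₂ : RealExpr) : RealExpr
  | div (e₁ e₂ : RealExpr) : RealExpr
  | sqrt (e : RealExpr) : RealExpr
  | log (e : RealExpr) : RealExpr

def RealExpr.eval (σ : Store) : RealExpr → ℝ
  | .ofNat e => (e.eval σ : ℝ)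
  | .get a i j => σ.real a (i.eval σ) (j.eval σ)
  | .add e₁ e₂ => e₁.eval σ + e₂.eval σ
  | .sub e₁ e₂ => e₁.eval σ - e₂.eval σ
  | .mul e₁ e₂ => e₁.eval σ * e₂.eval σ
  | .div e₁ e₂ => e₁.eval σ / e₂.eval σ
  | .sqrt e => Real.sqrt (e.eval σ)
  | .log e => Real.log (e.eval σ)

def RealExpr.cost : RealExpr → ℕ
  | .ofNat e => e.cost + 1
  | .get _ i j => i.cost + j.cost + 1
  | .add e₁ e₂ => e₁.cost + e₂.cost + 1
  | .sub e₁ e₂ => e₁.cost + e₂.cost + 1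
  | .mul e₁ e₂ => e₁.cost + e₂.cost + 1
  | .div e₁ e₂ => e₁.cost + e₂.cost + 1
  | .sqrt e => e.cost + 1
  | .log e => e.cost + 1

/-- Tests: comparison of two natural numbers or of two real numbers. -/
inductive Test : Type where
  | natLe (e₁ e₂ : NatExpr) : Test
  | realLe (e₁ e₂ : RealExpr) : Test

def Test.Holds (σ : Store) : Test → Prop
  | .natLe e₁ e₂ => e₁.eval σ ≤ e₂.eval σ
  | .realLe e₁ e₂ => e₁.eval σ ≤ e₂.eval σ

def Test.cost : Test → ℕ
  | .natLe e₁ e₂ => e₁.cost + e₂.cost + 1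
  | .realLe e₁ e₂ => e₁.cost + e₂.cost + 1

/-- Programs. -/
inductive Program : Type where
  | skip : Program
  | setNat (a : ℕ) (i j : NatExpr) (e : NatExpr) : Program
  | setReal (a : ℕ) (i j : NatExpr) (e : RealExpr) : Program
  | seq (p₁ p₂ : Program) : Program
  | ite (b : Test) (p₁ p₂ : Program) : Program
  | loop (b : Test) (p : Program) : Program

/-- `Exec p σ σ' t`: the program `p`, started in memory `σ`, halts in memory `σ'` after exactly
`t` steps. The program `loop b p` repeats `p` as long as `b` holds. -/
inductive Exec : Program → Store → Store → ℕ → Prop where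
  | skip (σ : Store) : Exec .skip σ σ 1
  | setNat (σ : Store) (a : ℕ) (i j e : NatExpr) :
      Exec (.setNat a i j e) σ (σ.setNat a (i.eval σ) (j.eval σ) (e.eval σ))
        (i.cost + j.cost + e.cost + 1)
  | setReal (σ : Store) (a : ℕ) (i j : NatExpr) (e : RealExpr) :
      Exec (.setReal a i j e) σ (σ.setReal a (i.eval σ) (j.eval σ) (e.eval σ))
        (i.cost + j.cost + e.cost + 1)
  | seq {p₁ p₂ : Program} {σ σ₁ σ₂ : Store} {t₁ t₂ : ℕ} :
      Exec p₁ σ σ₁ t₁ → Exec p₂ σ₁ σ₂ t₂ → Exec (.seq p₁ p₂) σ σ₂ (t₁ + t₂)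
  | iteTrue {b : Test} {p₁ p₂ : Program} {σ σ' : Store} {t : ℕ} :
      b.Holds σ → Exec p₁ σ σ' t → Exec (.ite b p₁ p₂) σ σ' (b.cost + t)
  | iteFalse {b : Test} {p₁ p₂ : Program} {σ σ' : Store} {t : ℕ} :
      ¬ b.Holds σ → Exec p₂ σ σ' t → Exec (.ite b p₁ p₂) σ σ' (b.cost + t)
  | loopDone {b : Test} {p : Program} {σ : Store} :
      ¬ b.Holds σ → Exec (.loop b p) σ σ b.cost
  | loopStep {b : Test} {p : Program} {σ σ₁ σ₂ : Store} {t₁ t₂ : ℕ} :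
      b.Holds σ → Exec p σ σ₁ t₁ → Exec (.loop b p) σ₁ σ₂ t₂ →
      Exec (.loop b p) σ σ₂ (b.cost + t₁ + t₂)

/-- The initial memory for L: `n` and `m` in the natural-number array `0`, and `μ`, the examples
and the labels in the real arrays `0`, `1` and `2`; all other cells are `0`. -/
def inputStore {n m : ℕ} (μ : Fin n → ℝ) (x : Fin m → Fin n → ℝ) (y : Fin m → ℤˣ) : Store where
  nat a i j := if a = 0 ∧ i = 0 ∧ j = 0 then n else if a = 0 ∧ i = 0 ∧ j = 1 then m else 0
  real a i j :=
    if a = 0 then (if h : i < n ∧ j = 0 then μ ⟨i, h.1⟩ else 0)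
    else if a = 1 then (if h : i < m ∧ j < n then x ⟨i, h.1⟩ ⟨j, h.2⟩ else 0)
    else if a = 2 then (if h : i < m ∧ j = 0 then ((y ⟨i, h.1⟩ : ℤ) : ℝ) else 0)
    else 0

/-- The number of terms of the polynomial written in the output arrays. -/
def outputTerms (σ : Store) : ℕ := σ.nat 1 0 1

/-- How the final memory is read as an output of L. A zero in cell `(0,0)` of the natural-number
array `1` means `FAIL`. Otherwise cell `(0,1)` of it is the number of terms; the `l`-th term is the
coefficient in cell `(l,0)` of the real array `3` times the product of the affine forms
`a i * xᵢ + b i` over those `i` whose flag in cell `(l,i)` of the natural-number array `2` is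
nonzero; `a i` and `b i` are the cells `(i,0)` and `(i,1)` of the real array `4`. -/
def readOutput (n : ℕ) (σ : Store) : Option (MvPolynomial (Fin n) ℝ) :=
  if σ.nat 1 0 0 = 0 then none
  else some (∑ l ∈ Finset.range (outputTerms σ), MvPolynomial.C (σ.real 3 l 0) *
    ∏ i : Fin n, if σ.nat 2 l i = 0 then 1
      else MvPolynomial.C (σ.real 4 i 0) * MvPolynomial.X i + MvPolynomial.C (σ.real 4 i 1))

end RealRAM

open RealRAM in
/-- Algorithm L runs in polynomial time: one fixed program, on every input consisting of a mean
vector in `(-1,1)ⁿ` and `m` labelled examples in `ℝⁿ × {-1,1}`, halts after at most polynomially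
many steps in `n` and `m` and has then written the output of L, with polynomially many terms. -/
def RunsInPolynomialTime : Prop :=
  ∃ (P : Program) (T : Polynomial ℕ), ∀ (n m : ℕ), 1 ≤ n → 1 ≤ m →
    ∀ (μ : Fin n → ℝ) (x : Fin m → Fin n → ℝ) (y : Fin m → ℤˣ), (∀ i, μ i ∈ Set.Ioo (-1) 1) →
      ∃ (σ : Store) (t : ℕ), Exec P (inputStore μ x y) σ t ∧ t ≤ T.eval (n + m) ∧
        outputTerms σ ≤ T.eval (n + m) ∧ readOutput n σ = algorithmL μ x y

end SmoothedLearning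

end

noncomputable section

namespace SmoothedLearning

/-! ## Fourier analysis on the biased cube -/

/-- The probability of the value `b` of a bit with mean `p`. -/
def bitWeight (p : ℝ) (b : Bool) : ℝ := if b = true then p else 1 - p

/-- The sign `±1` of a bit. -/
def bitSign (b : Bool) : ℝ := if b = true then 1 else -1

/-- The normalized value of a bit with mean `p`. -/
def bitNorm (p : ℝ) (b : Bool) : ℝ := (bitSign b - (2 * p - 1)) / Real.sqrt (1 - (2 * p - 1) ^ 2)

theorem bitWeight_pos {p : ℝ} (h0 : 0 < p) (h1 : p < 1) (b : Bool) : 0 < bitWeight p b := by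
  unfold bitWeight; split_ifs <;> linarith

theorem sum_bitWeight (p : ℝ) : ∑ b, bitWeight p b = 1 := by simp [bitWeight]

theorem sqrt_one_sub_mean_sq (p : ℝ) :
    Real.sqrt (1 - (2 * p - 1) ^ 2) = 2 * Real.sqrt (p * (1 - p)) := by
  rw [show 1 - (2 * p - 1) ^ 2 = 2 ^ 2 * (p * (1 - p)) by ring, Real.sqrt_mul (by positivity),
    Real.sqrt_sq (by norm_num)]

theorem bitNorm_true (p : ℝ) : bitNorm p true = (1 - p) / Real.sqrt (p * (1 - p)) := by
  rw [bitNorm, sqrt_one_sub_mean_sq, show bitSign true - (2 * p - 1) = 2 * (1 - p) by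
    simp [bitSign]; ring, mul_div_mul_left _ _ two_ne_zero]

theorem bitNorm_false (p : ℝ) : bitNorm p false = -p / Real.sqrt (p * (1 - p)) := by
  rw [bitNorm, sqrt_one_sub_mean_sq, show bitSign false - (2 * p - 1) = 2 * (-p) by
    simp [bitSign]; ring, mul_div_mul_left _ _ two_ne_zero]

section Bit

variable {p : ℝ} (h0 : 0 < p) (h1 : p < 1)
include h0 h1

theorem bitWeight_mul_bitNorm (b : Bool) :
    bitWeight p b * bitNorm p b = bitSign b * Real.sqrt (p * (1 - p)) := by
  have hq : 0 < p * (1 - p) := mul_pos h0 (by linarith)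
  have hr := Real.sqrt_pos.2 hq
  have hs := Real.mul_self_sqrt hq.le
  cases b
  · rw [bitNorm_false]; simp only [bitWeight, bitSign]; field_simp; simp; nlinarith
  · rw [bitNorm_true]; simp only [bitWeight, bitSign]; field_simp; simp; nlinarith

theorem sum_bitWeight_mul_bitNorm : ∑ b, bitWeight p b * bitNorm p b = 0 := by
  simp [bitWeight_mul_bitNorm h0 h1, bitSign]

theorem one_add_bitNorm_mul_bitNorm (b b' : Bool) :
    1 + bitNorm p b * bitNorm p b' = if b = b' then (bitWeight p b)⁻¹ else 0 := by
  have hq : 0 < p * (1 - p) := mul_pos h0 (by linarith)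
  have hr := Real.sqrt_pos.2 hq
  have hs := Real.mul_self_sqrt hq.le
  have h2 : (1 - p) ≠ 0 := by linarith
  cases b <;> cases b' <;> simp only [bitNorm_true, bitNorm_false, div_mul_div_comm, hs, bitWeight] <;>
    simp <;> field_simp <;> ring

theorem sum_bitWeight_mul_bitNorm_sq :
    ∑ b, bitWeight p b * (bitNorm p b * bitNorm p b) = 1 := by
  have h := fun b => one_add_bitNorm_mul_bitNorm h0 h1 b b
  simp only [if_true] at h
  have h' : ∀ b, bitNorm p b * bitNorm p b = (bitWeight p b)⁻¹ - 1 := fun b => by rw [← h b]; ring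
  have e : ∀ b, bitWeight p b * (bitNorm p b * bitNorm p b) = 1 - bitWeight p b := fun b => by
    rw [h', mul_sub, mul_inv_cancel₀ (bitWeight_pos h0 h1 b).ne', mul_one]
  simp only [e, Finset.sum_sub_distrib, sum_bitWeight]
  norm_num

end Bit

variable {n : ℕ}

/-- The probability of the point `x` under `productLaw μ`. -/
def weight (μ : Fin n → ℝ) (x : Fin n → Bool) : ℝ := ∏ i, bitWeight (μ i) (x i)

/-- The expectation under `productLaw μ`, as a finite sum. -/
def expect (μ : Fin n → ℝ) (g : (Fin n → Bool) → ℝ) : ℝ := ∑ x, weight μ x * g x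

/-- The orthonormal basis of the `L²` space of `productLaw μ`. -/
def character (μ : Fin n → ℝ) (S : Finset (Fin n)) (x : Fin n → Bool) : ℝ :=
  ∏ i ∈ S, bitNorm (μ i) (x i)

/-- The Fourier coefficient of `g` at `S`. -/
def coeff (μ : Fin n → ℝ) (g : (Fin n → Bool) → ℝ) (S : Finset (Fin n)) : ℝ :=
  expect μ fun x => g x * character μ S x

/-- All means lie strictly between `0` and `1`. -/
def Interior (μ : Fin n → ℝ) : Prop := ∀ i, 0 < μ i ∧ μ i < 1

section

variable {μ : Fin n → ℝ}

theorem weight_pos (hμ : Interior μ) (x : Fin n → Bool) : 0 < weight μ x :=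
  Finset.prod_pos fun i _ => bitWeight_pos (hμ i).1 (hμ i).2 _

theorem sum_prod_bits (u : Fin n → Bool → ℝ) : ∑ x : Fin n → Bool, ∏ i, u i (x i) = ∏ i, ∑ b, u i b := by
  rw [Finset.prod_univ_sum, Fintype.piFinset_univ]

theorem sum_weight (μ : Fin n → ℝ) : ∑ x, weight μ x = 1 := by
  simp only [weight]
  rw [sum_prod_bits fun i b => bitWeight (μ i) b]
  exact Finset.prod_eq_one fun i _ => sum_bitWeight _

theorem expect_const (μ : Fin n → ℝ) (a : ℝ) : expect μ (fun _ => a) = a := by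
  simp [expect, ← Finset.sum_mul, sum_weight]

theorem expect_mono (hμ : Interior μ) {g h : (Fin n → Bool) → ℝ} (H : ∀ x, g x ≤ h x) :
    expect μ g ≤ expect μ h :=
  Finset.sum_le_sum fun x _ => mul_le_mul_of_nonneg_left (H x) (weight_pos hμ x).le

theorem expect_add (g h : (Fin n → Bool) → ℝ) :
    expect μ (fun x => g x + h x) = expect μ g + expect μ h := by
  simp [expect, mul_add, Finset.sum_add_distrib]

theorem expect_sub (g h : (Fin n → Bool) → ℝ) :
    expect μ (fun x => g x - h x) = expect μ g - expect μ h := by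
  simp [expect, mul_sub, Finset.sum_sub_distrib]

theorem expect_const_mul (a : ℝ) (g : (Fin n → Bool) → ℝ) :
    expect μ (fun x => a * g x) = a * expect μ g := by
  simp [expect, Finset.mul_sum, mul_left_comm]

theorem expect_sum {ι : Type*} (s : Finset ι) (g : ι → (Fin n → Bool) → ℝ) :
    expect μ (fun x => ∑ k ∈ s, g k x) = ∑ k ∈ s, expect μ (g k) := by
  simp only [expect, Finset.mul_sum]
  exact Finset.sum_comm

theorem expect_character_mul_character (hμ : Interior μ) (S T : Finset (Fin n)) :
    expect μ (fun x => character μ S x * character μ T x) = if S = T then 1 else 0 := by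
  have h1 : ∀ x : Fin n → Bool, weight μ x * (character μ S x * character μ T x) =
      ∏ i, (bitWeight (μ i) (x i) * ((if i ∈ S then bitNorm (μ i) (x i) else 1) *
        (if i ∈ T then bitNorm (μ i) (x i) else 1))) := fun x => by
    rw [Finset.prod_mul_distrib, Finset.prod_mul_distrib, Finset.prod_ite_mem, Finset.prod_ite_mem]
    simp [weight, character]
  simp only [expect, h1]
  rw [sum_prod_bits fun i b => bitWeight (μ i) b * ((if i ∈ S then bitNorm (μ i) b else 1) *
        (if i ∈ T then bitNorm (μ i) b else 1))]
  split_ifs with h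
  · subst h
    refine Finset.prod_eq_one fun i _ => ?_
    by_cases hi : i ∈ S
    · simpa [hi] using sum_bitWeight_mul_bitNorm_sq (hμ i).1 (hμ i).2
    · simpa [hi] using sum_bitWeight (μ i)
  · obtain ⟨i, hi⟩ : ∃ i, ¬ (i ∈ S ↔ i ∈ T) := by
      by_contra! H
      exact h (Finset.ext H)
    refine Finset.prod_eq_zero (Finset.mem_univ i) ?_
    have := sum_bitWeight_mul_bitNorm (hμ i).1 (hμ i).2
    by_cases hS : i ∈ S <;> by_cases hT : i ∈ T <;> simp_all

theorem sum_character_mul_character (hμ : Interior μ) (x y : Fin n → Bool) :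
    ∑ S, character μ S x * character μ S y = if x = y then (weight μ x)⁻¹ else 0 := by
  have h : ∏ i, (1 + bitNorm (μ i) (x i) * bitNorm (μ i) (y i)) =
      ∑ S, character μ S x * character μ S y := by
    rw [Finset.prod_one_add]
    simp [character, Finset.prod_mul_distrib]
  rw [← h]
  simp only [one_add_bitNorm_mul_bitNorm (hμ _).1 (hμ _).2]
  split_ifs with hxy
  · subst hxy
    simp [weight]
  · obtain ⟨i, hi⟩ := Function.ne_iff.1 hxy
    exact Finset.prod_eq_zero (Finset.mem_univ i) (by simp [hi])

/-- Fourier inversion. -/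
theorem sum_coeff_mul_character (hμ : Interior μ) (g : (Fin n → Bool) → ℝ) (x : Fin n → Bool) :
    ∑ S, coeff μ g S * character μ S x = g x := by
  have : ∀ S, coeff μ g S * character μ S x =
      ∑ y, weight μ y * g y * (character μ S y * character μ S x) := fun S => by
    simp only [coeff, expect, Finset.sum_mul]
    exact Finset.sum_congr rfl fun y _ => by ring
  simp only [this]
  rw [Finset.sum_comm]
  simp only [← Finset.mul_sum, sum_character_mul_character hμ]
  simp only [mul_ite, mul_zero, Finset.sum_ite_eq', Finset.mem_univ, if_true]
  have := (weight_pos hμ x).ne'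
  field_simp

theorem expect_sum_character_sq (hμ : Interior μ) (a : Finset (Fin n) → ℝ) :
    expect μ (fun x => (∑ S, a S * character μ S x) ^ 2) = ∑ S, a S ^ 2 := by
  have : ∀ x, (∑ S, a S * character μ S x) ^ 2 =
      ∑ S, ∑ T, a S * a T * (character μ S x * character μ T x) := fun x => by
    rw [sq, Finset.sum_mul_sum]
    exact Finset.sum_congr rfl fun S _ => Finset.sum_congr rfl fun T _ => by ring
  simp only [this, expect_sum, expect_const_mul, expect_character_mul_character hμ]
  simp [sq]

/-- Parseval's identity. -/
theorem sum_coeff_sq (hμ : Interior μ) (g : (Fin n → Bool) → ℝ) :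
    ∑ S, coeff μ g S ^ 2 = expect μ fun x => g x ^ 2 := by
  rw [← expect_sum_character_sq hμ]
  simp only [sum_coeff_mul_character hμ]

theorem coeff_sub (g h : (Fin n → Bool) → ℝ) (S : Finset (Fin n)) :
    coeff μ (fun x => g x - h x) S = coeff μ g S - coeff μ h S := by
  simp only [coeff, sub_mul, expect_sub]

theorem bitLaw_isProbabilityMeasure {p : ℝ} (h0 : 0 < p) (h1 : p < 1) :
    IsProbabilityMeasure (ENNReal.ofReal p • Measure.dirac true +
      ENNReal.ofReal (1 - p) • Measure.dirac false) := by
  refine ⟨?_⟩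
  simp only [Measure.coe_add, Measure.coe_smul, Pi.add_apply, Pi.smul_apply, measure_univ,
    smul_eq_mul, mul_one]
  rw [← ENNReal.ofReal_add h0.le (by linarith)]
  simp

theorem productLaw_singleton (hμ : Interior μ) (x : Fin n → Bool) :
    productLaw μ {x} = ENNReal.ofReal (weight μ x) := by
  have hx : ({x} : Set (Fin n → Bool)) = Set.univ.pi fun i => {x i} := by
    ext y; simp [funext_iff]
  have := fun i => bitLaw_isProbabilityMeasure (hμ i).1 (hμ i).2
  rw [productLaw, hx, Measure.pi_pi, weight,
    ENNReal.ofReal_prod_of_nonneg fun i _ => (bitWeight_pos (hμ i).1 (hμ i).2 _).le]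
  refine Finset.prod_congr rfl fun i _ => ?_
  cases x i <;> simp [bitWeight]

theorem productLaw_isProbabilityMeasure (hμ : Interior μ) : IsProbabilityMeasure (productLaw μ) := by
  have := fun i => bitLaw_isProbabilityMeasure (hμ i).1 (hμ i).2
  unfold productLaw
  infer_instance

theorem productLaw_apply (hμ : Interior μ) (A : (Fin n → Bool) → Prop) [DecidablePred A] :
    productLaw μ {x | A x} = ENNReal.ofReal (expect μ fun x => if A x then 1 else 0) := by
  have h : {x | A x} = ((Finset.univ.filter A : Finset (Fin n → Bool)) : Set (Fin n → Bool)) := by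
    ext; simp
  rw [h, ← MeasureTheory.sum_measure_singleton]
  simp only [productLaw_singleton hμ]
  rw [← ENNReal.ofReal_sum_of_nonneg fun x _ => (weight_pos hμ x).le, expect]
  simp [Finset.sum_filter]

theorem integral_productLaw (hμ : Interior μ) (g : (Fin n → Bool) → ℝ) :
    ∫ x, g x ∂(productLaw μ) = expect μ g := by
  have := productLaw_isProbabilityMeasure hμ
  rw [integral_fintype Integrable.of_finite]
  refine Finset.sum_congr rfl fun x _ => ?_
  rw [Measure.real, productLaw_singleton hμ, ENNReal.toReal_ofReal (weight_pos hμ x).le, smul_eq_mul]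

/-- A function of one bit is independent of a function that ignores this bit. -/
theorem expect_bit_mul (μ : Fin n → ℝ) (i : Fin n) (φ : Bool → ℝ) {h : (Fin n → Bool) → ℝ}
    (hh : ∀ x b, h (Function.update x i b) = h x) :
    expect μ (fun x => φ (x i) * h x) = (∑ b, bitWeight (μ i) b * φ b) * expect μ h := by
  set W : (Fin n → Bool) → ℝ := fun x => ∏ j ∈ Finset.univ.erase i, bitWeight (μ j) (x j) with hW
  have hw : ∀ x, weight μ x = bitWeight (μ i) (x i) * W x := fun x =>
    (Finset.mul_prod_erase _ _ (Finset.mem_univ i)).symm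
  have hWu : ∀ x b, W (Function.update x i b) = W x := fun x b =>
    Finset.prod_congr rfl fun j hj => by rw [Function.update_of_ne (Finset.ne_of_mem_erase hj)]
  set A : Bool → ℝ := fun b => ∑ x : Fin n → Bool, if x i = b then W x * h x else 0 with hA
  have key : ∀ ψ : Bool → ℝ, ∑ x : Fin n → Bool, ψ (x i) * (W x * h x) = ∑ b, ψ b * A b := fun ψ => by
    simp only [hA, Finset.mul_sum]
    rw [Finset.sum_comm]
    refine Finset.sum_congr rfl fun x _ => ?_
    simp only [mul_ite, mul_zero]
    rw [Finset.sum_ite_eq Finset.univ (x i) fun b => ψ b * (W x * h x)]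
    simp
  have hflip : A true = A false := by
    simp only [hA]
    let e : (Fin n → Bool) ≃ (Fin n → Bool) := Function.Involutive.toPerm
      (fun x => Function.update x i (!x i)) (fun x => by simp)
    rw [← Equiv.sum_comp e]
    refine Finset.sum_congr rfl fun x _ => ?_
    have : e x = Function.update x i (!x i) := rfl
    rw [this, hWu, hh, Function.update_self]
    cases x i <;> simp
  have e1 : expect μ (fun x => φ (x i) * h x) = ∑ b, bitWeight (μ i) b * φ b * A b := by
    rw [← key fun b => bitWeight (μ i) b * φ b]
    exact Finset.sum_congr rfl fun x _ => by rw [hw]; ring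
  have e2 : expect μ h = ∑ b, bitWeight (μ i) b * A b := by
    rw [← key]
    exact Finset.sum_congr rfl fun x _ => by rw [hw]; ring
  rw [e1, e2]
  simp only [Fintype.sum_bool, hflip, bitWeight]
  simp
  ring

end

/-! ## Partial derivatives of the mean as a function of the mean vector -/

/-- The partial derivative along the coordinates in `T` of `μ ↦ expect μ g`. -/
def partialMean (g : (Fin n → Bool) → ℝ) (T : Finset (Fin n)) (μ : Fin n → ℝ) : ℝ :=
  ∑ x, g x * ∏ i, if i ∈ T then bitSign (x i) else bitWeight (μ i) (x i)

theorem coeff_eq_partialMean {μ : Fin n → ℝ} (hμ : Interior μ) (g : (Fin n → Bool) → ℝ)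
    (T : Finset (Fin n)) :
    coeff μ g T = (∏ i ∈ T, Real.sqrt (μ i * (1 - μ i))) * partialMean g T μ := by
  simp only [coeff, expect, partialMean, Finset.mul_sum]
  refine Finset.sum_congr rfl fun x _ => ?_
  have : weight μ x * character μ T x = (∏ i ∈ T, Real.sqrt (μ i * (1 - μ i))) *
      ∏ i, if i ∈ T then bitSign (x i) else bitWeight (μ i) (x i) := by
    have e : ∀ s : Finset (Fin n), ∀ u : Fin n → ℝ, ∏ i ∈ s, u i = ∏ i, if i ∈ s then u i else 1 :=
      fun s u => by simp [Finset.prod_ite_mem]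
    rw [character, e T, e T, weight, ← Finset.prod_mul_distrib, ← Finset.prod_mul_distrib]
    refine Finset.prod_congr rfl fun i _ => ?_
    by_cases hi : i ∈ T
    · simp only [hi, if_true]
      rw [bitWeight_mul_bitNorm (hμ i).1 (hμ i).2, mul_comm]
    · simp [hi]
  calc _ = g x * (weight μ x * character μ T x) := by ring
    _ = _ := by rw [this]; ring

theorem partialMean_update_of_mem (g : (Fin n → Bool) → ℝ) {T : Finset (Fin n)} {i : Fin n}
    (hi : i ∈ T) (μ : Fin n → ℝ) (t : ℝ) :
    partialMean g T (Function.update μ i t) = partialMean g T μ := by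
  refine Finset.sum_congr rfl fun x _ => ?_
  congr 1
  refine Finset.prod_congr rfl fun j _ => ?_
  by_cases hj : j = i
  · subst hj; simp [hi]
  · simp [hj]

theorem partialMean_update (g : (Fin n → Bool) → ℝ) {T : Finset (Fin n)} {i : Fin n}
    (hi : i ∉ T) (μ : Fin n → ℝ) :
    ∃ B : ℝ, ∀ t : ℝ, partialMean g T (Function.update μ i t) =
      t * partialMean g (insert i T) μ + B := by
  let rest : (Fin n → Bool) → ℝ := fun x =>
    ∏ j ∈ Finset.univ.erase i, if j ∈ T then bitSign (x j) else bitWeight (μ j) (x j)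
  refine ⟨∑ x, g x * ((if x i = true then 0 else 1) * rest x), fun t => ?_⟩
  simp only [partialMean, Finset.mul_sum]
  rw [← Finset.sum_add_distrib]
  refine Finset.sum_congr rfl fun x _ => ?_
  rw [← Finset.mul_prod_erase _ _ (Finset.mem_univ i),
    ← Finset.mul_prod_erase (a := i) _ (fun j => if j ∈ insert i T then _ else _) (Finset.mem_univ i)]
  have e1 : (∏ j ∈ Finset.univ.erase i, if j ∈ T then bitSign (x j) else
      bitWeight (Function.update μ i t j) (x j)) = rest x :=
    Finset.prod_congr rfl fun j hj => by
      rw [Function.update_of_ne (Finset.ne_of_mem_erase hj)]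
  have e2 : (∏ j ∈ Finset.univ.erase i, if j ∈ insert i T then bitSign (x j) else
      bitWeight (μ j) (x j)) = rest x :=
    Finset.prod_congr rfl fun j hj => by
      simp [Finset.mem_insert, Finset.ne_of_mem_erase hj]
  rw [e1, e2]
  simp only [hi, if_false, Function.update_self, Finset.mem_insert_self, if_true]
  cases x i <;> simp [bitWeight, bitSign] <;> ring

theorem continuous_partialMean (g : (Fin n → Bool) → ℝ) (T : Finset (Fin n)) :
    Continuous (partialMean g T) := by
  refine continuous_finsetSum _ fun x _ => continuous_const.mul
    (continuous_finsetProd _ fun i _ => ?_)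
  by_cases hi : i ∈ T
  · simp only [hi, if_true]; exact continuous_const
  · simp only [hi, if_false, bitWeight]
    split_ifs <;> fun_prop

/-! ## Truncated decision trees -/

namespace DecisionTree

variable {n : ℕ}

/-- The tree with all nodes below depth `k` replaced by leaves. -/
def truncate : ℕ → DecisionTree n → DecisionTree n
  | _, leaf b => leaf b
  | 0, node _ _ _ => leaf 1
  | k + 1, node i t₀ t₁ => node i (truncate k t₀) (truncate k t₁)

/-- The sets of coordinates that all occur on one path from the root to a leaf. -/
def spectrum : DecisionTree n → Finset (Finset (Fin n))
  | leaf _ => {∅}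
  | node i t₀ t₁ =>
    (t₀.spectrum ∪ t₁.spectrum) ∪ (t₀.spectrum ∪ t₁.spectrum).image (insert i)

/-- The function computed by a tree, with real values. -/
def val (t : DecisionTree n) (x : Fin n → Bool) : ℝ := ((t.eval x : ℤ) : ℝ)

theorem one_le_size (t : DecisionTree n) : 1 ≤ t.size := by
  induction t with
  | leaf b => simp [size]
  | node i a b ha hb => simp only [size]; omega

theorem card_spectrum_truncate (k : ℕ) (t : DecisionTree n) :
    (t.truncate k).spectrum.card ≤ 2 ^ k * t.size := by
  induction t generalizing k with
  | leaf b => cases k <;> simp [truncate, spectrum, size, Nat.one_le_two_pow]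
  | node i a b ha hb =>
    cases k with
    | zero =>
      have := one_le_size (node i a b)
      simpa [truncate, spectrum] using this
    | succ k =>
      simp only [truncate, spectrum, size]
      have h1 := Finset.card_union_le (a.truncate k).spectrum (b.truncate k).spectrum
      have h2 := Finset.card_union_le ((a.truncate k).spectrum ∪ (b.truncate k).spectrum)
        (((a.truncate k).spectrum ∪ (b.truncate k).spectrum).image (insert i))
      have h3 := Finset.card_image_le (s := (a.truncate k).spectrum ∪ (b.truncate k).spectrum)
        (f := insert i)
      have := ha k
      have := hb k
      rw [pow_succ]
      nlinarith

theorem card_le_of_mem_spectrum_truncate (k : ℕ) (t : DecisionTree n) {S : Finset (Fin n)}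
    (hS : S ∈ (t.truncate k).spectrum) : S.card ≤ k := by
  induction t generalizing k S with
  | leaf b => cases k <;> simp [truncate, spectrum] at hS <;> simp [hS]
  | node i a b ha hb =>
    cases k with
    | zero => simp [truncate, spectrum] at hS; simp [hS]
    | succ k =>
      have H : ∀ T ∈ (a.truncate k).spectrum ∪ (b.truncate k).spectrum, T.card ≤ k := fun T hT =>
        (Finset.mem_union.1 hT).elim (ha k) (hb k)
      rw [truncate, spectrum, Finset.mem_union, Finset.mem_image] at hS
      rcases hS with hS | ⟨T, hT, rfl⟩
      · exact (H S hS).trans k.le_succ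
      · exact (Finset.card_insert_le _ _).trans (Nat.succ_le_succ (H T hT))

theorem vars_truncate_subset (k : ℕ) (t : DecisionTree n) : (t.truncate k).vars ⊆ t.vars := by
  induction t generalizing k with
  | leaf b => cases k <;> simp [truncate]
  | node i a b ha hb =>
    cases k with
    | zero => simp [truncate, vars]
    | succ k =>
      exact Finset.insert_subset_insert _ (Finset.union_subset_union (ha k) (hb k))

theorem ReadOnce.truncate {t : DecisionTree n} (h : t.ReadOnce) (k : ℕ) :
    (t.truncate k).ReadOnce := by
  induction t generalizing k with
  | leaf b => cases k <;> trivial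
  | node i a b ha hb =>
    cases k with
    | zero => trivial
    | succ k =>
      exact ⟨fun hi => h.1 (vars_truncate_subset k a hi),
        fun hi => h.2.1 (vars_truncate_subset k b hi), ha h.2.2.1 k, hb h.2.2.2 k⟩

theorem eval_update {t : DecisionTree n} {i : Fin n} (hi : i ∉ t.vars) (x : Fin n → Bool)
    (b : Bool) : t.eval (Function.update x i b) = t.eval x := by
  induction t with
  | leaf _ => rfl
  | node j t₀ t₁ h0 h1 =>
    simp only [vars, Finset.mem_insert, Finset.mem_union, not_or] at hi
    simp only [eval, h0 hi.2.1, h1 hi.2.2, Function.update_of_ne (Ne.symm hi.1)]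

/-- The probability that a random point is misclassified after truncation at depth `k`. -/
theorem expect_eval_ne_truncate {μ : Fin n → ℝ} {c : ℝ} (hc : 0 < c) (hc1 : c ≤ 1)
    (hμ : ∀ i, c ≤ μ i ∧ μ i ≤ 1 - c) {t : DecisionTree n} (ht : t.ReadOnce) (k : ℕ) :
    expect μ (fun x => if t.eval x ≠ (t.truncate k).eval x then 1 else 0) ≤
      t.size * (1 - c) ^ k := by
  have hμ' : Interior μ := fun i => ⟨by linarith [(hμ i).1], by linarith [(hμ i).2]⟩
  induction t generalizing k with
  | leaf b =>
    cases k
    · simp [truncate, expect, size]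
    · simpa [truncate, expect, size] using pow_nonneg (sub_nonneg.2 hc1) _
  | node i a b ha hb =>
    cases k with
    | zero =>
      have h1 : expect μ (fun x => if (node i a b).eval x ≠ ((node i a b).truncate 0).eval x
          then (1 : ℝ) else 0) ≤ expect μ fun _ => 1 :=
        expect_mono hμ' fun x => by split_ifs <;> norm_num
      rw [expect_const] at h1
      have h2 : (1 : ℝ) ≤ ((node i a b).size : ℝ) := by exact_mod_cast one_le_size _
      simpa using h1.trans h2
    | succ k =>
      have hk : 0 ≤ 1 - c := sub_nonneg.2 hc1
      set A : (Fin n → Bool) → ℝ := fun x => if a.eval x ≠ (a.truncate k).eval x then 1 else 0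
        with hA
      set B : (Fin n → Bool) → ℝ := fun x => if b.eval x ≠ (b.truncate k).eval x then 1 else 0
        with hB
      have hA0 : ∀ x v, A (Function.update x i v) = A x := fun x v => by
        simp only [hA, eval_update ht.1, eval_update (fun h => ht.1 (vars_truncate_subset k a h))]
      have hB0 : ∀ x v, B (Function.update x i v) = B x := fun x v => by
        simp only [hB, eval_update ht.2.1,
          eval_update (fun h => ht.2.1 (vars_truncate_subset k b h))]
      have e : expect μ (fun x => if (node i a b).eval x ≠ ((node i a b).truncate (k + 1)).eval x
          then (1 : ℝ) else 0) = (1 - μ i) * expect μ A + μ i * expect μ B := by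
        have h1 := expect_bit_mul μ i (fun b => if b = true then 0 else 1) hA0
        have h2 := expect_bit_mul μ i (fun b => if b = true then 1 else 0) hB0
        simp only [Fintype.sum_bool, bitWeight] at h1 h2
        simp only [if_true, mul_zero, zero_add, mul_one, add_zero, Bool.false_eq_true, if_false]
          at h1 h2
        rw [← h1, ← h2, ← expect_add]
        congr 1
        funext x
        simp only [truncate, eval, hA, hB]
        cases x i <;> simp
      have hA1 := ha ht.2.2.1 k
      have hB1 := hb ht.2.2.2 k
      have hA2 : 0 ≤ expect μ A := by
        rw [← expect_const μ 0]; exact expect_mono hμ' fun x => by simp only [hA]; split_ifs <;> norm_num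
      have hB2 : 0 ≤ expect μ B := by
        rw [← expect_const μ 0]; exact expect_mono hμ' fun x => by simp only [hB]; split_ifs <;> norm_num
      rw [e, size, pow_succ]
      push_cast
      have hi := hμ i
      calc (1 - μ i) * expect μ A + μ i * expect μ B
          ≤ (1 - c) * expect μ A + (1 - c) * expect μ B := by gcongr <;> linarith
        _ ≤ (1 - c) * (a.size * (1 - c) ^ k) + (1 - c) * (b.size * (1 - c) ^ k) := by gcongr
        _ = _ := by ring

theorem expect_bit_mul_val_mul_character {μ : Fin n → ℝ} {i : Fin n} (φ : Bool → ℝ)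
    {t : DecisionTree n} (hi : i ∉ t.vars) {S : Finset (Fin n)}
    (h0 : coeff μ t.val S = 0) (h1 : coeff μ t.val (S.erase i) = 0) :
    expect μ (fun x => φ (x i) * (t.val x * character μ S x)) = 0 := by
  have hv : ∀ x v, t.val (Function.update x i v) = t.val x := fun x v => by
    simp only [val, eval_update hi]
  have hc : ∀ T : Finset (Fin n), i ∉ T → ∀ x v,
      character μ T (Function.update x i v) = character μ T x := fun T hT x v =>
    Finset.prod_congr rfl fun j hj => by
      rw [Function.update_of_ne (show j ≠ i from fun h => hT (h ▸ hj))]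
  by_cases hS : i ∈ S
  · have := expect_bit_mul μ i (fun b => φ b * bitNorm (μ i) b)
      (h := fun x => t.val x * character μ (S.erase i) x)
      (fun x v => by rw [hv, hc _ (Finset.notMem_erase i S)])
    rw [show expect μ (fun x => t.val x * character μ (S.erase i) x) = 0 from h1, mul_zero] at this
    rw [← this]
    congr 1
    funext x
    rw [character, ← Finset.mul_prod_erase S _ hS, character]
    ring
  · have := expect_bit_mul μ i φ (h := fun x => t.val x * character μ S x)
      (fun x v => by rw [hv, hc _ hS])
    rw [this, show expect μ (fun x => t.val x * character μ S x) = 0 from h0, mul_zero]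

theorem coeff_eq_zero {μ : Fin n → ℝ} (hμ : Interior μ) {t : DecisionTree n} (ht : t.ReadOnce)
    {S : Finset (Fin n)} (hS : S ∉ t.spectrum) : coeff μ t.val S = 0 := by
  induction t generalizing S with
  | leaf b =>
    have hS' : ∅ ≠ S := fun h => hS (by simp [spectrum, h])
    have := expect_character_mul_character hμ ∅ S
    simp only [character, Finset.prod_empty, one_mul, hS', if_false] at this
    simp only [coeff, val, eval, expect_const_mul, character, this, mul_zero]
  | node i a b ha hb =>
    have H : ∀ T, T = S ∨ T = S.erase i → T ∉ a.spectrum ∪ b.spectrum := by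
      rintro T (rfl | rfl) hT
      · exact hS (Finset.mem_union_left _ hT)
      · by_cases hi : i ∈ S
        · refine hS (Finset.mem_union_right _ (Finset.mem_image.2 ⟨_, hT, Finset.insert_erase hi⟩))
        · rw [Finset.erase_eq_of_notMem hi] at hT
          exact hS (Finset.mem_union_left _ hT)
    have Ha : ∀ T, T = S ∨ T = S.erase i → coeff μ a.val T = 0 := fun T hT =>
      ha ht.2.2.1 fun h => H T hT (Finset.mem_union_left _ h)
    have Hb : ∀ T, T = S ∨ T = S.erase i → coeff μ b.val T = 0 := fun T hT =>
      hb ht.2.2.2 fun h => H T hT (Finset.mem_union_right _ h)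
    have h0 := expect_bit_mul_val_mul_character (fun b => if b = true then 0 else 1) ht.1
      (Ha S (Or.inl rfl)) (Ha _ (Or.inr rfl))
    have h1 := expect_bit_mul_val_mul_character (fun b => if b = true then 1 else 0) ht.2.1
      (Hb S (Or.inl rfl)) (Hb _ (Or.inr rfl))
    have h2 := congrArg₂ (· + ·) h0 h1
    simp only [← expect_add, add_zero] at h2
    rw [← h2, coeff]
    congr 1
    funext x
    simp only [val, eval]
    cases x i <;> simp

end DecisionTree

/-! ## Anticoncentration of multilinear functions on a cube -/

/-- The function `x ↦ |x| ^ (-1/2)`, with value `∞` at `0`. -/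
def invSqrtAbs (x : ℝ) : ENNReal := ENNReal.ofReal |x| ^ (-(1 / 2) : ℝ)

theorem measurable_invSqrtAbs : Measurable invSqrtAbs :=
  (ENNReal.measurable_ofReal.comp measurable_norm).pow_const _

theorem invSqrtAbs_neg (x : ℝ) : invSqrtAbs (-x) = invSqrtAbs x := by simp [invSqrtAbs]

theorem invSqrtAbs_mul (x y : ℝ) : invSqrtAbs (x * y) = invSqrtAbs x * invSqrtAbs y := by
  rw [invSqrtAbs, abs_mul, ENNReal.ofReal_mul (abs_nonneg x),
    ENNReal.mul_rpow_of_ne_top ENNReal.ofReal_ne_top ENNReal.ofReal_ne_top]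
  rfl

theorem invSqrtAbs_of_pos {x : ℝ} (hx : 0 < x) : invSqrtAbs x = ENNReal.ofReal (Real.sqrt x)⁻¹ := by
  rw [invSqrtAbs, abs_of_pos hx, ENNReal.ofReal_rpow_of_pos hx, Real.rpow_neg hx.le, Real.sqrt_eq_rpow]

theorem invSqrtAbs_anti {x y : ℝ} (h : |x| ≤ |y|) : invSqrtAbs y ≤ invSqrtAbs x := by
  rw [invSqrtAbs, invSqrtAbs, ENNReal.rpow_neg, ENNReal.rpow_neg]
  gcongr

theorem lintegral_Ioc_invSqrtAbs {c : ℝ} (hc : 0 < c) :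
    ∫⁻ x in Set.Ioc 0 c, invSqrtAbs x = ENNReal.ofReal (2 * Real.sqrt c) := by
  have h1 : ∫⁻ x in Set.Ioc 0 c, invSqrtAbs x =
      ∫⁻ x in Set.Ioc 0 c, ENNReal.ofReal (x ^ (-(1 / 2) : ℝ)) := by
    refine setLIntegral_congr_fun measurableSet_Ioc fun x hx => ?_
    rw [invSqrtAbs, abs_of_pos hx.1, ENNReal.ofReal_rpow_of_pos hx.1]
  have hi : IntervalIntegrable (fun x : ℝ => x ^ (-(1 / 2) : ℝ)) volume 0 c :=
    intervalIntegral.intervalIntegrable_rpow' (by norm_num)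
  rw [intervalIntegrable_iff_integrableOn_Ioc_of_le hc.le] at hi
  rw [h1, ← ofReal_integral_eq_lintegral_ofReal hi
    ((ae_restrict_mem measurableSet_Ioc).mono fun x hx => Real.rpow_nonneg hx.1.le _),
    ← intervalIntegral.integral_of_le hc.le, integral_rpow (Or.inl (by norm_num))]
  congr 1
  rw [Real.sqrt_eq_rpow, Real.zero_rpow (by norm_num)]
  norm_num
  ring

theorem lintegral_Icc_invSqrtAbs_add {c : ℝ} (hc : 0 < c) (b : ℝ) :
    ∫⁻ x in Set.Icc (-c) c, invSqrtAbs (x + b) ≤ ENNReal.ofReal (6 * Real.sqrt c) := by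
  set ψ : ℝ → ENNReal := (Set.Ioc 0 c).indicator invSqrtAbs with hψ
  have hm : Measurable ψ := measurable_invSqrtAbs.indicator measurableSet_Ioc
  have hint : ∫⁻ x, ψ x = ENNReal.ofReal (2 * Real.sqrt c) := by
    rw [hψ, lintegral_indicator measurableSet_Ioc, lintegral_Ioc_invSqrtAbs hc]
  have hpt : ∀ y : ℝ, y ≠ 0 → invSqrtAbs y ≤ ψ y + ψ (-y) + invSqrtAbs c := by
    intro y hy
    by_cases h : |y| ≤ c
    · rcases lt_or_gt_of_ne hy with hneg | hpos
      · have : -y ∈ Set.Ioc 0 c := ⟨by linarith, by rwa [abs_of_neg hneg] at h⟩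
        simp only [hψ, Set.indicator_of_mem this, invSqrtAbs_neg]
        exact le_add_right le_add_self
      · have : y ∈ Set.Ioc 0 c := ⟨hpos, by rwa [abs_of_pos hpos] at h⟩
        simp only [hψ, Set.indicator_of_mem this]
        exact le_add_right (le_add_right le_rfl)
    · exact le_add_left (invSqrtAbs_anti (by rw [abs_of_pos hc]; exact (not_le.1 h).le))
  have hne : ∀ᵐ x : ℝ, x + b ≠ 0 := by
    have : {x : ℝ | ¬ (x + b ≠ 0)} = {-b} := by
      ext x; simp [add_eq_zero_iff_eq_neg]
    rw [ae_iff, this]; simp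
  calc ∫⁻ x in Set.Icc (-c) c, invSqrtAbs (x + b)
      ≤ ∫⁻ x in Set.Icc (-c) c, (ψ (x + b) + ψ (-(x + b)) + invSqrtAbs c) :=
        lintegral_mono_ae (ae_restrict_of_ae (hne.mono fun x hx => hpt _ hx))
    _ = (∫⁻ x in Set.Icc (-c) c, ψ (x + b)) + (∫⁻ x in Set.Icc (-c) c, ψ (-(x + b))) +
        ∫⁻ x in Set.Icc (-c) c, invSqrtAbs c := by
        rw [lintegral_add_right _ measurable_const,
          lintegral_add_left (show Measurable fun x => ψ (x + b) from hm.comp (measurable_add_const b))]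
    _ ≤ (∫⁻ x, ψ (x + b)) + (∫⁻ x, ψ (-(x + b))) + ∫⁻ x in Set.Icc (-c) c, invSqrtAbs c := by
        gcongr <;> exact Measure.restrict_le_self
    _ = ENNReal.ofReal (6 * Real.sqrt c) := by
        rw [lintegral_add_right_eq_self ψ b,
          lintegral_add_right_eq_self (fun x => ψ (-x)) b, lintegral_neg_eq_self, hint,
          setLIntegral_const, Real.volume_Icc, invSqrtAbs_of_pos hc,
          ← ENNReal.ofReal_mul (inv_nonneg.2 (Real.sqrt_nonneg c)),
          ← ENNReal.ofReal_add (by positivity) (by positivity),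
          ← ENNReal.ofReal_add (by positivity)
            (mul_nonneg (inv_nonneg.2 (Real.sqrt_nonneg c)) (by linarith))]
        congr 1
        have h1 := Real.sqrt_pos.2 hc
        have h2 := Real.mul_self_sqrt hc.le
        field_simp
        nlinarith

/-- The uniform distribution on the interval `[-c,c]`. -/
def uniformInterval (c : ℝ) : Measure ℝ := ProbabilityTheory.cond volume (Set.Icc (-c) c)

theorem uniformInterval_isProbabilityMeasure {c : ℝ} (hc : 0 < c) :
    IsProbabilityMeasure (uniformInterval c) :=
  ProbabilityTheory.cond_isProbabilityMeasure_of_finite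
    (by rw [Real.volume_Icc]; simpa using hc) (by simp)

theorem uniformCube_eq_pi (n : ℕ) {c : ℝ} (hc : 0 < c) :
    uniformCube n c = Measure.pi fun _ => uniformInterval c := by
  have := uniformInterval_isProbabilityMeasure hc
  refine (Measure.pi_eq fun s hs => ?_).symm
  have hI : Set.Icc (fun _ : Fin n => -c) (fun _ => c) = Set.univ.pi fun _ => Set.Icc (-c) c :=
    (Set.pi_univ_Icc _ _).symm
  rw [uniformCube, hI, ProbabilityTheory.cond_apply (MeasurableSet.univ_pi fun _ => measurableSet_Icc),
    ← Set.pi_inter_distrib, volume_pi, Measure.pi_pi, Measure.pi_pi]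
  simp only [uniformInterval, ProbabilityTheory.cond_apply measurableSet_Icc]
  rw [Finset.prod_mul_distrib, ENNReal.prod_inv_distrib]
  intro i _ j _ _
  left; simpa using hc

theorem lintegral_uniformInterval_invSqrtAbs {c : ℝ} (hc : 0 < c) (a b : ℝ) :
    ∫⁻ t, invSqrtAbs (t * a + b) ∂(uniformInterval c) ≤
      ENNReal.ofReal (3 / Real.sqrt c) * invSqrtAbs a := by
  have hs := Real.sqrt_pos.2 hc
  by_cases ha : a = 0
  · subst ha
    have : invSqrtAbs 0 = ⊤ := by simp [invSqrtAbs]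
    rw [this, ENNReal.mul_top (by simpa using hs)]
    exact le_top
  · have h : ∀ t, invSqrtAbs (t * a + b) = invSqrtAbs (t + b / a) * invSqrtAbs a := fun t => by
      rw [← invSqrtAbs_mul]; congr 1; field_simp
    simp only [h]
    rw [lintegral_mul_const _ (show Measurable fun t => invSqrtAbs (t + b / a) from
      measurable_invSqrtAbs.comp (measurable_add_const _)), uniformInterval,
      ProbabilityTheory.cond, lintegral_smul_measure]
    gcongr
    refine (mul_le_mul_right (lintegral_Icc_invSqrtAbs_add hc _) _).trans (le_of_eq ?_)
    rw [Real.volume_Icc, ← ENNReal.ofReal_inv_of_pos (by linarith),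
      ← ENNReal.ofReal_mul (inv_nonneg.2 (by linarith))]
    congr 1
    have h2 := Real.mul_self_sqrt hc.le
    field_simp
    nlinarith

section

variable {n : ℕ} {c : ℝ} (hc : 0 < c) (μbar : Fin n → ℝ) (g : (Fin n → Bool) → ℝ)
include hc

theorem lintegral_partialMean_insert {T : Finset (Fin n)} {i : Fin n} (hi : i ∉ T)
    {E : Set (Fin n → ℝ)} (hE : MeasurableSet E)
    (hinv : ∀ Δ t, Function.update Δ i t ∈ E ↔ Δ ∈ E) :
    ∫⁻ Δ, E.indicator (fun Δ => invSqrtAbs (partialMean g T (μbar + Δ))) Δ ∂(uniformCube n c) ≤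
      ENNReal.ofReal (3 / Real.sqrt c) *
        ∫⁻ Δ, E.indicator (fun Δ => invSqrtAbs (partialMean g (insert i T) (μbar + Δ))) Δ
          ∂(uniformCube n c) := by
  have := uniformInterval_isProbabilityMeasure hc
  have hm : ∀ T : Finset (Fin n), Measurable
      (E.indicator fun Δ => invSqrtAbs (partialMean g T (μbar + Δ))) := fun T =>
    (measurable_invSqrtAbs.comp ((continuous_partialMean g T).measurable.comp
      (measurable_const_add μbar))).indicator hE
  rw [uniformCube_eq_pi n hc, ← lintegral_const_mul _ (hm _)]
  refine lintegral_le_of_lmarginal_le {i} (hm T) ((hm _).const_mul _) fun Δ => ?_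
  simp only [lmarginal_singleton]
  have hupd : ∀ t, μbar + Function.update Δ i t = Function.update (μbar + Δ) i (μbar i + t) :=
    fun t => by
      ext j
      by_cases hj : j = i
      · subst hj; simp
      · simp [hj]
  by_cases hΔ : Δ ∈ E
  · have hmem : ∀ t, Function.update Δ i t ∈ E := fun t => (hinv Δ t).2 hΔ
    simp only [Set.indicator_of_mem (hmem _), hupd,
      partialMean_update_of_mem g (Finset.mem_insert_self i T)]
    obtain ⟨B, hB⟩ := partialMean_update g hi (μbar + Δ)
    simp only [hB, lintegral_const, measure_univ, mul_one]
    refine le_trans (le_of_eq (lintegral_congr fun t => ?_))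
      (lintegral_uniformInterval_invSqrtAbs hc _
        (μbar i * partialMean g (insert i T) (μbar + Δ) + B))
    congr 1; ring
  · have hmem : ∀ t, Function.update Δ i t ∉ E := fun t h => hΔ ((hinv Δ t).1 h)
    simp [Set.indicator_of_notMem (hmem _)]

theorem lintegral_partialMean_union (U : Finset (Fin n)) {T : Finset (Fin n)} (hU : Disjoint U T)
    {E : Set (Fin n → ℝ)} (hE : MeasurableSet E)
    (hinv : ∀ i ∈ U, ∀ Δ t, Function.update Δ i t ∈ E ↔ Δ ∈ E) :
    ∫⁻ Δ, E.indicator (fun Δ => invSqrtAbs (partialMean g T (μbar + Δ))) Δ ∂(uniformCube n c) ≤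
      ENNReal.ofReal (3 / Real.sqrt c) ^ U.card *
        ∫⁻ Δ, E.indicator (fun Δ => invSqrtAbs (partialMean g (U ∪ T) (μbar + Δ))) Δ
          ∂(uniformCube n c) := by
  induction U using Finset.induction_on generalizing T with
  | empty => simp
  | insert i U hi ih =>
    rw [Finset.disjoint_insert_left] at hU
    refine (lintegral_partialMean_insert hc μbar g hU.1 hE
      (hinv i (Finset.mem_insert_self i U))).trans ?_
    rw [Finset.card_insert_of_notMem hi, pow_succ', mul_assoc]
    gcongr
    refine (ih (T := insert i T) (Finset.disjoint_insert_right.2 ⟨hi, hU.2⟩)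
      fun j hj => hinv j (Finset.mem_insert_of_mem hj)).trans ?_
    rw [Finset.union_insert, Finset.insert_union]

/-- If a partial derivative of higher order is large, then one of lower order is seldom small. -/
theorem uniformCube_partialMean_small_le {S T : Finset (Fin n)} (hTS : T ⊆ S) {η θ : ℝ}
    (hη : 0 < η) (hθ : 0 < θ) (hc9 : c ≤ 9) :
    uniformCube n c {Δ | η ≤ |partialMean g S (μbar + Δ)| ∧ |partialMean g T (μbar + Δ)| ≤ θ} ≤
      ENNReal.ofReal ((3 / Real.sqrt c) ^ S.card * Real.sqrt (θ / η)) := by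
  have := uniformInterval_isProbabilityMeasure hc
  have hprob : IsProbabilityMeasure (uniformCube n c) := by
    rw [uniformCube_eq_pi n hc]; infer_instance
  have hmeas : ∀ T, Measurable fun Δ => partialMean g T (μbar + Δ) := fun T =>
    (continuous_partialMean g T).measurable.comp (measurable_const_add μbar)
  set E : Set (Fin n → ℝ) := {Δ | η ≤ |partialMean g S (μbar + Δ)|} with hE
  have hEm : MeasurableSet E := measurableSet_le measurable_const (hmeas S).norm
  have hinv : ∀ i ∈ S \ T, ∀ Δ t, Function.update Δ i t ∈ E ↔ Δ ∈ E := fun i hi Δ t => by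
    have hupd : μbar + Function.update Δ i t = Function.update (μbar + Δ) i (μbar i + t) := by
      ext j
      by_cases hj : j = i
      · subst hj; simp
      · simp [hj]
    simp only [hE, Set.mem_ofPred_eq, hupd, partialMean_update_of_mem g (Finset.mem_sdiff.1 hi).1]
  have h1 := lintegral_partialMean_union hc μbar g (S \ T) Finset.sdiff_disjoint hEm hinv
  rw [Finset.sdiff_union_of_subset hTS] at h1
  have h2 : ∫⁻ Δ, E.indicator (fun Δ => invSqrtAbs (partialMean g S (μbar + Δ))) Δ
      ∂(uniformCube n c) ≤ invSqrtAbs η := by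
    refine (lintegral_mono (g := fun _ => invSqrtAbs η) fun Δ => ?_).trans (by simp)
    refine Set.indicator_le' (fun Δ hΔ => invSqrtAbs_anti ?_) (fun _ _ => zero_le) Δ
    rwa [abs_of_pos hη]
  have h3 : invSqrtAbs θ * uniformCube n c
      {Δ | η ≤ |partialMean g S (μbar + Δ)| ∧ |partialMean g T (μbar + Δ)| ≤ θ} ≤
      ∫⁻ Δ, E.indicator (fun Δ => invSqrtAbs (partialMean g T (μbar + Δ))) Δ ∂(uniformCube n c) := by
    refine le_trans ?_ (mul_meas_ge_le_lintegral
      ((measurable_invSqrtAbs.comp (hmeas T)).indicator hEm) (invSqrtAbs θ))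
    refine mul_le_mul_right (measure_mono fun Δ hΔ => ?_) _
    obtain ⟨hΔ, hΔ'⟩ := hΔ
    change invSqrtAbs θ ≤ E.indicator (fun Δ => invSqrtAbs (partialMean g T (μbar + Δ))) Δ
    rw [Set.indicator_of_mem (show Δ ∈ E from hΔ)]
    exact invSqrtAbs_anti (by rwa [abs_of_pos hθ])
  have h4 := h3.trans (h1.trans (mul_le_mul_right h2 _))
  have hsθ := Real.sqrt_pos.2 hθ
  have hsη := Real.sqrt_pos.2 hη
  have hsc := Real.sqrt_pos.2 hc
  rw [invSqrtAbs_of_pos hθ, invSqrtAbs_of_pos hη] at h4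
  have hone : ENNReal.ofReal (Real.sqrt θ) * ENNReal.ofReal (Real.sqrt θ)⁻¹ = 1 := by
    rw [← ENNReal.ofReal_mul hsθ.le, mul_inv_cancel₀ hsθ.ne', ENNReal.ofReal_one]
  have h5 := mul_le_mul_right h4 (ENNReal.ofReal (Real.sqrt θ))
  rw [← mul_assoc, hone, one_mul] at h5
  refine h5.trans ?_
  rw [← ENNReal.ofReal_pow (by positivity), ← ENNReal.ofReal_mul (by positivity),
    ← ENNReal.ofReal_mul hsθ.le]
  refine ENNReal.ofReal_le_ofReal ?_
  have hle : (3 / Real.sqrt c) ^ (S \ T).card ≤ (3 / Real.sqrt c) ^ S.card := by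
    refine pow_le_pow_right₀ ?_ (Finset.card_le_card Finset.sdiff_subset)
    rw [one_le_div hsc, Real.sqrt_le_left (by norm_num)]
    linarith
  rw [Real.sqrt_div hθ.le]
  calc Real.sqrt θ * ((3 / Real.sqrt c) ^ (S \ T).card * (Real.sqrt η)⁻¹)
      = (3 / Real.sqrt c) ^ (S \ T).card * (Real.sqrt θ / Real.sqrt η) := by
        rw [div_eq_mul_inv]; ring
    _ ≤ _ := by gcongr

end

/-! ## Concentration of the empirical coefficients -/

section

variable {n m : ℕ} {μ : Fin n → ℝ}

theorem sampleLaw_isProbabilityMeasure (hμ : Interior μ) (m : ℕ) :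
    IsProbabilityMeasure (sampleLaw μ m) := by
  have := productLaw_isProbabilityMeasure hμ
  unfold sampleLaw
  infer_instance

theorem sampleLaw_sum_ge_le (hμ : Interior μ) {g : (Fin n → Bool) → ℝ} {R : ℝ} (hR : 0 < R)
    (hg : ∀ x, |g x| ≤ R) {t : ℝ} (ht : 0 ≤ t) :
    (sampleLaw μ m).real {X | m * t ≤ ∑ j, (g (X j) - expect μ g)} ≤
      Real.exp (-(m * t ^ 2 / (2 * R ^ 2))) := by
  have hP := productLaw_isProbabilityMeasure hμ
  have hS := sampleLaw_isProbabilityMeasure hμ m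
  have hind : ProbabilityTheory.iIndepFun (fun (j : Fin m) (X : Fin m → Fin n → Bool) =>
      g (X j) - expect μ g) (sampleLaw μ m) :=
    ProbabilityTheory.iIndepFun_pi (X := fun (_ : Fin m) x => g x - expect μ g)
      fun j => (measurable_of_finite _).aemeasurable
  have hsub : ∀ j ∈ (Finset.univ : Finset (Fin m)), ProbabilityTheory.HasSubgaussianMGF
      (fun X : Fin m → Fin n → Bool => g (X j) - expect μ g) ((‖R - -R‖₊ / 2) ^ 2)
      (sampleLaw μ m) := fun j _ => by
    have h1 := ProbabilityTheory.hasSubgaussianMGF_of_mem_Icc (μ := productLaw μ) (X := g)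
      (a := -R) (b := R) (measurable_of_finite _).aemeasurable
      (Filter.Eventually.of_forall fun x => abs_le.1 (hg x))
    rw [integral_productLaw hμ] at h1
    have hmp : Measure.map (fun X : Fin m → Fin n → Bool => X j) (sampleLaw μ m) = productLaw μ :=
      (measurePreserving_eval (fun _ : Fin m => productLaw μ) j).map_eq
    rw [← hmp] at h1
    exact ProbabilityTheory.HasSubgaussianMGF.of_map
      (Y := fun X : Fin m → Fin n → Bool => X j) (measurable_pi_apply j).aemeasurable h1
  have h := ProbabilityTheory.HasSubgaussianMGF.measure_sum_ge_le_of_iIndepFun hind hsub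
    (ε := m * t) (by positivity)
  refine h.trans (le_of_eq ?_)
  congr 1
  have hc : ((‖R - -R‖₊ / 2 : NNReal) : ℝ) = R := by
    simp only [NNReal.coe_div, coe_nnnorm, Real.norm_eq_abs, NNReal.coe_ofNat]
    rw [abs_of_pos (by linarith)]; ring
  simp only [Finset.sum_const, Finset.card_univ, Fintype.card_fin, nsmul_eq_mul, NNReal.coe_mul,
    NNReal.coe_natCast, NNReal.coe_pow, hc]
  rcases Nat.eq_zero_or_pos m with rfl | hm
  · simp
  · field_simp

/-- Hoeffding's inequality for the empirical mean of a bounded function. -/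
theorem sampleLaw_abs_sub_ge_le (hμ : Interior μ) (hm : 0 < m) {g : (Fin n → Bool) → ℝ} {R : ℝ}
    (hR : 0 < R) (hg : ∀ x, |g x| ≤ R) {t : ℝ} (ht : 0 ≤ t) :
    sampleLaw μ m {X | t < |1 / (m : ℝ) * ∑ j, g (X j) - expect μ g|} ≤
      ENNReal.ofReal (2 * Real.exp (-(m * t ^ 2 / (2 * R ^ 2)))) := by
  have hS := sampleLaw_isProbabilityMeasure hμ m
  have h1 := sampleLaw_sum_ge_le (m := m) hμ hR hg ht
  have h2 := sampleLaw_sum_ge_le (m := m) hμ hR (g := fun x => -g x)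
    (fun x => by rw [abs_neg]; exact hg x) ht
  have hneg : expect μ (fun x => -g x) = -expect μ g := by simp [expect]
  have hm' : (0 : ℝ) < m := by exact_mod_cast hm
  rw [two_mul, ENNReal.ofReal_add (Real.exp_pos _).le (Real.exp_pos _).le]
  have hle : {X : Fin m → Fin n → Bool | t < |1 / (m : ℝ) * ∑ j, g (X j) - expect μ g|} ⊆
      {X | m * t ≤ ∑ j, (g (X j) - expect μ g)} ∪
        {X | m * t ≤ ∑ j, (-g (X j) - expect μ fun x => -g x)} := by
    intro X hX
    have hX : t < |1 / (m : ℝ) * ∑ j, g (X j) - expect μ g| := hX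
    have e : 1 / (m : ℝ) * ∑ j, g (X j) - expect μ g =
        (∑ j, (g (X j) - expect μ g)) / m := by
      rw [Finset.sum_sub_distrib]; simp; field_simp
    have e' : ∑ j, (-g (X j) - expect μ fun x => -g x) = -∑ j, (g (X j) - expect μ g) := by
      rw [hneg, ← Finset.sum_neg_distrib]
      exact Finset.sum_congr rfl fun j _ => by ring
    rw [e, abs_div, abs_of_pos hm', lt_div_iff₀ hm'] at hX
    rcases le_abs.1 hX.le with h | h
    · left; change m * t ≤ ∑ j, (g (X j) - expect μ g); linarith
    · right
      change m * t ≤ ∑ j, (-g (X j) - expect μ fun x => -g x)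
      rw [e']; linarith
  refine (measure_mono hle).trans ((measure_union_le _ _).trans (add_le_add ?_ ?_))
  · rw [← ofReal_measureReal]; exact ENNReal.ofReal_le_ofReal h1
  · rw [← ofReal_measureReal]; exact ENNReal.ofReal_le_ofReal h2

theorem abs_units_cast (u : ℤˣ) : |((u : ℤ) : ℝ)| = 1 := by
  rcases Int.units_eq_one_or u with rfl | rfl <;> simp

theorem sampleLaw_exists_estimate_far (hμ : Interior μ) (hm : 0 < m) (f : (Fin n → Bool) → ℤˣ)
    {R : ℝ} (hR : 0 < R) (r : ℕ)
    (hz : ∀ S : Finset (Fin n), S.card ≤ r → ∀ x, |character μ S x| ≤ R) {t : ℝ} (ht : 0 ≤ t) :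
    sampleLaw μ m {X | ¬ ∀ S : Finset (Fin n), S.card ≤ r →
      |estimate (meanPM μ) (fun j => toPM (X j)) (fun j => f (X j)) S -
        coeff μ (fun x => ((f x : ℤ) : ℝ)) S| ≤ t} ≤
      ENNReal.ofReal (2 ^ n * (2 * Real.exp (-(m * t ^ 2 / (2 * R ^ 2))))) := by
  set A : Finset (Fin n) → Set (Fin m → Fin n → Bool) := fun S =>
    {X | t < |1 / (m : ℝ) * ∑ j, (((f (X j) : ℤ) : ℝ) * character μ S (X j)) -
      expect μ fun x => ((f x : ℤ) : ℝ) * character μ S x|} with hA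
  have hle : {X : Fin m → Fin n → Bool | ¬ ∀ S : Finset (Fin n), S.card ≤ r →
      |estimate (meanPM μ) (fun j => toPM (X j)) (fun j => f (X j)) S -
        coeff μ (fun x => ((f x : ℤ) : ℝ)) S| ≤ t} ⊆
      ⋃ S ∈ (Finset.univ.filter fun S : Finset (Fin n) => S.card ≤ r), A S := by
    intro X hX
    obtain ⟨S, hS⟩ := not_forall.1 hX
    obtain ⟨hS, hX⟩ := Classical.not_imp.1 hS
    exact Set.mem_biUnion (by simpa using hS) (not_le.1 hX)
  refine (measure_mono hle).trans ((measure_biUnion_finset_le _ _).trans ?_)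
  refine (Finset.sum_le_sum (g := fun _ =>
    ENNReal.ofReal (2 * Real.exp (-(m * t ^ 2 / (2 * R ^ 2))))) fun S hS => ?_).trans ?_
  · refine sampleLaw_abs_sub_ge_le hμ hm hR (g := fun x => ((f x : ℤ) : ℝ) * character μ S x)
      (fun x => ?_) ht
    rw [abs_mul, abs_units_cast, one_mul]
    exact hz S (by simpa using hS) x
  · rw [Finset.sum_const, nsmul_eq_mul, ENNReal.ofReal_mul (p := 2 ^ n) (by positivity)]
    refine mul_le_mul' ?_ le_rfl
    have hcard : (Finset.univ.filter fun S : Finset (Fin n) => S.card ≤ r).card ≤ 2 ^ n :=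
      (Finset.card_le_univ _).trans (by simp)
    rw [ENNReal.ofReal_pow (by norm_num), ENNReal.ofReal_ofNat]
    exact_mod_cast hcard

end

/-! ## Analysis of the feature search -/

section

variable {n m : ℕ} {μ : Fin n → ℝ}

theorem eval_hypothesisPoly (ν : Fin n → ℝ) (x : Fin m → Fin n → ℝ) (y : Fin m → ℤˣ)
    (F : Finset (Finset (Fin n))) (v : Fin n → ℝ) :
    MvPolynomial.eval v (hypothesisPoly ν x y F) =
      ∑ S ∈ F, estimate ν x y S * ∏ i ∈ S, normalized ν v i := by
  simp only [hypothesisPoly, map_sum, map_mul, map_prod, MvPolynomial.eval_C, map_sub,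
    MvPolynomial.eval_X, normalized]
  refine Finset.sum_congr rfl fun S _ => ?_
  congr 1
  exact Finset.prod_congr rfl fun i _ => by ring

theorem success_of_expect_le (hμ : Interior μ) {f : (Fin n → Bool) → ℤˣ} {ε : ℝ}
    {X : Fin m → Fin n → Bool} {F : Finset (Finset (Fin n))}
    (hF : features (meanPM μ) (fun j => toPM (X j)) (fun j => f (X j)) (rounds m (meanPM μ)) = some F)
    (hε : expect μ (fun x => (∑ S ∈ F, estimate (meanPM μ) (fun j => toPM (X j))
      (fun j => f (X j)) S * character μ S x - ((f x : ℤ) : ℝ)) ^ 2) ≤ ε) :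
    Success f ε μ X := by
  classical
  refine ⟨_, by rw [algorithmL, hF, Option.map_some], ?_⟩
  rw [productLaw_apply hμ]
  refine ENNReal.ofReal_le_ofReal ((expect_mono hμ fun x => ?_).trans hε)
  have hx : MvPolynomial.eval (toPM x) (hypothesisPoly (meanPM μ) (fun j => toPM (X j))
      (fun j => f (X j)) F) = ∑ S ∈ F, estimate (meanPM μ) (fun j => toPM (X j))
      (fun j => f (X j)) S * character μ S x := eval_hypothesisPoly _ _ _ _ _
  rw [← hx, thresholdFunction]
  generalize MvPolynomial.eval (toPM x) (hypothesisPoly (meanPM μ) (fun j => toPM (X j))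
      (fun j => f (X j)) F) = v
  by_cases hv : 0 ≤ v <;> rcases Int.units_eq_one_or (f x) with h | h <;> 
    simp [hv, h, -one_le_sq_iff_one_le_abs] <;> nlinarith

theorem features_eq_some {ν : Fin n → ℝ} {x : Fin m → Fin n → ℝ} {y : Fin m → ℤˣ} (r : ℕ)
    (hcard : ∀ F : Finset (Finset (Fin n)), (∀ S ∈ F, S.card ≤ r ∧
      (S = ∅ ∨ (m : ℝ) ^ (-(1 / 3) : ℝ) ≤ |estimate ν x y S|)) → F.card ≤ m)
    {d : ℕ} (hd : d ≤ r) :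
    ∃ F, features ν x y d = some F ∧ (∀ S ∈ F, S.card ≤ d ∧
      (S = ∅ ∨ (m : ℝ) ^ (-(1 / 3) : ℝ) ≤ |estimate ν x y S|)) ∧
      ∀ S : Finset (Fin n), S.card ≤ d →
        (∀ T ⊆ S, T ≠ ∅ → (m : ℝ) ^ (-(1 / 3) : ℝ) ≤ |estimate ν x y T|) → S ∈ F := by
  induction d with
  | zero =>
    refine ⟨{∅}, rfl, by simp, fun S hS _ => ?_⟩
    simpa using hS
  | succ d ih =>
    obtain ⟨F, hF, h1, h2⟩ := ih (Nat.le_of_succ_le hd)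
    have h1' : ∀ S ∈ extend ν x y F, S.card ≤ d + 1 ∧
        (S = ∅ ∨ (m : ℝ) ^ (-(1 / 3) : ℝ) ≤ |estimate ν x y S|) := by
      intro S hS
      rw [extend, Finset.mem_union, Finset.mem_filter, Finset.mem_image] at hS
      rcases hS with hS | ⟨⟨⟨T, i⟩, hT, rfl⟩, hS⟩
      · exact ⟨(h1 S hS).1.trans d.le_succ, (h1 S hS).2⟩
      · exact ⟨(Finset.card_insert_le _ _).trans
          (Nat.succ_le_succ (h1 T (Finset.mem_product.1 hT).1).1), Or.inr hS⟩
    have hm : ¬ m < (extend ν x y F).card :=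
      not_lt.2 (hcard _ fun S hS => ⟨(h1' S hS).1.trans hd, (h1' S hS).2⟩)
    refine ⟨extend ν x y F, by rw [features, hF]; simp [hm], h1', fun S hS hT => ?_⟩
    rw [extend, Finset.mem_union]
    rcases S.eq_empty_or_nonempty with rfl | ⟨i, hi⟩
    · exact Or.inl (h2 ∅ (by simp) fun T hT hT' => absurd (Finset.subset_empty.1 hT) hT')
    · right
      rw [Finset.mem_filter, Finset.mem_image]
      refine ⟨⟨(S.erase i, i), ?_, Finset.insert_erase hi⟩, hT S le_rfl (Finset.ne_empty_of_mem hi)⟩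
      refine Finset.mem_product.2 ⟨h2 _ ?_ fun T h => hT T (h.trans (Finset.erase_subset _ _)),
        Finset.mem_univ _⟩
      rw [Finset.card_erase_of_mem hi]; omega

theorem card_mul_le_of_le_abs {ι : Type*} [Fintype ι] [DecidableEq ι] {a : ι → ℝ} (ha : ∑ i, a i ^ 2 ≤ 1)
    {F : Finset ι} {θ : ℝ} (hθ : 0 ≤ θ) (hF : ∀ i ∈ F, θ ≤ |a i|) : F.card * θ ^ 2 ≤ 1 := by
  refine le_trans ?_ ha
  calc (F.card : ℝ) * θ ^ 2 = ∑ i ∈ F, θ ^ 2 := by simp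
    _ ≤ ∑ i ∈ F, a i ^ 2 := Finset.sum_le_sum fun i hi => by
        rw [← sq_abs (a i)]; exact pow_le_pow_left₀ hθ (hF i hi) 2
    _ ≤ ∑ i, a i ^ 2 := Finset.sum_le_univ_sum_of_nonneg fun i => sq_nonneg _

/-- The squared error of an approximate partial Fourier sum. -/
theorem expect_partial_sum_sub_sq (hμ : Interior μ) (g : (Fin n → Bool) → ℝ)
    (F : Finset (Finset (Fin n))) (e : Finset (Fin n) → ℝ) :
    expect μ (fun x => (∑ S ∈ F, e S * character μ S x - g x) ^ 2) =
      ∑ S ∈ F, (e S - coeff μ g S) ^ 2 + ∑ S ∈ Fᶜ, coeff μ g S ^ 2 := by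
  have h : ∀ x, ∑ S ∈ F, e S * character μ S x - g x =
      ∑ S, ((if S ∈ F then e S else 0) - coeff μ g S) * character μ S x := fun x => by
    simp only [sub_mul, Finset.sum_sub_distrib, sum_coeff_mul_character hμ, ite_mul, zero_mul]
    rw [Finset.sum_ite_mem, Finset.univ_inter]
  simp only [h, expect_sum_character_sq hμ]
  rw [← Finset.sum_add_sum_compl F]
  congr 1
  · exact Finset.sum_congr rfl fun S hS => by simp [hS]
  · exact Finset.sum_congr rfl fun S hS => by simp [Finset.mem_compl.1 hS]

/-- The Fourier mass of a decision tree outside a family that holds all large coefficients of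
the truncated tree. -/
theorem sum_compl_coeff_sq_le {c : ℝ} (hc : 0 < c) (hc1 : c ≤ 1 / 2)
    (hμ : ∀ i, c ≤ μ i ∧ μ i ≤ 1 - c) {t : DecisionTree n} (ht : t.ReadOnce) (k : ℕ)
    {F : Finset (Finset (Fin n))} {η : ℝ}
    (hF : ∀ S ∈ (t.truncate k).spectrum, S ∉ F → |coeff μ t.val S| ≤ η) :
    ∑ S ∈ Fᶜ, coeff μ t.val S ^ 2 ≤
      2 ^ k * t.size * η ^ 2 + 4 * (t.size * (1 - c) ^ k) := by
  have hμ' : Interior μ := fun i => ⟨by linarith [(hμ i).1], by linarith [(hμ i).2]⟩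
  set T := (t.truncate k).spectrum with hT
  have h1 : ∑ S ∈ Fᶜ ∩ T, coeff μ t.val S ^ 2 ≤ 2 ^ k * t.size * η ^ 2 := by
    calc ∑ S ∈ Fᶜ ∩ T, coeff μ t.val S ^ 2 ≤ ∑ S ∈ Fᶜ ∩ T, η ^ 2 :=
          Finset.sum_le_sum fun S hS => by
            rw [Finset.mem_inter, Finset.mem_compl] at hS
            rw [← sq_abs]; exact pow_le_pow_left₀ (abs_nonneg _) (hF S hS.2 hS.1) 2
      _ = (Fᶜ ∩ T).card * η ^ 2 := by simp
      _ ≤ ((2 ^ k * t.size : ℕ) : ℝ) * η ^ 2 := by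
          have := (Finset.card_le_card (Finset.inter_subset_right (s₁ := Fᶜ) (s₂ := T))).trans
            (t.card_spectrum_truncate k)
          gcongr
      _ = _ := by push_cast; ring
  have h2 : ∑ S ∈ Fᶜ \ T, coeff μ t.val S ^ 2 ≤ 4 * (t.size * (1 - c) ^ k) := by
    calc ∑ S ∈ Fᶜ \ T, coeff μ t.val S ^ 2
        = ∑ S ∈ Fᶜ \ T, coeff μ (fun x => t.val x - (t.truncate k).val x) S ^ 2 :=
          Finset.sum_congr rfl fun S hS => by
            rw [coeff_sub, DecisionTree.coeff_eq_zero hμ' (ht.truncate k) (Finset.mem_sdiff.1 hS).2,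
              sub_zero]
      _ ≤ ∑ S, coeff μ (fun x => t.val x - (t.truncate k).val x) S ^ 2 :=
          Finset.sum_le_univ_sum_of_nonneg fun i => sq_nonneg _
      _ = expect μ fun x => (t.val x - (t.truncate k).val x) ^ 2 := sum_coeff_sq hμ' _
      _ ≤ expect μ fun x => 4 * (if t.eval x ≠ (t.truncate k).eval x then 1 else 0) :=
          expect_mono hμ' fun x => by
            unfold DecisionTree.val
            rcases Int.units_eq_one_or (t.eval x) with h | h <;>
              rcases Int.units_eq_one_or ((t.truncate k).eval x) with h' | h' <;>
              rw [h, h'] <;> norm_num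
      _ ≤ _ := by
          rw [expect_const_mul]
          have := DecisionTree.expect_eval_ne_truncate hc (by linarith) hμ ht k
          gcongr
  have h3 := Finset.sum_inter_add_sum_sdiff Fᶜ T fun S => coeff μ t.val S ^ 2
  linarith

end

/-! ## The smoothed guarantee -/

theorem log_le_half {y : ℝ} (hy : 0 < y) : Real.log y ≤ y / 2 := by
  have h1 := Real.log_le_sub_one_of_pos (half_pos hy)
  rw [Real.log_div hy.ne' two_ne_zero] at h1
  linarith [Real.log_two_lt_d9]

theorem pow_le_rpow_of_le_log {M y a k : ℝ} (hM : 1 ≤ M) (hy : 0 < y) {d : ℕ}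
    (hd : (d : ℝ) ≤ k * Real.log M) (ha : k * (y / 2) ≤ a) : y ^ d ≤ M ^ a := by
  have hL := Real.log_nonneg hM
  rw [Real.rpow_def_of_pos (by linarith), ← Real.rpow_natCast, Real.rpow_def_of_pos hy]
  refine Real.exp_le_exp.2 ?_
  calc Real.log y * d ≤ y / 2 * d := by
        gcongr; exact log_le_half hy
    _ ≤ y / 2 * (k * Real.log M) := by gcongr
    _ = Real.log M * (k * (y / 2)) := by ring
    _ ≤ _ := by gcongr

section

variable {n m : ℕ} {μ : Fin n → ℝ}

theorem bitNorm_sq_le {p u : ℝ} (hu : 0 < u) (hp : |2 * p - 1| ≤ 1 - u) (b : Bool) :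
    bitNorm p b ^ 2 ≤ 2 / u := by
  obtain ⟨h1, h2⟩ := abs_le.1 hp
  have hp0 : 0 < p := by linarith
  have hp1 : 0 < 1 - p := by linarith
  rw [div_eq_mul_inv, ← inv_inv (2 : ℝ), ← mul_inv]
  cases b
  · rw [bitNorm_false, div_pow, Real.sq_sqrt (by positivity),
      show (-p) ^ 2 / (p * (1 - p)) = p / (1 - p) by field_simp, div_le_iff₀ hp1,
      inv_mul_eq_div, le_div_iff₀ (by positivity)]
    nlinarith
  · rw [bitNorm_true, div_pow, Real.sq_sqrt (by positivity),
      show (1 - p) ^ 2 / (p * (1 - p)) = (1 - p) / p by field_simp, div_le_iff₀ hp0,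
      inv_mul_eq_div, le_div_iff₀ (by positivity)]
    nlinarith

theorem abs_character_le {ν0 u : ℝ} (hu : 0 < u) (hu' : u ≤ 1) (hν : ν0 = 1 - u)
    (hμ : ∀ i, |2 * μ i - 1| ≤ ν0) {M : ℝ} (hM : 1 ≤ M) {r : ℕ}
    (hr : (r : ℝ) ≤ Real.log M / 12 * u) {S : Finset (Fin n)} (hS : S.card ≤ r)
    (x : Fin n → Bool) : |character μ S x| ≤ M ^ (1 / 24 : ℝ) := by
  have hpos : 0 ≤ M ^ (1 / 24 : ℝ) := Real.rpow_nonneg (by linarith) _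
  refine abs_le_of_sq_le_sq ?_ hpos
  calc character μ S x ^ 2 = ∏ i ∈ S, bitNorm (μ i) (x i) ^ 2 := by
        rw [character, Finset.prod_pow]
    _ ≤ ∏ i ∈ S, 2 / u := Finset.prod_le_prod (fun _ _ => sq_nonneg _)
        fun i _ => bitNorm_sq_le hu (hν ▸ hμ i) _
    _ = (2 / u) ^ S.card := Finset.prod_const _
    _ ≤ (2 / u) ^ r := by
        refine pow_le_pow_right₀ ?_ hS
        rw [one_le_div hu]; linarith
    _ ≤ M ^ (1 / 12 : ℝ) := by
        refine pow_le_rpow_of_le_log hM (by positivity) (k := u / 12) (hr.trans (le_of_eq (by ring))) ?_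
        field_simp; norm_num
    _ = (M ^ (1 / 24 : ℝ)) ^ 2 := by
        rw [← Real.rpow_natCast, ← Real.rpow_mul (by linarith)]; norm_num

/-- The depth at which trees are truncated in the analysis. -/
def truncationDepth (c : ℝ) (m : ℕ) : ℕ := ⌊c / 144 * Real.log m⌋₊

theorem truncationDepth_le {c : ℝ} (hc : 0 < c) (hm : 1 ≤ m) :
    (truncationDepth c m : ℝ) ≤ c / 144 * Real.log m :=
  Nat.floor_le (mul_nonneg (by positivity) (Real.log_nonneg (by exact_mod_cast hm)))

theorem pow_truncationDepth_le {c : ℝ} (hc : 0 < c) (hm : 1 ≤ m) :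
    (12 / c) ^ truncationDepth c m ≤ (m : ℝ) ^ (1 / 24 : ℝ) :=
  pow_le_rpow_of_le_log (by exact_mod_cast hm) (by positivity) (truncationDepth_le hc hm)
    (by field_simp; norm_num)

theorem two_pow_truncationDepth_le {c : ℝ} (hc : 0 < c) (hc1 : c ≤ 1 / 4) (hm : 1 ≤ m) :
    (2 : ℝ) ^ truncationDepth c m ≤ (m : ℝ) ^ (1 / 24 : ℝ) :=
  le_trans (pow_le_pow_left₀ (by norm_num) (by rw [le_div_iff₀ hc]; linarith) _)
    (pow_truncationDepth_le hc hm)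

theorem one_sub_pow_truncationDepth_le {c : ℝ} (hc : 0 < c) (hc1 : c ≤ 1 / 4) (hm : 1 ≤ m) :
    (1 - c) ^ truncationDepth c m ≤ 2 * (m : ℝ) ^ (-(c ^ 2 / 144)) := by
  have hm' : (0 : ℝ) < m := by exact_mod_cast hm
  have h1 : c / 144 * Real.log m - 1 ≤ truncationDepth c m := (Nat.sub_one_lt_floor _).le
  have h2 : 1 - c ≤ Real.exp (-c) := by linarith [Real.add_one_le_exp (-c)]
  calc (1 - c) ^ truncationDepth c m ≤ Real.exp (-c) ^ truncationDepth c m :=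
        pow_le_pow_left₀ (by linarith) h2 _
    _ = Real.exp (truncationDepth c m * -c) := by rw [← Real.exp_nat_mul]
    _ ≤ Real.exp (c + Real.log m * -(c ^ 2 / 144)) := Real.exp_le_exp.2 (by nlinarith)
    _ = Real.exp c * (m : ℝ) ^ (-(c ^ 2 / 144)) := by rw [Real.exp_add, Real.rpow_def_of_pos hm']
    _ ≤ _ := by
        gcongr
        have : Real.exp c ≤ Real.exp (Real.log 2) :=
          Real.exp_le_exp.2 (by linarith [Real.log_two_gt_d9])
        rwa [Real.exp_log (by norm_num)] at this

theorem one_sub_iSup_ge {c : ℝ} (hn : 1 ≤ n) (hμ : ∀ i, c ≤ μ i ∧ μ i ≤ 1 - c) :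
    2 * c ≤ 1 - ⨆ i, |meanPM μ i| := by
  have : Nonempty (Fin n) := ⟨⟨0, hn⟩⟩
  have : ⨆ i, |meanPM μ i| ≤ 1 - 2 * c := ciSup_le fun i => by
    rw [meanPM, abs_le]
    constructor <;> linarith [(hμ i).1, (hμ i).2]
  linarith

theorem truncationDepth_le_rounds {c : ℝ} (hc : 0 < c) (hm : 1 ≤ m) (hn : 1 ≤ n)
    (hμ : ∀ i, c ≤ μ i ∧ μ i ≤ 1 - c) : truncationDepth c m ≤ rounds m (meanPM μ) := by
  refine Nat.floor_le_floor ?_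
  have h1 := one_sub_iSup_ge hn hμ
  have hL : 0 ≤ Real.log m := Real.log_nonneg (by exact_mod_cast hm)
  nlinarith

theorem abs_character_le_of_card_le_rounds {c : ℝ} (hc : 0 < c) (hm : 1 ≤ m) (hn : 1 ≤ n)
    (hμ : ∀ i, c ≤ μ i ∧ μ i ≤ 1 - c) {S : Finset (Fin n)} (hS : S.card ≤ rounds m (meanPM μ))
    (x : Fin n → Bool) : |character μ S x| ≤ (m : ℝ) ^ (1 / 24 : ℝ) := by
  have h1 := one_sub_iSup_ge hn hμ
  have hL : 0 ≤ Real.log m := Real.log_nonneg (by exact_mod_cast hm)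
  have h0 : 0 ≤ ⨆ i, |meanPM μ i| := Real.iSup_nonneg fun i => abs_nonneg _
  refine abs_character_le (ν0 := ⨆ i, |meanPM μ i|) (u := 1 - ⨆ i, |meanPM μ i|) (by linarith)
    (by linarith) (by ring) (fun i => ?_) (by exact_mod_cast hm) (Nat.floor_le ?_) hS x
  · exact le_ciSup (f := fun i => |meanPM μ i|) (Set.finite_range _).bddAbove i
  · exact mul_nonneg (by positivity) (by linarith)

/-- Persistence: a large coefficient of a set in the spectrum of the truncated tree forces all
coefficients of its subsets to be fairly large. -/
def Persistent (t : DecisionTree n) (k : ℕ) (η α : ℝ) (μ : Fin n → ℝ) : Prop :=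
  ∀ S ∈ (t.truncate k).spectrum, ∀ T ⊆ S, η < |coeff μ t.val S| → α ≤ |coeff μ t.val T|

theorem persistent_of_partialMean {c : ℝ} (hc : 0 < c) (hc1 : c ≤ 1 / 4)
    (hμ : ∀ i, c ≤ μ i ∧ μ i ≤ 1 - c) {t : DecisionTree n} {k : ℕ} {η α : ℝ} (hα : 0 ≤ α)
    (h : ∀ S ∈ (t.truncate k).spectrum, ∀ T ⊆ S,
      ¬ (η ≤ |partialMean t.val S μ| ∧ |partialMean t.val T μ| ≤ α / c ^ k)) :
    Persistent t k η α μ := by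
  intro S hS T hT hlarge
  have hμ' : Interior μ := fun i => ⟨by linarith [(hμ i).1], by linarith [(hμ i).2]⟩
  have hsq : ∀ i, c ≤ Real.sqrt (μ i * (1 - μ i)) ∧ Real.sqrt (μ i * (1 - μ i)) ≤ 1 := fun i => by
    obtain ⟨h1, h2⟩ := hμ i
    constructor
    · exact Real.le_sqrt_of_sq_le (by nlinarith)
    · rw [Real.sqrt_le_one]; nlinarith
  have hprod : ∀ S : Finset (Fin n), c ^ S.card ≤ ∏ i ∈ S, Real.sqrt (μ i * (1 - μ i)) ∧
      ∏ i ∈ S, Real.sqrt (μ i * (1 - μ i)) ≤ 1 := fun S => by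
    constructor
    · rw [← Finset.prod_const]
      exact Finset.prod_le_prod (fun _ _ => hc.le) fun i _ => (hsq i).1
    · exact Finset.prod_le_one (fun _ _ => Real.sqrt_nonneg _) fun i _ => (hsq i).2
  have habs : ∀ S, |coeff μ t.val S| =
      (∏ i ∈ S, Real.sqrt (μ i * (1 - μ i))) * |partialMean t.val S μ| := fun S => by
    rw [coeff_eq_partialMean hμ', abs_mul, abs_of_nonneg (Finset.prod_nonneg fun _ _ => Real.sqrt_nonneg _)]
  have h1 : η ≤ |partialMean t.val S μ| := by
    rw [habs] at hlarge
    nlinarith [(hprod S).2, abs_nonneg (partialMean t.val S μ)]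
  have h2 := not_le.1 fun h2 => h S hS T hT ⟨h1, h2⟩
  have hcard : T.card ≤ k := (Finset.card_le_card hT).trans (t.card_le_of_mem_spectrum_truncate k hS)
  have hck : 0 < c ^ k := by positivity
  have h3 : c ^ k ≤ c ^ T.card := pow_le_pow_of_le_one hc.le (by linarith) hcard
  rw [habs]
  calc α = c ^ k * (α / c ^ k) := by field_simp
    _ ≤ (∏ i ∈ T, Real.sqrt (μ i * (1 - μ i))) * |partialMean t.val T μ| :=
      mul_le_mul (h3.trans (hprod T).1) h2.le (by positivity)
        (Finset.prod_nonneg fun _ _ => Real.sqrt_nonneg _)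

theorem uniformCube_not_persistent_le {c : ℝ} (hc : 0 < c) (hc1 : c ≤ 1 / 4) (μbar : Fin n → ℝ)
    (t : DecisionTree n) (k : ℕ) {η α : ℝ} (hη : 0 < η) (hα : 0 < α) :
    uniformCube n c (⋃ S ∈ (t.truncate k).spectrum, ⋃ T ∈ S.powerset,
      {Δ | η ≤ |partialMean t.val S (μbar + Δ)| ∧
        |partialMean t.val T (μbar + Δ)| ≤ α / c ^ k}) ≤
      ENNReal.ofReal (t.size * (12 / c) ^ k * Real.sqrt (α / η)) := by
  have hsc := Real.sqrt_pos.2 hc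
  have hb : ∀ S ∈ (t.truncate k).spectrum, ∀ T ∈ S.powerset, uniformCube n c
      {Δ | η ≤ |partialMean t.val S (μbar + Δ)| ∧
        |partialMean t.val T (μbar + Δ)| ≤ α / c ^ k} ≤
      ENNReal.ofReal ((3 / c) ^ k * Real.sqrt (α / η)) := fun S hS T hT => by
    refine (uniformCube_partialMean_small_le hc μbar t.val (Finset.mem_powerset.1 hT) hη
      (by positivity) (by linarith)).trans (ENNReal.ofReal_le_ofReal ?_)
    have e : α / c ^ k / η = ((1 / Real.sqrt c) ^ k) ^ 2 * (α / η) := by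
      rw [← pow_mul, mul_comm k 2, pow_mul, div_pow, Real.sq_sqrt hc.le]
      rw [div_pow, one_pow]
      field_simp
      rw [one_pow]
    rw [e, Real.sqrt_mul (by positivity), Real.sqrt_sq (by positivity), ← mul_assoc]
    gcongr
    have h3 : 1 ≤ 3 / Real.sqrt c := by
      rw [one_le_div hsc, Real.sqrt_le_left (by norm_num)]; linarith
    calc (3 / Real.sqrt c) ^ S.card * (1 / Real.sqrt c) ^ k
        ≤ (3 / Real.sqrt c) ^ k * (1 / Real.sqrt c) ^ k := by
          gcongr
          exact t.card_le_of_mem_spectrum_truncate k hS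
      _ = (3 / c) ^ k := by
          rw [← mul_pow, div_mul_div_comm, Real.mul_self_sqrt hc.le, mul_one]
  refine (measure_biUnion_finset_le _ _).trans ((Finset.sum_le_sum fun S hS =>
    (measure_biUnion_finset_le _ _).trans (Finset.sum_le_sum fun T hT => hb S hS T hT)).trans ?_)
  have h1 : ∀ S ∈ (t.truncate k).spectrum,
      ∑ T ∈ S.powerset, ENNReal.ofReal ((3 / c) ^ k * Real.sqrt (α / η)) ≤
        ((2 ^ k : ℕ) : ENNReal) * ENNReal.ofReal ((3 / c) ^ k * Real.sqrt (α / η)) := fun S hS => by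
    rw [Finset.sum_const, nsmul_eq_mul, Finset.card_powerset]
    gcongr
    · norm_num
    · exact t.card_le_of_mem_spectrum_truncate k hS
  refine (Finset.sum_le_sum h1).trans ?_
  rw [Finset.sum_const, nsmul_eq_mul, ← mul_assoc]
  calc _ ≤ ((2 ^ k * t.size : ℕ) : ENNReal) * ((2 ^ k : ℕ) : ENNReal) *
        ENNReal.ofReal ((3 / c) ^ k * Real.sqrt (α / η)) := by
        gcongr; exact t.card_spectrum_truncate k
    _ = _ := by
        rw [← Nat.cast_mul, ← ENNReal.ofReal_natCast, ← ENNReal.ofReal_mul (by positivity)]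
        congr 1
        push_cast
        rw [show (12 : ℝ) / c = 2 * 2 * (3 / c) by ring, mul_pow, mul_pow]
        ring

end

section

variable {n m : ℕ} {μ : Fin n → ℝ}

theorem rpow_neg_le_rpow_neg {M a b : ℝ} (hM : 1 ≤ M) (hab : a ≤ b) : M ^ (-b) ≤ M ^ (-a) :=
  Real.rpow_le_rpow_of_exponent_le hM (neg_le_neg hab)

theorem card_le_of_accurate {N τ t : ℝ} (hμ : Interior μ) {f : (Fin n → Bool) → ℤˣ} {r : ℕ}
    {e : Finset (Fin n) → ℝ} (hτ : 0 < τ) (htτ : t ≤ τ / 2) (hN : 1 + 4 / τ ^ 2 ≤ N)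
    (hacc : ∀ S : Finset (Fin n), S.card ≤ r → |e S - coeff μ (fun x => ((f x : ℤ) : ℝ)) S| ≤ t)
    {F : Finset (Finset (Fin n))} (hF : ∀ S ∈ F, S.card ≤ r ∧ (S = ∅ ∨ τ ≤ |e S|)) :
    (F.card : ℝ) ≤ N := by
  have h1 : ∑ S, coeff μ (fun x => ((f x : ℤ) : ℝ)) S ^ 2 ≤ 1 := by
    rw [sum_coeff_sq hμ, ← expect_const μ 1]
    refine expect_mono hμ fun x => ?_
    rw [← sq_abs, abs_units_cast, one_pow]
  have h2 := card_mul_le_of_le_abs h1 (F := F.erase ∅) (half_pos hτ).le fun S hS => by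
    obtain ⟨hne, hS⟩ := Finset.mem_erase.1 hS
    have h3 := (hF S hS).2.resolve_left hne
    have h4 := hacc S (hF S hS).1
    have h5 := abs_sub_abs_le_abs_sub (e S) (coeff μ (fun x => ((f x : ℤ) : ℝ)) S)
    linarith
  have h3 : (F.card : ℝ) ≤ (F.erase ∅).card + 1 := by
    exact_mod_cast Nat.sub_le_iff_le_add.1 Finset.pred_card_le_card_erase
  have h4 : ((F.erase ∅).card : ℝ) ≤ 4 / τ ^ 2 := by
    rw [le_div_iff₀ (by positivity)]
    nlinarith
  linarith

/-- The algorithm succeeds when the empirical coefficients are accurate and the Fourier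
coefficients of the tree are persistent. -/
theorem success_of_accurate {c : ℝ} (hc : 0 < c) (hc1 : c ≤ 1 / 4) (hm : 1 ≤ m) (hn : 1 ≤ n)
    (hμ : ∀ i, c ≤ μ i ∧ μ i ≤ 1 - c) {f : (Fin n → Bool) → ℤˣ} {t : DecisionTree n}
    (ht : t.ReadOnce) (htf : ∀ x, t.eval x = f x) {ε : ℝ} (hε : 0 < ε)
    (h1 : 16 * (t.size / ε) ≤ (m : ℝ) ^ (c ^ 2 / 144)) (h2 : 16 ≤ (m : ℝ) ^ (c ^ 2 / 144))
    (hp : Persistent t (truncationDepth c m) ((m : ℝ) ^ (-(1 / 6) : ℝ))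
      (2 * (m : ℝ) ^ (-(1 / 3) : ℝ)) μ)
    {X : Fin m → Fin n → Bool}
    (hacc : ∀ S : Finset (Fin n), S.card ≤ rounds m (meanPM μ) →
      |estimate (meanPM μ) (fun j => toPM (X j)) (fun j => f (X j)) S -
        coeff μ (fun x => ((f x : ℤ) : ℝ)) S| ≤ (m : ℝ) ^ (-(2 / 5) : ℝ)) :
    Success f ε μ X := by
  have hμ' : Interior μ := fun i => ⟨by linarith [(hμ i).1], by linarith [(hμ i).2]⟩
  have hval : (fun x => ((f x : ℤ) : ℝ)) = t.val := funext fun x => by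
    rw [DecisionTree.val, htf]
  have hM1 : 1 ≤ (m : ℝ) := by exact_mod_cast hm
  have hM0 : 0 < (m : ℝ) := by linarith
  set lam : ℝ := c ^ 2 / 144 with hlam
  have hlam1 : lam ≤ 1 / 48 := by rw [hlam]; nlinarith
  set e : Finset (Fin n) → ℝ :=
    estimate (meanPM μ) (fun j => toPM (X j)) (fun j => f (X j)) with he
  set r := rounds m (meanPM μ) with hr
  set d := truncationDepth c m with hd
  have hdr : d ≤ r := truncationDepth_le_rounds hc hm hn hμ
  have hMlam : 0 < (m : ℝ) ^ lam := Real.rpow_pos_of_pos hM0 _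
  have hneg : (m : ℝ) ^ (-lam) ≤ 1 / 16 := by
    rw [Real.rpow_neg hM0.le, ← one_div]
    exact one_div_le_one_div_of_le (by norm_num) h2
  have hτ : 0 < (m : ℝ) ^ (-(1 / 3) : ℝ) := Real.rpow_pos_of_pos hM0 _
  have hmul : ∀ a b : ℝ, (m : ℝ) ^ a * (m : ℝ) ^ b = (m : ℝ) ^ (a + b) := fun a b => (Real.rpow_add hM0 a b).symm
  have hsmall : ∀ a : ℝ, lam ≤ a → (m : ℝ) ^ (-a) ≤ 1 / 16 := fun a ha =>
    (rpow_neg_le_rpow_neg hM1 ha).trans hneg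
  have htτ : (m : ℝ) ^ (-(2 / 5) : ℝ) ≤ (m : ℝ) ^ (-(1 / 3) : ℝ) / 2 := by
    have h := hsmall (1 / 15) (by linarith)
    rw [show (-(2 / 5) : ℝ) = -(1 / 3) + -(1 / 15) by norm_num, ← hmul]
    nlinarith
  have h23 : 1 + 4 / ((m : ℝ) ^ (-(1 / 3) : ℝ)) ^ 2 = 1 + 4 * (m : ℝ) ^ (2 / 3 : ℝ) := by
    rw [← Real.rpow_natCast, ← Real.rpow_mul hM0.le, div_eq_mul_inv, ← Real.rpow_neg hM0.le]
    norm_num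
  have h23' : 1 ≤ (m : ℝ) ^ (2 / 3 : ℝ) := Real.one_le_rpow hM1 (by norm_num)
  have hN : 1 + 4 / ((m : ℝ) ^ (-(1 / 3) : ℝ)) ^ 2 ≤ (m : ℝ) := by
    have h := h2.trans (Real.rpow_le_rpow_of_exponent_le hM1 (show lam ≤ 1 / 3 by linarith))
    have h' : (m : ℝ) ^ (2 / 3 : ℝ) * (m : ℝ) ^ (1 / 3 : ℝ) = m := by
      rw [hmul]; norm_num
    rw [h23]
    nlinarith
  obtain ⟨F, hF, hF1, hF2⟩ := features_eq_some (ν := meanPM μ) (x := fun j => toPM (X j))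
    (y := fun j => f (X j)) r (fun F hF => by
      exact_mod_cast card_le_of_accurate hμ' hτ htτ hN hacc hF) (le_refl r)
  refine success_of_expect_le hμ' hF ?_
  rw [hval] at hacc
  have hgoal : expect μ (fun x => (∑ S ∈ F, e S * character μ S x - t.val x) ^ 2) ≤ ε := by
    rw [expect_partial_sum_sub_sq hμ']
    have hA : ∑ S ∈ F, (e S - coeff μ t.val S) ^ 2 ≤ 5 * (m : ℝ) ^ (-lam) := by
      calc ∑ S ∈ F, (e S - coeff μ t.val S) ^ 2 ≤ ∑ S ∈ F, ((m : ℝ) ^ (-(2 / 5) : ℝ)) ^ 2 :=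
            Finset.sum_le_sum fun S hS => by
              rw [← sq_abs]; exact pow_le_pow_left₀ (abs_nonneg _) (hacc S (hF1 S hS).1) 2
        _ = F.card * (m : ℝ) ^ (-(4 / 5) : ℝ) := by
            rw [Finset.sum_const, nsmul_eq_mul, ← Real.rpow_natCast, ← Real.rpow_mul hM0.le]
            norm_num
        _ ≤ (5 * (m : ℝ) ^ (2 / 3 : ℝ)) * (m : ℝ) ^ (-(4 / 5) : ℝ) := by
            have := card_le_of_accurate hμ' hτ htτ (le_refl _) (hval ▸ hacc) hF1
            rw [h23] at this
            gcongr
            linarith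
        _ = 5 * (m : ℝ) ^ (-(2 / 15) : ℝ) := by
            rw [mul_assoc, hmul]; norm_num
        _ ≤ _ := by
            exact mul_le_mul_of_nonneg_left (rpow_neg_le_rpow_neg hM1 (by linarith)) (by positivity)
    have hB := sum_compl_coeff_sq_le hc (by linarith) hμ ht d (F := F)
      (η := (m : ℝ) ^ (-(1 / 6) : ℝ)) fun S hS hSF => by
        by_contra hlarge
        refine hSF (hF2 S ((t.card_le_of_mem_spectrum_truncate d hS).trans hdr) fun T hT _ => ?_)
        have h3 := hp S hS T hT (not_le.1 hlarge)
        have h4 := hacc T ((Finset.card_le_card hT).trans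
          ((t.card_le_of_mem_spectrum_truncate d hS).trans hdr))
        have h5 := abs_sub_abs_le_abs_sub (coeff μ t.val T) (e T)
        rw [abs_sub_comm] at h5
        linarith
    have hB1 : (2 : ℝ) ^ d * t.size * ((m : ℝ) ^ (-(1 / 6) : ℝ)) ^ 2 ≤ t.size * (m : ℝ) ^ (-lam) := by
      calc (2 : ℝ) ^ d * t.size * ((m : ℝ) ^ (-(1 / 6) : ℝ)) ^ 2
          ≤ (m : ℝ) ^ (1 / 24 : ℝ) * t.size * ((m : ℝ) ^ (-(1 / 6) : ℝ)) ^ 2 := by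
            have := two_pow_truncationDepth_le hc hc1 hm
            gcongr
        _ = t.size * (m : ℝ) ^ (-(7 / 24) : ℝ) := by
            rw [← Real.rpow_natCast, ← Real.rpow_mul hM0.le, mul_comm ((m : ℝ) ^ _) (t.size : ℝ), mul_assoc,
              hmul]
            norm_num
        _ ≤ _ := by
            exact mul_le_mul_of_nonneg_left (rpow_neg_le_rpow_neg hM1 (by linarith)) (by positivity)
    have hB2 : 4 * (t.size * (1 - c) ^ d) ≤ 8 * (t.size * (m : ℝ) ^ (-lam)) := by
      have := one_sub_pow_truncationDepth_le hc hc1 hm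
      have h4 : (t.size : ℝ) * (1 - c) ^ d ≤ t.size * (2 * (m : ℝ) ^ (-lam)) := by gcongr
      linarith
    have hs : (1 : ℝ) ≤ t.size := by exact_mod_cast t.one_le_size
    have hfin : 16 * (t.size * (m : ℝ) ^ (-lam)) ≤ ε := by
      rw [Real.rpow_neg hM0.le, ← div_eq_mul_inv, ← mul_div_assoc, div_le_iff₀ hMlam]
      rw [← mul_div_assoc, div_le_iff₀ hε] at h1
      linarith
    have hpos : 0 < (m : ℝ) ^ (-lam) := Real.rpow_pos_of_pos hM0 _
    nlinarith
  rw [← hval] at hgoal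
  exact hgoal

theorem le_measure_of_compl_le {Ω : Type*} [MeasurableSpace Ω] {P : Measure Ω}
    [IsProbabilityMeasure P] {A : Set Ω} (hA : MeasurableSet A) {p : ℝ} (hp : 0 ≤ p)
    (h : P Aᶜ ≤ ENNReal.ofReal p) : ENNReal.ofReal (1 - p) ≤ P A := by
  rw [ENNReal.ofReal_sub _ hp, ENNReal.ofReal_one, tsub_le_iff_right,
    ← prob_add_prob_compl (μ := P) hA]
  gcongr

theorem le_sampleLaw_success {c : ℝ} (hc : 0 < c) (hc1 : c ≤ 1 / 4) (hm : 1 ≤ m) (hn : 1 ≤ n)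
    (hμ : ∀ i, c ≤ μ i ∧ μ i ≤ 1 - c) {f : (Fin n → Bool) → ℤˣ} {t : DecisionTree n}
    (ht : t.ReadOnce) (htf : ∀ x, t.eval x = f x) {ε δ : ℝ} (hε : 0 < ε) (hδ : 0 < δ)
    (h1 : 16 * (t.size / ε) ≤ (m : ℝ) ^ (c ^ 2 / 144)) (h2 : 16 * n ≤ (m : ℝ) ^ (c ^ 2 / 144))
    (h3 : 16 / δ ≤ (m : ℝ) ^ (c ^ 2 / 144))
    (hp : Persistent t (truncationDepth c m) ((m : ℝ) ^ (-(1 / 6) : ℝ))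
      (2 * (m : ℝ) ^ (-(1 / 3) : ℝ)) μ) :
    ENNReal.ofReal (1 - δ / 2) ≤ sampleLaw μ m {X | Success f ε μ X} := by
  have hμ' : Interior μ := fun i => ⟨by linarith [(hμ i).1], by linarith [(hμ i).2]⟩
  have hP := sampleLaw_isProbabilityMeasure hμ' m
  have hM1 : (1 : ℝ) ≤ m := by exact_mod_cast hm
  have hM0 : (0 : ℝ) < m := by linarith
  have hn1 : (1 : ℝ) ≤ n := by exact_mod_cast hn
  have hfar := sampleLaw_exists_estimate_far hμ' (m := m) (by omega) f
    (Real.rpow_pos_of_pos hM0 (1 / 24)) (rounds m (meanPM μ))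
    (fun S hS x => abs_character_le_of_card_le_rounds hc hm hn hμ hS x)
    (Real.rpow_nonneg hM0.le (-(2 / 5)))
  have hexp : (m : ℝ) * ((m : ℝ) ^ (-(2 / 5) : ℝ)) ^ 2 / (2 * ((m : ℝ) ^ (1 / 24 : ℝ)) ^ 2) =
      (m : ℝ) ^ (7 / 60 : ℝ) / 2 := by
    have e : (m : ℝ) ^ (7 / 60 : ℝ) * ((m : ℝ) ^ (1 / 24 : ℝ)) ^ 2 =
        (m : ℝ) * ((m : ℝ) ^ (-(2 / 5) : ℝ)) ^ 2 := by
      nth_rw 3 [← Real.rpow_one (m : ℝ)]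
      simp only [← Real.rpow_natCast, ← Real.rpow_mul hM0.le, ← Real.rpow_add hM0]
      norm_num
    have hpos : 0 < (m : ℝ) ^ (1 / 24 : ℝ) := Real.rpow_pos_of_pos hM0 _
    rw [← e]
    field_simp
  rw [hexp] at hfar
  have hlam1 : c ^ 2 / 144 ≤ 7 / 60 := by nlinarith
  have hle := Real.rpow_le_rpow_of_exponent_le hM1 hlam1
  have hprob : (2 : ℝ) ^ n * (2 * Real.exp (-((m : ℝ) ^ (7 / 60 : ℝ) / 2))) ≤ δ / 2 := by
    have h4 : (2 : ℝ) ^ n ≤ Real.exp n := by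
      rw [← Real.exp_one_pow]
      exact pow_le_pow_left₀ (by norm_num) (by linarith [Real.add_one_le_exp 1]) n
    have h5 : (n : ℝ) + 4 / δ ≤ (m : ℝ) ^ (7 / 60 : ℝ) / 2 := by
      have : 4 / δ = 16 / δ / 4 := by ring
      linarith
    calc (2 : ℝ) ^ n * (2 * Real.exp (-((m : ℝ) ^ (7 / 60 : ℝ) / 2)))
        ≤ Real.exp n * (2 * Real.exp (-(n + 4 / δ))) := by gcongr
      _ = 2 * Real.exp (-(4 / δ)) := by
          rw [neg_add, Real.exp_add, Real.exp_neg (n : ℝ)]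
          field_simp
      _ ≤ 2 * (δ / 4) := by
          gcongr
          rw [Real.exp_neg, inv_le_comm₀ (Real.exp_pos _) (by positivity), inv_div]
          linarith [Real.add_one_le_exp (4 / δ)]
      _ = _ := by ring
  refine (le_measure_of_compl_le (Set.toFinite _).measurableSet (by linarith) ?_).trans
    (measure_mono fun X hX => success_of_accurate hc hc1 hm hn hμ ht htf hε h1 (by linarith) hp hX)
  exact hfar.trans (ENNReal.ofReal_le_ofReal hprob)

end

theorem le_smoothedProb_success {c : ℝ} (hc : 0 < c) (hc1 : c ≤ 1 / 4) {n m s : ℕ} (hm : 1 ≤ m)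
    (hn : 1 ≤ n) {f : (Fin n → Bool) → ℤˣ} (hf : ComputedByTree s f) {ε δ : ℝ} (hε : 0 < ε)
    (hδ : 0 < δ) (hδ1 : δ ≤ 1) {μbar : Fin n → ℝ} (hμ : ∀ i, μbar i ∈ Set.Icc (2 * c) (1 - 2 * c))
    (h1 : 16 * (s / ε) ≤ (m : ℝ) ^ (c ^ 2 / 144)) (h2 : 16 * n ≤ (m : ℝ) ^ (c ^ 2 / 144))
    (h3 : 16 * (s / δ) ≤ (m : ℝ) ^ (c ^ 2 / 144)) :
    ENNReal.ofReal (1 - δ) ≤ smoothedProb c μbar m (fun Δ X => Success f ε (μbar + Δ) X) := by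
  obtain ⟨t, ht, hts, htf⟩ := hf
  have hts' : (t.size : ℝ) ≤ s := by exact_mod_cast hts
  have hs1 : (1 : ℝ) ≤ t.size := by exact_mod_cast t.one_le_size
  have hM1 : (1 : ℝ) ≤ m := by exact_mod_cast hm
  have hM0 : (0 : ℝ) < m := by linarith
  have := uniformInterval_isProbabilityMeasure hc
  have hprob : IsProbabilityMeasure (uniformCube n c) := by
    rw [uniformCube_eq_pi n hc]; infer_instance
  set η : ℝ := (m : ℝ) ^ (-(1 / 6) : ℝ) with hη
  set α : ℝ := 2 * (m : ℝ) ^ (-(1 / 3) : ℝ) with hα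
  have hη0 : 0 < η := Real.rpow_pos_of_pos hM0 _
  have hα0 : 0 < α := mul_pos two_pos (Real.rpow_pos_of_pos hM0 _)
  set k := truncationDepth c m with hk
  set Q : Set (Fin n → ℝ) := Set.Icc (fun _ => -c) (fun _ => c) with hQ
  set bad : Set (Fin n → ℝ) := ⋃ S ∈ (t.truncate k).spectrum, ⋃ T ∈ S.powerset,
      {Δ | η ≤ |partialMean t.val S (μbar + Δ)| ∧
        |partialMean t.val T (μbar + Δ)| ≤ α / c ^ k} with hbad
  have hmeas : ∀ T, Measurable fun Δ => partialMean t.val T (μbar + Δ) := fun T =>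
    (continuous_partialMean t.val T).measurable.comp (measurable_const_add μbar)
  have hbadm : MeasurableSet bad :=
    Finset.measurableSet_biUnion _ fun S _ => Finset.measurableSet_biUnion _ fun T _ =>
      (measurableSet_le measurable_const (hmeas S).norm).inter
        (measurableSet_le (hmeas T).norm measurable_const)
  have hQm : MeasurableSet Q := measurableSet_Icc
  have hQ0 : uniformCube n c Qᶜ = 0 := by
    rw [uniformCube, ProbabilityTheory.cond_apply hQm, Set.inter_compl_self, measure_empty, mul_zero]
  have hbadP : uniformCube n c bad ≤ ENNReal.ofReal (δ / 2) := by
    refine (uniformCube_not_persistent_le hc hc1 μbar t k hη0 hα0).trans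
      (ENNReal.ofReal_le_ofReal ?_)
    have e1 : α / η = 2 * (m : ℝ) ^ (-(1 / 6) : ℝ) := by
      rw [hα, hη, mul_div_assoc, ← Real.rpow_sub hM0]; norm_num
    have e2 : Real.sqrt (α / η) ≤ 2 * (m : ℝ) ^ (-(1 / 12) : ℝ) := by
      rw [e1, Real.sqrt_le_iff]
      refine ⟨by positivity, ?_⟩
      rw [mul_pow, ← Real.rpow_natCast ((m : ℝ) ^ _), ← Real.rpow_mul hM0.le]
      norm_num
      have : 0 ≤ (m : ℝ) ^ (-(1 / 6) : ℝ) := Real.rpow_nonneg hM0.le _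
      linarith
    calc t.size * (12 / c) ^ k * Real.sqrt (α / η)
        ≤ s * (m : ℝ) ^ (1 / 24 : ℝ) * (2 * (m : ℝ) ^ (-(1 / 12) : ℝ)) := by
          have := pow_truncationDepth_le hc hm
          gcongr
      _ = 2 * (s * (m : ℝ) ^ (-(1 / 24) : ℝ)) := by
          rw [show (-(1 / 24) : ℝ) = 1 / 24 + -(1 / 12) by norm_num, Real.rpow_add hM0]
          ring
      _ ≤ 2 * (s * (m : ℝ) ^ (-(c ^ 2 / 144))) := by
          refine mul_le_mul_of_nonneg_left (mul_le_mul_of_nonneg_left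
            (rpow_neg_le_rpow_neg hM1 (by nlinarith)) (by positivity)) (by positivity)
      _ ≤ δ / 2 := by
          have hMlam : 0 < (m : ℝ) ^ (c ^ 2 / 144) := Real.rpow_pos_of_pos hM0 _
          rw [Real.rpow_neg hM0.le, ← div_eq_mul_inv, ← mul_div_assoc, div_le_iff₀ hMlam]
          rw [← mul_div_assoc, div_le_iff₀ hδ] at h3
          nlinarith
  have hgoodm : MeasurableSet (Q \ bad) := hQm.diff hbadm
  have hgoodP : ENNReal.ofReal (1 - δ / 2) ≤ uniformCube n c (Q \ bad) := by
    refine le_measure_of_compl_le hgoodm (by linarith) ?_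
    refine (measure_mono (t := Qᶜ ∪ bad) fun Δ hΔ => ?_).trans
      ((measure_union_le _ _).trans (by rw [hQ0, zero_add]; exact hbadP))
    by_cases hΔQ : Δ ∈ Q
    · right
      by_contra hb
      exact hΔ ⟨hΔQ, hb⟩
    · exact Or.inl hΔQ
  have hpt : ∀ Δ ∈ Q \ bad, ENNReal.ofReal (1 - δ / 2) ≤
      sampleLaw (μbar + Δ) m {X | Success f ε (μbar + Δ) X} := by
    rintro Δ ⟨hΔQ, hΔ⟩
    have hμΔ : ∀ i, c ≤ (μbar + Δ) i ∧ (μbar + Δ) i ≤ 1 - c := fun i => by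
      have h4 := hΔQ.1 i
      have h5 := hΔQ.2 i
      obtain ⟨h6, h7⟩ := hμ i
      simp only [Pi.add_apply]
      constructor <;> linarith
    refine le_sampleLaw_success hc hc1 hm hn hμΔ ht htf hε hδ
      (le_trans (by gcongr) h1) h2 (le_trans ?_ h3) ?_
    · rw [← mul_div_assoc]
      gcongr
      linarith
    · refine persistent_of_partialMean hc hc1 hμΔ hα0.le fun S hS T hT hST => hΔ ?_
      exact Set.mem_biUnion hS (Set.mem_biUnion (Finset.mem_powerset.2 hT) hST)
  calc ENNReal.ofReal (1 - δ) ≤ ENNReal.ofReal ((1 - δ / 2) * (1 - δ / 2)) :=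
        ENNReal.ofReal_le_ofReal (by nlinarith)
    _ = ENNReal.ofReal (1 - δ / 2) * ENNReal.ofReal (1 - δ / 2) :=
        ENNReal.ofReal_mul (by linarith)
    _ ≤ ENNReal.ofReal (1 - δ / 2) * uniformCube n c (Q \ bad) := by gcongr
    _ = ∫⁻ Δ, (Q \ bad).indicator (fun _ => ENNReal.ofReal (1 - δ / 2)) Δ ∂(uniformCube n c) :=
        (lintegral_indicator_const hgoodm _).symm
    _ ≤ _ := lintegral_mono fun Δ => Set.indicator_le' (s := Q \ bad) hpt (fun _ _ => zero_le) Δ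

/-- Smoothed learning of decision trees from polynomially many examples. -/
theorem exists_polynomial_smoothedProb_success {c : ℝ} (hc : 0 < c) (hc1 : c < 1 / 4) :
    ∃ q : Polynomial ℝ, ∀ (n s : ℕ), 1 ≤ n → 1 ≤ s →
      ∀ (ε δ : ℝ), 0 < ε → ε ≤ 1 → 0 < δ →
      ∀ (f : (Fin n → Bool) → ℤˣ), ComputedByTree s f →
      ∀ (μbar : Fin n → ℝ), (∀ i, μbar i ∈ Set.Icc (2 * c) (1 - 2 * c)) →
      ∀ m : ℕ, q.eval ((n : ℝ) * (s : ℝ) / (δ * ε)) ≤ (m : ℝ) →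
        ENNReal.ofReal (1 - δ) ≤ smoothedProb c μbar m (fun Δ X => Success f ε (μbar + Δ) X) := by
  obtain ⟨K, hK⟩ := exists_nat_ge (144 / c ^ 2)
  refine ⟨(16 * Polynomial.X) ^ K, fun n s hn hs ε δ hε hε1 hδ f hf μbar hμ m hq => ?_⟩
  rcases le_or_gt 1 δ with hδ1 | hδ1
  · rw [ENNReal.ofReal_of_nonpos (by linarith)]
    exact zero_le
  have hn' : (1 : ℝ) ≤ n := by exact_mod_cast hn
  have hs' : (1 : ℝ) ≤ s := by exact_mod_cast hs
  set N : ℝ := (n : ℝ) * (s : ℝ) / (δ * ε) with hN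
  have hns : (1 : ℝ) ≤ n * s := by nlinarith
  have hδε : δ * ε ≤ 1 := by nlinarith
  have hδε0 : 0 < δ * ε := by positivity
  have hNns : (n : ℝ) * s ≤ N := by
    rw [hN, le_div_iff₀ hδε0]; nlinarith
  have hN1 : (s : ℝ) / ε ≤ N := by
    rw [hN, div_le_div_iff₀ hε hδε0]
    have : (s : ℝ) * δ ≤ n * s := by nlinarith
    nlinarith
  have hN2 : (s : ℝ) / δ ≤ N := by
    rw [hN, div_le_div_iff₀ hδ hδε0]
    have : (s : ℝ) * ε ≤ n * s := by nlinarith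
    nlinarith
  have hN3 : (n : ℝ) ≤ N := by nlinarith
  simp only [Polynomial.eval_pow, Polynomial.eval_mul, Polynomial.eval_X, Polynomial.eval_ofNat] at hq
  have hN0 : 1 ≤ 16 * N := by linarith
  have hm1 : (1 : ℝ) ≤ m := (one_le_pow₀ hN0).trans hq
  have hm : 1 ≤ m := by exact_mod_cast hm1
  have hmain : 16 * N ≤ (m : ℝ) ^ (c ^ 2 / 144) := by
    calc 16 * N = (16 * N) ^ (1 : ℝ) := (Real.rpow_one _).symm
      _ ≤ (16 * N) ^ (K * (c ^ 2 / 144)) := by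
          refine Real.rpow_le_rpow_of_exponent_le hN0 ?_
          rw [div_le_iff₀ (by positivity)] at hK
          linarith
      _ = ((16 * N) ^ K) ^ (c ^ 2 / 144) := by
          rw [Real.rpow_mul (by linarith), Real.rpow_natCast]
      _ ≤ _ := Real.rpow_le_rpow (by positivity) hq (by positivity)
  exact le_smoothedProb_success hc hc1.le hm hn hf hε hδ hδ1.le hμ (by linarith) (by linarith)
    (by linarith)

namespace RealRAM

/-! ## A program logic with time bounds -/

/-- An upper bound for the running time of a program all of whose loops make at most `X`
iterations. -/
def Program.timePoly : Program → Polynomial ℕ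
  | .skip => 1
  | .setNat _ i j e => (i.cost + j.cost + e.cost + 1 : ℕ)
  | .setReal _ i j e => (i.cost + j.cost + e.cost + 1 : ℕ)
  | .seq p₁ p₂ => p₁.timePoly + p₂.timePoly
  | .ite b p₁ p₂ => (b.cost : Polynomial ℕ) + p₁.timePoly + p₂.timePoly
  | .loop b p => Polynomial.X * ((b.cost : Polynomial ℕ) + p.timePoly) + (b.cost : Polynomial ℕ)

/-- Started in `σ`, the program halts within the time given by `timePoly` at `B`, and `Q` holds of
the final memory. -/
def Runs (B : ℕ) (p : Program) (σ : Store) (Q : Store → Prop) : Prop :=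
  ∃ σ' t, Exec p σ σ' t ∧ t ≤ p.timePoly.eval B ∧ Q σ'

variable {B : ℕ} {σ : Store} {Q : Store → Prop}

theorem Runs.mono {p : Program} {Q' : Store → Prop} (h : Runs B p σ Q) (H : ∀ σ', Q σ' → Q' σ') :
    Runs B p σ Q' := by
  obtain ⟨σ', t, h1, h2, h3⟩ := h
  exact ⟨σ', t, h1, h2, H _ h3⟩

theorem runs_skip (h : Q σ) : Runs B .skip σ Q :=
  ⟨σ, 1, .skip σ, by simp [Program.timePoly], h⟩

theorem runs_setNat {a : ℕ} {i j e : NatExpr}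
    (h : Q (σ.setNat a (i.eval σ) (j.eval σ) (e.eval σ))) : Runs B (.setNat a i j e) σ Q :=
  ⟨_, _, .setNat σ a i j e, by simp only [Program.timePoly, Polynomial.eval_natCast, Nat.cast_id]; rfl, h⟩

theorem runs_setReal {a : ℕ} {i j : NatExpr} {e : RealExpr}
    (h : Q (σ.setReal a (i.eval σ) (j.eval σ) (e.eval σ))) : Runs B (.setReal a i j e) σ Q :=
  ⟨_, _, .setReal σ a i j e, by simp only [Program.timePoly, Polynomial.eval_natCast, Nat.cast_id]; rfl, h⟩

theorem runs_seq {p₁ p₂ : Program} (h : Runs B p₁ σ fun σ' => Runs B p₂ σ' Q) :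
    Runs B (.seq p₁ p₂) σ Q := by
  obtain ⟨σ₁, t₁, h1, h2, σ₂, t₂, h3, h4, h5⟩ := h
  exact ⟨σ₂, t₁ + t₂, .seq h1 h3, by
    simp only [Program.timePoly, Polynomial.eval_add]; omega, h5⟩

theorem runs_ite {b : Test} {p₁ p₂ : Program} (h1 : b.Holds σ → Runs B p₁ σ Q)
    (h2 : ¬ b.Holds σ → Runs B p₂ σ Q) : Runs B (.ite b p₁ p₂) σ Q := by
  by_cases hb : b.Holds σ
  · obtain ⟨σ', t, h3, h4, h5⟩ := h1 hb
    refine ⟨σ', _, .iteTrue hb h3, ?_, h5⟩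
    simp only [Program.timePoly, Polynomial.eval_add, Polynomial.eval_natCast, Nat.cast_id]
    omega
  · obtain ⟨σ', t, h3, h4, h5⟩ := h2 hb
    refine ⟨σ', _, .iteFalse hb h3, ?_, h5⟩
    simp only [Program.timePoly, Polynomial.eval_add, Polynomial.eval_natCast, Nat.cast_id]
    omega

theorem runs_loop {b : Test} {p : Program} (Inv : ℕ → Store → Prop) {N : ℕ} (hN : N ≤ B)
    (hstep : ∀ k σ, k < N → Inv k σ → b.Holds σ ∧ Runs B p σ (Inv (k + 1)))
    (hdone : ∀ σ, Inv N σ → ¬ b.Holds σ) (h0 : Inv 0 σ) : Runs B (.loop b p) σ (Inv N) := by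
  have key : ∀ r k σ, k + r = N → Inv k σ → ∃ σ' t, Exec (.loop b p) σ σ' t ∧
      t ≤ r * (b.cost + p.timePoly.eval B) + b.cost ∧ Inv N σ' := by
    intro r
    induction r with
    | zero =>
      intro k σ hk h
      obtain rfl : k = N := hk
      exact ⟨σ, _, .loopDone (hdone σ h), by simp, h⟩
    | succ r ih =>
      intro k σ hk h
      obtain ⟨hb, σ₁, t₁, h1, h2, h3⟩ := hstep k σ (by omega) h
      obtain ⟨σ₂, t₂, h4, h5, h6⟩ := ih (k + 1) σ₁ (by omega) h3
      refine ⟨σ₂, _, .loopStep hb h1 h4, ?_, h6⟩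
      rw [Nat.succ_mul]
      omega
  obtain ⟨σ', t, h1, h2, h3⟩ := key N 0 σ (by simp) h0
  refine ⟨σ', t, h1, h2.trans ?_, h3⟩
  simp only [Program.timePoly, Polynomial.eval_add, Polynomial.eval_mul, Polynomial.eval_X,
    Polynomial.eval_natCast, Nat.cast_id]
  gcongr

/-- The value of the natural-number variable `v`. -/
def natVar (v : ℕ) : NatExpr := .get v (.const 0) (.const 0)

/-- The value of the real variable `v`. -/
def realVar (v : ℕ) : RealExpr := .get v (.const 0) (.const 0)

/-- Assignment to a natural-number variable. -/
def setNatVar (v : ℕ) (e : NatExpr) : Program := .setNat v (.const 0) (.const 0) e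

/-- Assignment to a real variable. -/
def setRealVar (v : ℕ) (e : RealExpr) : Program := .setReal v (.const 0) (.const 0) e

/-- Run `p` for `v = 0, 1, …, E - 1`. -/
def forTo (v : ℕ) (E : NatExpr) (p : Program) : Program :=
  .seq (setNatVar v (.const 0))
    (.loop (.natLe (.add (natVar v) (.const 1)) E)
      (.seq p (setNatVar v (.add (natVar v) (.const 1)))))

@[simp] theorem natVar_eval (v : ℕ) (σ : Store) : (natVar v).eval σ = σ.nat v 0 0 := rfl

@[simp] theorem realVar_eval (v : ℕ) (σ : Store) : (realVar v).eval σ = σ.real v 0 0 := rfl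

@[simp] theorem setNat_real (σ : Store) (a i j v : ℕ) : (σ.setNat a i j v).real = σ.real := rfl

@[simp] theorem setReal_nat (σ : Store) (a i j : ℕ) (v : ℝ) : (σ.setReal a i j v).nat = σ.nat := rfl

theorem setNat_nat (σ : Store) (a i j v a' i' j' : ℕ) : (σ.setNat a i j v).nat a' i' j' =
    if a' = a ∧ i' = i ∧ j' = j then v else σ.nat a' i' j' := rfl

theorem setReal_real (σ : Store) (a i j : ℕ) (v : ℝ) (a' i' j' : ℕ) :
    (σ.setReal a i j v).real a' i' j' =
      if a' = a ∧ i' = i ∧ j' = j then v else σ.real a' i' j' := rfl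

theorem runs_forTo {v : ℕ} {E : NatExpr} {p : Program} (Inv : ℕ → Store → Prop) {N : ℕ} (hN : N ≤ B)
    (hE : ∀ k σ, Inv k σ → E.eval σ = N)
    (hv : ∀ k σ x, Inv k σ → Inv k (σ.setNat v 0 0 x))
    (hstep : ∀ k σ, k < N → σ.nat v 0 0 = k → Inv k σ →
      Runs B p σ fun σ' => σ'.nat v 0 0 = k ∧ Inv (k + 1) σ')
    (h0 : Inv 0 σ) : Runs B (forTo v E p) σ (Inv N) := by
  refine runs_seq (runs_setNat ?_)
  refine (runs_loop (fun k σ => σ.nat v 0 0 = k ∧ Inv k σ) hN (fun k σ hk h => ⟨?_, ?_⟩)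
    (fun σ h => ?_) ⟨by simp [setNat_nat, NatExpr.eval], hv _ _ _ h0⟩).mono fun σ' h => h.2
  · simp only [Test.Holds, hE k σ h.2, NatExpr.eval, natVar_eval, h.1]
    omega
  · refine runs_seq ((hstep k σ hk h.1 h.2).mono fun σ' h' => runs_setNat ⟨?_, hv _ _ _ h'.2⟩)
    simp [setNat_nat, NatExpr.eval, h'.1]
  · simp only [Test.Holds, hE N σ h.2, NatExpr.eval, natVar_eval, h.1]
    omega

/-- Only the natural-number arrays in `A` and the real arrays in `R` have changed. -/
def Frame (A R : Finset ℕ) (σ σ' : Store) : Prop :=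
  (∀ a ∉ A, σ'.nat a = σ.nat a) ∧ ∀ b ∉ R, σ'.real b = σ.real b

theorem Frame.refl (A R : Finset ℕ) (σ : Store) : Frame A R σ σ := ⟨fun _ _ => rfl, fun _ _ => rfl⟩

theorem Frame.setNat {A R : Finset ℕ} {σ σ' : Store} (h : Frame A R σ σ') {a : ℕ} (ha : a ∈ A)
    (i j v : ℕ) : Frame A R σ (σ'.setNat a i j v) := by
  refine ⟨fun b hb => ?_, h.2⟩
  rw [← h.1 b hb]
  funext i' j'
  rw [setNat_nat, if_neg]
  rintro ⟨rfl, -⟩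
  exact hb ha

theorem Frame.setReal {A R : Finset ℕ} {σ σ' : Store} (h : Frame A R σ σ') {a : ℕ} (ha : a ∈ R)
    (i j : ℕ) (v : ℝ) : Frame A R σ (σ'.setReal a i j v) := by
  refine ⟨h.1, fun b hb => ?_⟩
  rw [← h.2 b hb]
  funext i' j'
  rw [setReal_real, if_neg]
  rintro ⟨rfl, -⟩
  exact hb ha

theorem Frame.trans {A R A' R' A'' R'' : Finset ℕ} {σ σ' σ'' : Store} (h : Frame A R σ σ')
    (h' : Frame A' R' σ' σ'') (hA : A ⊆ A'') (hA' : A' ⊆ A'') (hR : R ⊆ R'') (hR' : R' ⊆ R'') :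
    Frame A'' R'' σ σ'' :=
  ⟨fun a ha => (h'.1 a fun h => ha (hA' h)).trans (h.1 a fun h => ha (hA h)),
    fun a ha => (h'.2 a fun h => ha (hR' h)).trans (h.2 a fun h => ha (hR h))⟩

/-! ## The program for algorithm L

Natural-number variables: `3` and `4` run over the sets found before the present round and over the
coordinates, `5` is the number of these sets, `6`, `7`, `8`, `9`, `10`, `14` are loop counters, `11`
and `12` are flags of the search for duplicates, `13` is the number of the round. Real variables:
`5` and `6` are a partial sum and a partial product, `7` is the largest `|μ i|`. -/

/-- The number of coordinates. -/
def dimE : NatExpr := .get 0 (.const 0) (.const 0)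

/-- The number of examples. -/
def sampleE : NatExpr := .get 0 (.const 0) (.const 1)

/-- The number of sets found so far, and the index of the row for the next candidate. -/
def countE : NatExpr := .get 1 (.const 0) (.const 1)

/-- Compute the empirical coefficient of the set in the row with index `countE`. -/
def estimateProgram : Program :=
  .seq (setRealVar 5 (.ofNat (.const 0)))
    (.seq
      (forTo 7 sampleE
        (.seq (setRealVar 6 (.ofNat (.const 1)))
          (.seq
            (forTo 8 dimE
              (.ite (.natLe (.const 1) (.get 2 countE (natVar 8)))
                (setRealVar 6 (.mul (realVar 6)
                  (.add (.mul (.get 4 (natVar 8) (.const 0)) (.get 1 (natVar 7) (natVar 8)))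
                    (.get 4 (natVar 8) (.const 1)))))
                .skip))
            (setRealVar 5 (.add (realVar 5) (.mul (.get 2 (natVar 7) (.const 0)) (realVar 6)))))))
      (.setReal 3 countE (.const 0) (.div (realVar 5) (.ofNat sampleE))))

/-- The normalized value of coordinate `i` of example `j`, if `i` is in the set in row `c`. -/
def rawFactor (σ : Store) (c j i : ℕ) : ℝ :=
  if 1 ≤ σ.nat 2 c i then σ.real 4 i 0 * σ.real 1 j i + σ.real 4 i 1 else 1

/-- The empirical coefficient of the set in row `c`. -/
def rawEstimate (n m : ℕ) (σ : Store) (c : ℕ) : ℝ :=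
  (∑ j ∈ Finset.range m, σ.real 2 j 0 * ∏ i ∈ Finset.range n, rawFactor σ c j i) / m

theorem runs_estimateProgram {n m : ℕ} (hn : σ.nat 0 0 0 = n) (hm : σ.nat 0 0 1 = m) (hnB : n ≤ B)
    (hmB : m ≤ B) : Runs B estimateProgram σ fun σ' => Frame {7, 8} {3, 5, 6} σ σ' ∧
      ∀ l, σ'.real 3 l 0 = if l = σ.nat 1 0 1 then rawEstimate n m σ l else σ.real 3 l 0 := by
  set c := σ.nat 1 0 1 with hc
  refine runs_seq (runs_setReal (runs_seq ?_))
  refine (runs_forTo (fun k σ' => Frame {7, 8} {5, 6} σ σ' ∧ σ'.real 5 0 0 =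
      ∑ j ∈ Finset.range k, σ.real 2 j 0 * ∏ i ∈ Finset.range n, rawFactor σ c j i) hmB
    (fun k σ' h => ?_) (fun k σ' x h => ⟨h.1.setNat (by decide) _ _ _, h.2⟩)
    (fun k σ₁ hk hk7 h₁ => ?_) ⟨(Frame.refl _ _ _).setReal (by decide) _ _ _, ?_⟩).mono
    fun σ' h => runs_setReal ⟨?_, fun l => ?_⟩
  · simp [sampleE, NatExpr.eval, h.1.1 0 (by decide), hm]
  · refine runs_seq (runs_setReal (runs_seq ?_))
    refine (runs_forTo (fun k' σ' => Frame {8} {6} σ₁ σ' ∧ σ'.real 6 0 0 =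
      ∏ i ∈ Finset.range k', rawFactor σ c k i) hnB
      (fun k σ' h => ?_) (fun k σ' x h => ⟨h.1.setNat (by decide) _ _ _, h.2⟩)
      (fun k' σ₂ hk' hk8 h₂ => ?_) ⟨(Frame.refl _ _ _).setReal (by decide) _ _ _, ?_⟩).mono
      fun σ' h => runs_setReal ⟨?_, (h₁.1.trans h.1 (by decide) (by decide) (by decide)
        (by decide)).setReal (by decide) _ _ _, ?_⟩
    · simp [dimE, NatExpr.eval, h.1.1 0 (by decide), h₁.1.1 0 (by decide), hn]
    · have e7 : σ₂.nat 7 0 0 = k := by rw [h₂.1.1 7 (by decide), hk7]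
      have hrow : σ₂.nat 2 = σ.nat 2 := by rw [h₂.1.1 2 (by decide), h₁.1.1 2 (by decide)]
      have hcnt : σ₂.nat 1 0 1 = c := by rw [h₂.1.1 1 (by decide), h₁.1.1 1 (by decide)]
      have h4 : σ₂.real 4 = σ.real 4 := by rw [h₂.1.2 4 (by decide), h₁.1.2 4 (by decide)]
      have h1 : σ₂.real 1 = σ.real 1 := by rw [h₂.1.2 1 (by decide), h₁.1.2 1 (by decide)]
      refine runs_ite (fun hb => runs_setReal ⟨hk8, h₂.1.setReal (by decide) _ _ _, ?_⟩)
        fun hb => runs_skip ⟨hk8, h₂.1, ?_⟩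
      · simp only [Test.Holds, NatExpr.eval, countE, natVar_eval, hk8, hrow, hcnt] at hb
        simp only [setReal_real, NatExpr.eval, RealExpr.eval, natVar_eval, realVar_eval, hk8, e7, h4,
          h1, h₂.2, Finset.prod_range_succ, rawFactor, if_pos hb]
        simp
      · simp only [Test.Holds, NatExpr.eval, countE, natVar_eval, hk8, hrow, hcnt] at hb
        simp only [h₂.2, Finset.prod_range_succ, rawFactor, if_neg hb, mul_one]
    · simp [setReal_real, NatExpr.eval, RealExpr.eval]
    · simp only [setReal_nat]
      rw [h.1.1 7 (by decide), hk7]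
    · have e7 : σ'.nat 7 0 0 = k := by rw [h.1.1 7 (by decide), hk7]
      have h5 : σ'.real 5 = σ₁.real 5 := h.1.2 5 (by decide)
      have h2 : σ'.real 2 = σ.real 2 := by rw [h.1.2 2 (by decide), h₁.1.2 2 (by decide)]
      simp only [setReal_real, NatExpr.eval, RealExpr.eval, natVar_eval, realVar_eval, e7, h5, h2,
        h₁.2, h.2, Finset.sum_range_succ]
      simp
  · simp [setReal_real, NatExpr.eval, RealExpr.eval]
  · exact (h.1.trans (Frame.refl {7, 8} {3, 5, 6} _) (by decide) (by decide) (by decide)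
      (by decide)).setReal (by decide) _ _ _
  · have h3 : σ'.real 3 = σ.real 3 := h.1.2 3 (by decide)
    have h0 : σ'.nat 0 = σ.nat 0 := h.1.1 0 (by decide)
    have h1 : σ'.nat 1 = σ.nat 1 := h.1.1 1 (by decide)
    simp only [setReal_real, NatExpr.eval, RealExpr.eval, realVar_eval, countE, sampleE, h0, h1, h3,
      hm, h.2, ← hc, rawEstimate]
    by_cases hl : l = c
    · subst hl; simp
    · simp [hl]

/-- Write the set in row `3`, enlarged by the coordinate `4`, into the row `countE`. -/
def candidateProgram : Program :=
  .seq (forTo 6 dimE (.setNat 2 countE (natVar 6) (.get 2 (natVar 3) (natVar 6))))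
    (.setNat 2 countE (natVar 4) (.const 1))

theorem runs_candidateProgram {n l i c : ℕ} (hn : σ.nat 0 0 0 = n) (hnB : n ≤ B)
    (hl : σ.nat 3 0 0 = l) (hi : σ.nat 4 0 0 = i) (hc : σ.nat 1 0 1 = c) (hlc : l ≠ c) :
    Runs B candidateProgram σ fun σ' => Frame {2, 6} ∅ σ σ' ∧ ∀ l' j, σ'.nat 2 l' j =
      if l' = c then (if j = i then 1 else if j < n then σ.nat 2 l j else σ.nat 2 c j)
      else σ.nat 2 l' j := by
  refine runs_seq ((runs_forTo (fun k σ' => Frame {2, 6} ∅ σ σ' ∧ ∀ l' j, σ'.nat 2 l' j =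
      if l' = c then (if j < k then σ.nat 2 l j else σ.nat 2 c j) else σ.nat 2 l' j) hnB
    (fun k σ' h => ?_) (fun k σ' x h => ⟨h.1.setNat (by decide) _ _ _, ?_⟩)
    (fun k σ₁ hk hk6 h₁ => ?_) ⟨Frame.refl _ _ _, ?_⟩).mono fun σ' h => ?_)
  · simp [dimE, NatExpr.eval, h.1.1 0 (by decide), hn]
  · simpa [setNat_nat] using h.2
  · refine runs_setNat ⟨?_, h₁.1.setNat (by decide) _ _ _, fun l' j => ?_⟩
    · simp [setNat_nat, hk6]
    · have h3 : σ₁.nat 3 = σ.nat 3 := h₁.1.1 3 (by decide)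
      have h1 : σ₁.nat 1 = σ.nat 1 := h₁.1.1 1 (by decide)
      simp only [setNat_nat, NatExpr.eval, countE, natVar_eval, hk6, h3, h1, hl, hc, h₁.2, hlc,
        if_false, true_and]
      by_cases h1 : l' = c
      · subst h1
        by_cases h2 : j = k
        · subst h2; simp
        · have : j < k + 1 ↔ j < k := by omega
          simp [h2, this]
      · simp [h1]
  · intro l' j
    by_cases h1 : l' = c
    · subst h1; simp
    · simp [h1]
  · refine runs_setNat ⟨h.1.setNat (by decide) _ _ _, fun l' j => ?_⟩
    have h4 : σ'.nat 4 = σ.nat 4 := h.1.1 4 (by decide)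
    have h1 : σ'.nat 1 = σ.nat 1 := h.1.1 1 (by decide)
    simp only [setNat_nat, NatExpr.eval, countE, natVar_eval, h4, h1, hi, hc, h.2, true_and]
    by_cases h1 : l' = c <;> by_cases h2 : j = i <;> simp [h1, h2]

/-- Set the flag `12` if the row `countE` equals one of the previous rows. -/
def duplicateProgram : Program :=
  .seq (setNatVar 12 (.const 0))
    (forTo 9 countE
      (.seq (setNatVar 11 (.const 1))
        (.seq
          (forTo 10 dimE
            (.ite (.natLe (.get 2 (natVar 9) (natVar 10)) (.get 2 countE (natVar 10)))
              (.ite (.natLe (.get 2 countE (natVar 10)) (.get 2 (natVar 9) (natVar 10)))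
                .skip (setNatVar 11 (.const 0)))
              (setNatVar 11 (.const 0))))
          (.ite (.natLe (.const 1) (natVar 11)) (setNatVar 12 (.const 1)) .skip))))

theorem runs_duplicateProgram {n c : ℕ} (hn : σ.nat 0 0 0 = n) (hnB : n ≤ B)
    (hc : σ.nat 1 0 1 = c) (hcB : c ≤ B) :
    Runs B duplicateProgram σ fun σ' => Frame {9, 10, 11, 12} ∅ σ σ' ∧
      (1 ≤ σ'.nat 12 0 0 ↔ ∃ l < c, ∀ j < n, σ.nat 2 l j = σ.nat 2 c j) := by
  refine runs_seq (runs_setNat ((runs_forTo (fun k σ' => Frame {9, 10, 11, 12} ∅ σ σ' ∧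
      (1 ≤ σ'.nat 12 0 0 ↔ ∃ l < k, ∀ j < n, σ.nat 2 l j = σ.nat 2 c j)) hcB
    (fun k σ' h => ?_) (fun k σ' x h => ⟨h.1.setNat (by decide) _ _ _, ?_⟩)
    (fun k σ₁ hk hk9 h₁ => ?_) ⟨(Frame.refl _ _ _).setNat (by decide) _ _ _, ?_⟩)))
  · simp [countE, NatExpr.eval, h.1.1 1 (by decide), hc]
  · simpa [setNat_nat] using h.2
  · refine runs_seq (runs_setNat (runs_seq ?_))
    refine (runs_forTo (fun k' σ' => Frame {10, 11} ∅ σ₁ σ' ∧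
        (1 ≤ σ'.nat 11 0 0 ↔ ∀ j < k', σ.nat 2 k j = σ.nat 2 c j)) hnB
      (fun k' σ' h => ?_) (fun k' σ' x h => ⟨h.1.setNat (by decide) _ _ _, ?_⟩)
      (fun k' σ₂ hk' hk10 h₂ => ?_) ⟨(Frame.refl _ _ _).setNat (by decide) _ _ _, ?_⟩).mono
      fun σ' h => ?_
    · simp [dimE, NatExpr.eval, h.1.1 0 (by decide), h₁.1.1 0 (by decide), hn]
    · simpa [setNat_nat] using h.2
    · have e9 : σ₂.nat 9 0 0 = k := by rw [h₂.1.1 9 (by decide), hk9]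
      have e2 : σ₂.nat 2 = σ.nat 2 := by rw [h₂.1.1 2 (by decide), h₁.1.1 2 (by decide)]
      have e1 : σ₂.nat 1 0 1 = c := by rw [h₂.1.1 1 (by decide), h₁.1.1 1 (by decide), hc]
      have hsplit : (∀ j < k' + 1, σ.nat 2 k j = σ.nat 2 c j) ↔
          (∀ j < k', σ.nat 2 k j = σ.nat 2 c j) ∧ σ.nat 2 k k' = σ.nat 2 c k' :=
        Nat.forall_lt_succ_right
      refine runs_ite (fun hb => runs_ite (fun hb' => runs_skip ⟨hk10, h₂.1, ?_⟩)
        fun hb' => runs_setNat ⟨?_, h₂.1.setNat (by decide) _ _ _, ?_⟩)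
        fun hb => runs_setNat ⟨?_, h₂.1.setNat (by decide) _ _ _, ?_⟩
      · simp only [Test.Holds, NatExpr.eval, countE, natVar_eval, hk10, e9, e2, e1] at hb hb'
        rw [h₂.2, hsplit]
        exact ⟨fun h => ⟨h, le_antisymm hb hb'⟩, fun h => h.1⟩
      · simp [setNat_nat, hk10]
      · simp only [Test.Holds, NatExpr.eval, countE, natVar_eval, hk10, e9, e2, e1] at hb hb'
        rw [hsplit]
        simp only [setNat_nat, NatExpr.eval, and_self, if_true]
        exact ⟨fun h => absurd h (by norm_num), fun h => absurd h.2.ge hb'⟩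
      · simp [setNat_nat, hk10]
      · simp only [Test.Holds, NatExpr.eval, countE, natVar_eval, hk10, e9, e2, e1] at hb
        rw [hsplit]
        simp only [setNat_nat, NatExpr.eval, and_self, if_true]
        exact ⟨fun h => absurd h (by norm_num), fun h => absurd h.2.le hb⟩
    · simp [setNat_nat, NatExpr.eval]
    · have e9 : σ'.nat 9 0 0 = k := by rw [h.1.1 9 (by decide), hk9]
      have e12 : σ'.nat 12 = σ₁.nat 12 := h.1.1 12 (by decide)
      have hF : Frame {9, 10, 11, 12} ∅ σ σ' :=
        h₁.1.trans h.1 (by decide) (by decide) (by decide) (by decide)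
      have hsplit : (∃ l < k + 1, ∀ j < n, σ.nat 2 l j = σ.nat 2 c j) ↔
          (∃ l < k, ∀ j < n, σ.nat 2 l j = σ.nat 2 c j) ∨ ∀ j < n, σ.nat 2 k j = σ.nat 2 c j :=
        Nat.exists_lt_succ_right
      refine runs_ite (fun hb => runs_setNat ⟨?_, hF.setNat (by decide) _ _ _, ?_⟩)
        fun hb => runs_skip ⟨e9, hF, ?_⟩
      · simp [setNat_nat, e9]
      · simp only [Test.Holds, NatExpr.eval, natVar_eval] at hb
        rw [hsplit]
        simp only [setNat_nat, NatExpr.eval, and_self, if_true, le_refl, true_iff]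
        exact Or.inr (h.2.1 hb)
      · simp only [Test.Holds, NatExpr.eval, natVar_eval] at hb
        rw [hsplit, e12, h₁.2]
        exact ⟨Or.inl, fun h' => h'.resolve_right fun h' => hb (h.2.2 h')⟩
  · simp [setNat_nat, NatExpr.eval]

/-- The number `m e³` for the coefficient `e` of the candidate. -/
def scaledCubeE : RealExpr :=
  .mul (.ofNat sampleE) (.mul (.get 3 countE (.const 0))
    (.mul (.get 3 countE (.const 0)) (.get 3 countE (.const 0))))

/-- Keep the candidate if its coefficient is large and it is no duplicate; report failure if there
is no room for it. -/
def insertProgram : Program :=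
  .ite (.realLe (.ofNat (.const 1)) (.mul scaledCubeE scaledCubeE))
    (.ite (.natLe (.const 1) (natVar 12)) .skip
      (.ite (.natLe (.add countE (.const 1)) sampleE)
        (.setNat 1 (.const 0) (.const 1) (.add countE (.const 1)))
        (.setNat 1 (.const 0) (.const 0) (.const 0))))
    .skip

theorem runs_insertProgram {m c : ℕ} {e : ℝ} (hm : σ.nat 0 0 1 = m)
    (hc : σ.nat 1 0 1 = c) (he : σ.real 3 c 0 = e) :
    Runs B insertProgram σ fun σ' => Frame {1} ∅ σ σ' ∧
      ((1 ≤ (m * e ^ 3) ^ 2 ∧ ¬ 1 ≤ σ.nat 12 0 0 ∧ c < m ∧ σ'.nat 1 0 1 = c + 1 ∧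
          σ'.nat 1 0 0 = σ.nat 1 0 0) ∨
        (1 ≤ (m * e ^ 3) ^ 2 ∧ ¬ 1 ≤ σ.nat 12 0 0 ∧ ¬ c < m ∧ σ'.nat 1 0 1 = c ∧
          σ'.nat 1 0 0 = 0) ∨
        (¬ (1 ≤ (m * e ^ 3) ^ 2 ∧ ¬ 1 ≤ σ.nat 12 0 0) ∧ σ'.nat 1 0 1 = c ∧
          σ'.nat 1 0 0 = σ.nat 1 0 0)) := by
  have hq : Test.Holds σ (.realLe (.ofNat (.const 1)) (.mul scaledCubeE scaledCubeE)) ↔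
      1 ≤ ((m : ℝ) * e ^ 3) ^ 2 := by
    simp only [Test.Holds, RealExpr.eval, NatExpr.eval, scaledCubeE, sampleE, countE, hm, hc, he]
    rw [show (m : ℝ) * (e * (e * e)) * (m * (e * (e * e))) = (m * e ^ 3) ^ 2 by ring]
    simp
  have h12 : Test.Holds σ (.natLe (.const 1) (natVar 12)) ↔ 1 ≤ σ.nat 12 0 0 := Iff.rfl
  have hlt : Test.Holds σ (.natLe (.add countE (.const 1)) sampleE) ↔ c < m := by
    simp only [Test.Holds, NatExpr.eval, sampleE, countE, hm, hc, Nat.succ_le_iff]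
  refine runs_ite (fun h1 => runs_ite (fun h2 => runs_skip ⟨Frame.refl _ _ _, Or.inr (Or.inr
    ⟨fun h => h.2 (h12.1 h2), hc, rfl⟩)⟩) fun h2 => runs_ite
    (fun h3 => runs_setNat ⟨(Frame.refl _ _ _).setNat (by decide) _ _ _, Or.inl
      ⟨hq.1 h1, h2, hlt.1 h3, ?_, ?_⟩⟩)
    fun h3 => runs_setNat ⟨(Frame.refl _ _ _).setNat (by decide) _ _ _, Or.inr (Or.inl
      ⟨hq.1 h1, h2, fun h => h3 (hlt.2 h), ?_, ?_⟩)⟩)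
    fun h1 => runs_skip ⟨Frame.refl _ _ _, Or.inr (Or.inr ⟨fun h => h1 (hq.2 h.1), hc, rfl⟩)⟩
  · simp [setNat_nat, NatExpr.eval, countE, hc]
  · simp [setNat_nat, NatExpr.eval]
  · simp [setNat_nat, NatExpr.eval, hc]
  · simp [setNat_nat, NatExpr.eval]

/-! ### The state of the search -/

/-- The set whose indicator is written in row `l`. -/
def rowSet (n : ℕ) (σ : Store) (l : ℕ) : Finset (Fin n) :=
  Finset.univ.filter fun i => 1 ≤ σ.nat 2 l i

section

variable {n m : ℕ} (μ : Fin n → ℝ) (x : Fin m → Fin n → ℝ) (y : Fin m → ℤˣ)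

/-- The memory holds the input and the coefficients of the normalizing affine forms. -/
structure HoldsInput (σ : Store) : Prop where
  dim : σ.nat 0 0 0 = n
  sample : σ.nat 0 0 1 = m
  point : ∀ j i, σ.real 1 (j : Fin m) (i : Fin n) = x j i
  label : ∀ j, σ.real 2 (j : Fin m) 0 = ((y j : ℤ) : ℝ)
  slope : ∀ i, σ.real 4 (i : Fin n) 0 = 1 / Real.sqrt (1 - μ i ^ 2)
  offset : ∀ i, σ.real 4 (i : Fin n) 1 = -(μ i * (1 / Real.sqrt (1 - μ i ^ 2)))

variable {μ x y}

theorem rawEstimate_eq (h : HoldsInput μ x y σ) (c : ℕ) :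
    rawEstimate n m σ c = estimate μ x y (rowSet n σ c) := by
  rw [rawEstimate, estimate, Finset.sum_range, one_div, inv_mul_eq_div]
  congr 1
  refine Finset.sum_congr rfl fun j _ => ?_
  rw [h.label, Finset.prod_range]
  congr 1
  rw [← Finset.univ_inter (rowSet n σ c), ← Finset.prod_ite_mem]
  refine Finset.prod_congr rfl fun i _ => ?_
  simp only [rawFactor, rowSet, Finset.mem_filter, Finset.mem_univ, true_and, h.slope, h.offset,
    h.point, normalized]
  split_ifs
  · ring
  · rfl

theorem HoldsInput.congr {σ' : Store} (h : HoldsInput μ x y σ) (h0 : σ'.nat 0 = σ.nat 0)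
    (h1 : σ'.real 1 = σ.real 1) (h2 : σ'.real 2 = σ.real 2) (h4 : σ'.real 4 = σ.real 4) :
    HoldsInput μ x y σ' :=
  ⟨h0 ▸ h.dim, h0 ▸ h.sample, h1 ▸ h.point, h2 ▸ h.label, h4 ▸ h.slope, h4 ▸ h.offset⟩

/-- The coefficient of `S` reaches the threshold of the algorithm. -/
def Large (μ : Fin n → ℝ) (x : Fin m → Fin n → ℝ) (y : Fin m → ℤˣ) (S : Finset (Fin n)) : Prop :=
  (m : ℝ) ^ (-(1 / 3) : ℝ) ≤ |estimate μ x y S|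

theorem one_le_scaled_cube_sq_iff {m : ℕ} (hm : 1 ≤ m) (e : ℝ) :
    1 ≤ ((m : ℝ) * e ^ 3) ^ 2 ↔ (m : ℝ) ^ (-(1 / 3) : ℝ) ≤ |e| := by
  have hm0 : (0 : ℝ) < m := by exact_mod_cast hm
  have hpos : 0 < (m : ℝ) ^ (-(1 / 3) : ℝ) := Real.rpow_pos_of_pos hm0 _
  have hcube : ((m : ℝ) ^ (-(1 / 3) : ℝ)) ^ 3 = (m : ℝ)⁻¹ := by
    rw [← Real.rpow_natCast, ← Real.rpow_mul hm0.le, ← Real.rpow_neg_one]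
    norm_num
  rw [one_le_sq_iff_one_le_abs, abs_mul, abs_pow, abs_of_pos hm0,
    ← pow_le_pow_iff_left₀ hpos.le (abs_nonneg e) (three_ne_zero), hcube, inv_le_iff_one_le_mul₀' hm0]

/-- The rows below `countE` hold exactly the family `F`, or the search has failed. -/
structure HoldsFamily (μ : Fin n → ℝ) (x : Fin m → Fin n → ℝ) (y : Fin m → ℤˣ)
    (F : Finset (Finset (Fin n))) (failed : Prop) (σ : Store) : Prop where
  input : HoldsInput μ x y σ
  count_pos : 1 ≤ σ.nat 1 0 1
  count_le : σ.nat 1 0 1 ≤ m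
  entry_le : ∀ l j, σ.nat 2 l j ≤ 1
  coefficient : ∀ l < σ.nat 1 0 1, σ.real 3 l 0 = estimate μ x y (rowSet n σ l)
  not_failed : σ.nat 1 0 0 ≠ 0 → ¬ failed
  mem_iff : σ.nat 1 0 0 ≠ 0 → ∀ S, S ∈ F ↔ ∃ l < σ.nat 1 0 1, rowSet n σ l = S
  injective : σ.nat 1 0 0 ≠ 0 → ∀ l < σ.nat 1 0 1, ∀ l' < σ.nat 1 0 1,
    rowSet n σ l = rowSet n σ l' → l = l'
  of_zero : σ.nat 1 0 0 = 0 → failed ∨ m < F.card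

variable {F : Finset (Finset (Fin n))} {failed : Prop}

theorem rowSet_congr {σ σ' : Store} {l : ℕ} (h : ∀ j < n, σ'.nat 2 l j = σ.nat 2 l j) :
    rowSet n σ' l = rowSet n σ l := by
  simp only [rowSet]
  refine Finset.filter_congr fun i _ => by rw [h i i.2]

theorem HoldsFamily.congr {σ' : Store} (h : HoldsFamily μ x y F failed σ)
    (h0 : σ'.nat 0 = σ.nat 0) (h1 : σ'.nat 1 = σ.nat 1) (h2 : σ'.nat 2 = σ.nat 2)
    (g1 : σ'.real 1 = σ.real 1) (g2 : σ'.real 2 = σ.real 2) (g3 : σ'.real 3 = σ.real 3)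
    (g4 : σ'.real 4 = σ.real 4) : HoldsFamily μ x y F failed σ' := by
  have hr : ∀ l, rowSet n σ' l = rowSet n σ l := fun l => rowSet_congr fun j _ => by rw [h2]
  refine ⟨h.input.congr h0 g1 g2 g4, ?_, ?_, ?_, ?_, ?_, ?_, ?_, ?_⟩ <;>
    simp only [h1, h2, g3, hr]
  exacts [h.count_pos, h.count_le, h.entry_le, h.coefficient,
    h.not_failed, h.mem_iff, h.injective, h.of_zero]

theorem HoldsFamily.family_eq (h : HoldsFamily μ x y F failed σ) (hf : σ.nat 1 0 0 ≠ 0) :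
    F = (Finset.range (σ.nat 1 0 1)).image (rowSet n σ) := by
  ext S
  rw [h.mem_iff hf]
  simp

theorem HoldsFamily.card_eq (h : HoldsFamily μ x y F failed σ) (hf : σ.nat 1 0 0 ≠ 0) :
    F.card = σ.nat 1 0 1 := by
  rw [h.family_eq hf, Finset.card_image_of_injOn, Finset.card_range]
  intro l hl l' hl'
  exact h.injective hf l (by simpa using hl) l' (by simpa using hl')

end

/-- Form a candidate and keep it if it qualifies. -/
def itemProgram : Program :=
  .seq candidateProgram (.seq estimateProgram (.seq duplicateProgram insertProgram))

section

variable {n m : ℕ} {μ : Fin n → ℝ} {x : Fin m → Fin n → ℝ} {y : Fin m → ℤˣ}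
  {F : Finset (Finset (Fin n))} {failed : Prop}

open Classical in
theorem runs_itemProgram (h : HoldsFamily μ x y F failed σ) (hnB : n ≤ B) (hmB : m ≤ B) {l : ℕ}
    {i : Fin n} (hl : σ.nat 3 0 0 = l) (hlc : l < σ.nat 1 0 1) (hi : σ.nat 4 0 0 = i) :
    Runs B itemProgram σ fun σ' => Frame {1, 2, 6, 7, 8, 9, 10, 11, 12} {3, 5, 6} σ σ' ∧
      σ.nat 1 0 1 ≤ σ'.nat 1 0 1 ∧ (∀ l' < σ.nat 1 0 1, rowSet n σ' l' = rowSet n σ l') ∧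
      HoldsFamily μ x y (F ∪ if Large μ x y (insert i (rowSet n σ l))
        then {insert i (rowSet n σ l)} else ∅) failed σ' := by
  set c := σ.nat 1 0 1 with hc
  set S := insert i (rowSet n σ l) with hS
  have hm1 : 1 ≤ m := h.count_pos.trans h.count_le
  refine runs_seq ((runs_candidateProgram h.input.dim hnB hl hi hc.symm hlc.ne).mono
    fun σ₁ ⟨hF₁, h₁⟩ => ?_)
  have hI₁ : HoldsInput μ x y σ₁ := h.input.congr (hF₁.1 0 (by decide)) (hF₁.2 1 (by decide))
    (hF₁.2 2 (by decide)) (hF₁.2 4 (by decide))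
  have hc₁ : σ₁.nat 1 0 1 = c := by rw [hF₁.1 1 (by decide)]
  refine runs_seq ((runs_estimateProgram hI₁.dim hI₁.sample hnB hmB).mono fun σ₂ ⟨hF₂, h₂⟩ => ?_)
  rw [hc₁] at h₂
  have hI₂ : HoldsInput μ x y σ₂ := hI₁.congr (hF₂.1 0 (by decide)) (hF₂.2 1 (by decide))
    (hF₂.2 2 (by decide)) (hF₂.2 4 (by decide))
  have hc₂ : σ₂.nat 1 0 1 = c := by rw [hF₂.1 1 (by decide), hc₁]
  refine runs_seq ((runs_duplicateProgram hI₂.dim hnB hc₂ (h.count_le.trans hmB)).mono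
    fun σ₃ ⟨hF₃, h₃⟩ => ?_)
  have hI₃ : HoldsInput μ x y σ₃ := hI₂.congr (hF₃.1 0 (by decide)) (hF₃.2 1 (by decide))
    (hF₃.2 2 (by decide)) (hF₃.2 4 (by decide))
  have hc₃ : σ₃.nat 1 0 1 = c := by rw [hF₃.1 1 (by decide), hc₂]
  have hrow2 : σ₂.nat 2 = σ₁.nat 2 := hF₂.1 2 (by decide)
  have hrow3 : σ₃.nat 2 = σ₁.nat 2 := by rw [hF₃.1 2 (by decide), hrow2]
  have hreal3 : σ₃.real 3 = σ₂.real 3 := hF₃.2 3 (by decide)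
  have hrowc : rowSet n σ₁ c = S := by
    ext j
    simp only [hS, rowSet, Finset.mem_filter, Finset.mem_univ, true_and, Finset.mem_insert, h₁,
      if_true, j.2, Fin.ext_iff]
    by_cases hj : (j : ℕ) = i <;> simp [hj]
  have hrowlt : ∀ l' < c, rowSet n σ₁ l' = rowSet n σ l' := fun l' hl' =>
    rowSet_congr fun j _ => by rw [h₁, if_neg hl'.ne]
  have hentry : ∀ l' j, σ₁.nat 2 l' j ≤ 1 := fun l' j => by
    rw [h₁]
    split_ifs
    exacts [le_rfl, h.entry_le _ _, h.entry_le _ _, h.entry_le _ _]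
  have he : σ₃.real 3 c 0 = estimate μ x y S := by
    rw [hreal3, h₂, if_pos rfl, rawEstimate_eq hI₁, hrowc]
  have hcoef : ∀ l' < c, σ₃.real 3 l' 0 = estimate μ x y (rowSet n σ l') := fun l' hl' => by
    rw [hreal3, h₂, if_neg hl'.ne, hF₁.2 3 (by decide), h.coefficient l' hl']
  have hdup : 1 ≤ σ₃.nat 12 0 0 ↔ ∃ l' < c, rowSet n σ l' = S := by
    rw [h₃, hrow2]
    refine exists_congr fun l' => and_congr_right fun hl' => ?_
    rw [← hrowc, ← hrowlt l' hl']
    constructor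
    · intro H
      simp only [rowSet]
      exact Finset.filter_congr fun j _ => by rw [H j j.2]
    · intro H j hj
      have := congrArg (fun T : Finset (Fin n) => (⟨j, hj⟩ : Fin n) ∈ T) H
      simp only [rowSet, Finset.mem_filter, Finset.mem_univ, true_and, eq_iff_iff] at this
      have h4 := hentry l' j
      have h5 := hentry c j
      omega
  refine (runs_insertProgram hI₃.sample hc₃ he).mono fun σ₄ ⟨hF₄, h₄⟩ => ?_
  have hI₄ : HoldsInput μ x y σ₄ := hI₃.congr (hF₄.1 0 (by decide)) (hF₄.2 1 (by decide))
    (hF₄.2 2 (by decide)) (hF₄.2 4 (by decide))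
  have hrow4 : σ₄.nat 2 = σ₁.nat 2 := by rw [hF₄.1 2 (by decide), hrow3]
  have hreal4 : σ₄.real 3 = σ₃.real 3 := hF₄.2 3 (by decide)
  have hset4 : ∀ l', rowSet n σ₄ l' = rowSet n σ₁ l' := fun l' => rowSet_congr fun j _ => by rw [hrow4]
  have hentry4 : ∀ l' j, σ₄.nat 2 l' j ≤ 1 := fun l' j => by rw [hrow4]; exact hentry l' j
  have hlt4 : ∀ l' < c, rowSet n σ₄ l' = rowSet n σ l' := fun l' hl' => by
    rw [hset4, hrowlt l' hl']
  have hflag : σ₃.nat 1 0 0 = σ.nat 1 0 0 := by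
    rw [hF₃.1 1 (by decide), hF₂.1 1 (by decide), hF₁.1 1 (by decide)]
  have hcoef4 : ∀ l' < c, σ₄.real 3 l' 0 = estimate μ x y (rowSet n σ₄ l') := fun l' hl' => by
    rw [hreal4, hcoef l' hl', hlt4 l' hl']
  have hframe : Frame {1, 2, 6, 7, 8, 9, 10, 11, 12} {3, 5, 6} σ σ₄ :=
    ((hF₁.trans hF₂ (A'' := {2, 6, 7, 8}) (R'' := {3, 5, 6}) (by decide) (by decide) (by decide)
      (by decide)).trans hF₃ (A'' := {2, 6, 7, 8, 9, 10, 11, 12}) (R'' := {3, 5, 6}) (by decide)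
      (by decide) (by decide) (by decide)).trans hF₄ (by decide) (by decide) (by decide) (by decide)
  have hlarge : 1 ≤ ((m : ℝ) * estimate μ x y S ^ 3) ^ 2 ↔ Large μ x y S :=
    one_le_scaled_cube_sq_iff hm1 _
  rw [hlarge, hdup, hflag] at h₄
  have hsub : F ⊆ F ∪ if Large μ x y S then {S} else ∅ := Finset.subset_union_left
  have hzero : σ.nat 1 0 0 = 0 → failed ∨ m < (F ∪ if Large μ x y S then {S} else ∅).card :=
    fun hf => (h.of_zero hf).imp id fun hm => hm.trans_le (Finset.card_le_card hsub)
  rcases h₄ with ⟨hL, hD, hcm, h1, h0⟩ | ⟨hL, hD, hcm, h1, h0⟩ | ⟨hno, h1, h0⟩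
  · refine ⟨hframe, by omega, hlt4, hI₄, by omega, by omega, hentry4, fun l' hl' => ?_, ?_, ?_, ?_, ?_⟩
    · rw [h1] at hl'
      rcases Nat.lt_succ_iff_lt_or_eq.1 hl' with hl' | rfl
      · exact hcoef4 l' hl'
      · rw [hreal4, he, hset4, hrowc]
    · rw [h0]; exact h.not_failed
    · rw [h0, h1]
      intro hf T
      rw [if_pos hL, Finset.mem_union, Finset.mem_singleton, h.mem_iff hf, Nat.exists_lt_succ_right,
        hset4, hrowc, eq_comm (a := T)]
      refine or_congr_left (exists_congr fun l' => and_congr_right fun hl' => ?_)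
      rw [hlt4 l' hl']
    · rw [h0, h1]
      intro hf l₁ hl₁ l₂ hl₂ hEq
      rcases Nat.lt_succ_iff_lt_or_eq.1 hl₁ with hl₁ | rfl <;>
        rcases Nat.lt_succ_iff_lt_or_eq.1 hl₂ with hl₂ | rfl
      · rw [hlt4 _ hl₁, hlt4 _ hl₂] at hEq
        exact h.injective hf _ hl₁ _ hl₂ hEq
      · rw [hlt4 _ hl₁, hset4 c, hrowc] at hEq
        exact absurd ⟨_, hl₁, hEq⟩ hD
      · rw [hlt4 _ hl₂, hset4 c, hrowc] at hEq
        exact absurd ⟨_, hl₂, hEq.symm⟩ hD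
      · rfl
    · rw [h0]; exact hzero
  · refine ⟨hframe, by omega, hlt4, hI₄, by have := h.count_pos; omega, by have := h.count_le; omega,
      hentry4, ?_, fun hf => absurd h0 hf, fun hf => absurd h0 hf, fun hf => absurd h0 hf, fun _ => ?_⟩
    · rw [h1]; exact hcoef4
    · by_cases hf : σ.nat 1 0 0 = 0
      · exact hzero hf
      · right
        rw [if_pos hL, Finset.union_comm, ← Finset.insert_eq, Finset.card_insert_of_notMem, h.card_eq hf]
        · omega
        · rw [h.mem_iff hf]; exact hD
  · refine ⟨hframe, by omega, hlt4, hI₄, by have := h.count_pos; omega, by have := h.count_le; omega,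
      hentry4, ?_, ?_, ?_, ?_, ?_⟩
    · rw [h1]; exact hcoef4
    · rw [h0]; exact h.not_failed
    · rw [h0, h1]
      intro hf T
      have hFeq : (F ∪ if Large μ x y S then {S} else ∅) = F := by
        refine Finset.union_eq_left.2 ?_
        split_ifs with hL
        · have hD := not_not.1 fun hD => hno ⟨hL, hD⟩
          exact Finset.singleton_subset_iff.2 ((h.mem_iff hf S).2 hD)
        · exact Finset.empty_subset _
      rw [hFeq, h.mem_iff hf]
      exact exists_congr fun l' => and_congr_right fun hl' => by rw [hlt4 l' hl']
    · rw [h0, h1]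
      intro hf l₁ hl₁ l₂ hl₂ hEq
      rw [hlt4 _ hl₁, hlt4 _ hl₂] at hEq
      exact h.injective hf _ hl₁ _ hl₂ hEq
    · rw [h0]; exact hzero

/-- One round of the search. -/
def roundProgram : Program :=
  .seq (setNatVar 5 countE) (forTo 3 (natVar 5) (forTo 4 dimE itemProgram))

open Classical in
/-- The family found in a round when the rows before `l`, and row `l` with the coordinates before
`k`, have been treated. -/
def partialExtend (μ : Fin n → ℝ) (x : Fin m → Fin n → ℝ) (y : Fin m → ℤˣ)
    (F : Finset (Finset (Fin n))) (R : ℕ → Finset (Fin n)) (l k : ℕ) : Finset (Finset (Fin n)) :=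
  Finset.univ.filter fun S => S ∈ F ∨ (Large μ x y S ∧
    ∃ (l' : ℕ) (i : Fin n), (l' < l ∨ l' = l ∧ (i : ℕ) < k) ∧ insert i (R l') = S)

theorem mem_partialExtend {R : ℕ → Finset (Fin n)} {l k : ℕ} {S : Finset (Fin n)} :
    S ∈ partialExtend μ x y F R l k ↔ S ∈ F ∨ (Large μ x y S ∧
      ∃ (l' : ℕ) (i : Fin n), (l' < l ∨ l' = l ∧ (i : ℕ) < k) ∧ insert i (R l') = S) := by
  simp [partialExtend]

theorem partialExtend_zero (R : ℕ → Finset (Fin n)) : partialExtend μ x y F R 0 0 = F := by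
  ext S
  simp [mem_partialExtend]

theorem partialExtend_dim (R : ℕ → Finset (Fin n)) (l : ℕ) :
    partialExtend μ x y F R l n = partialExtend μ x y F R (l + 1) 0 := by
  ext S
  simp only [mem_partialExtend, Fin.is_lt, and_true,
    Nat.not_lt_zero, and_false, or_false, Nat.lt_succ_iff_lt_or_eq]

open Classical in
theorem partialExtend_succ (R : ℕ → Finset (Fin n)) (l : ℕ) (i : Fin n) :
    partialExtend μ x y F R l (i + 1) = partialExtend μ x y F R l i ∪
      if Large μ x y (insert i (R l)) then {insert i (R l)} else ∅ := by
  ext S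
  have hmem : S ∈ (if Large μ x y (insert i (R l)) then {insert i (R l)} else
      (∅ : Finset (Finset (Fin n)))) ↔ Large μ x y S ∧ insert i (R l) = S := by
    split_ifs with h
    · rw [Finset.mem_singleton]
      exact ⟨fun hS => ⟨hS ▸ h, hS.symm⟩, fun hS => hS.2.symm⟩
    · refine ⟨fun hS => absurd hS (Finset.notMem_empty _), fun hS => absurd (hS.2 ▸ hS.1) h⟩
  rw [Finset.mem_union, hmem]
  simp only [mem_partialExtend]
  constructor
  · rintro (h | ⟨hL, l', i', hlt, hS⟩)
    · exact Or.inl (Or.inl h)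
    · rcases hlt with h | ⟨rfl, h⟩
      · exact Or.inl (Or.inr ⟨hL, l', i', Or.inl h, hS⟩)
      · rcases Nat.lt_succ_iff_lt_or_eq.1 h with h | h
        · exact Or.inl (Or.inr ⟨hL, l', i', Or.inr ⟨rfl, h⟩, hS⟩)
        · obtain rfl := Fin.ext h
          exact Or.inr ⟨hL, hS⟩
  · rintro ((h | ⟨hL, l', i', hlt, hS⟩) | ⟨hL, hS⟩)
    · exact Or.inl h
    · exact Or.inr ⟨hL, l', i', hlt.imp id fun h => ⟨h.1, Nat.lt_succ_of_lt h.2⟩, hS⟩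
    · exact Or.inr ⟨hL, l, i, Or.inr ⟨rfl, Nat.lt_succ_self _⟩, hS⟩

theorem partialExtend_count (h : HoldsFamily μ x y F failed σ) (hf : σ.nat 1 0 0 ≠ 0) :
    partialExtend μ x y F (rowSet n σ) (σ.nat 1 0 1) 0 = extend μ x y F := by
  ext S
  rw [mem_partialExtend]
  simp only [extend, Finset.mem_filter, Finset.mem_univ, Nat.not_lt_zero, and_false, or_false, Finset.mem_union, Finset.mem_image, Finset.mem_product, and_true,
    Prod.exists, h.mem_iff hf, Large]
  refine or_congr_right ⟨?_, ?_⟩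
  · rintro ⟨hL, l, i, hl, hS⟩
    exact ⟨⟨_, i, ⟨l, hl, rfl⟩, hS⟩, hL⟩
  · rintro ⟨⟨_, i, ⟨l, hl, rfl⟩, hS⟩, hL⟩
    exact ⟨hL, l, i, hl, hS⟩

theorem runs_roundProgram (h : HoldsFamily μ x y F failed σ) (hnB : n ≤ B) (hmB : m ≤ B) :
    Runs B roundProgram σ fun σ' =>
      Frame {1, 2, 3, 4, 5, 6, 7, 8, 9, 10, 11, 12} {3, 5, 6} σ σ' ∧
      HoldsFamily μ x y (partialExtend μ x y F (rowSet n σ) (σ.nat 1 0 1) 0) failed σ' := by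
  set c := σ.nat 1 0 1 with hc
  refine runs_seq (runs_setNat ?_)
  refine (runs_forTo (fun k σ' => Frame {1, 2, 3, 4, 5, 6, 7, 8, 9, 10, 11, 12} {3, 5, 6} σ σ' ∧
      σ'.nat 5 0 0 = c ∧ c ≤ σ'.nat 1 0 1 ∧ (∀ l < c, rowSet n σ' l = rowSet n σ l) ∧
      HoldsFamily μ x y (partialExtend μ x y F (rowSet n σ) k 0) failed σ') (h.count_le.trans hmB)
    (fun k σ' h => by exact h.2.1) (fun k σ' v h => ⟨h.1.setNat (by decide) _ _ _, ?_, ?_, ?_, ?_⟩)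
    (fun k σ₁ hk hk3 h₁ => ?_) ⟨(Frame.refl _ _ _).setNat (by decide) _ _ _, ?_, ?_, ?_, ?_⟩).mono
    fun σ' h => ⟨h.1, h.2.2.2.2⟩
  · simpa [setNat_nat] using h.2.1
  · simpa [setNat_nat] using h.2.2.1
  · exact fun l hl => (rowSet_congr fun j _ => by simp [setNat_nat]).trans (h.2.2.2.1 l hl)
  · refine h.2.2.2.2.congr ?_ ?_ ?_ rfl rfl rfl rfl <;> · funext i j; simp [setNat_nat]
  · refine (runs_forTo (fun k' σ' =>
        Frame {1, 2, 3, 4, 5, 6, 7, 8, 9, 10, 11, 12} {3, 5, 6} σ σ' ∧ σ'.nat 3 0 0 = k ∧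
        σ'.nat 5 0 0 = c ∧ c ≤ σ'.nat 1 0 1 ∧ (∀ l < c, rowSet n σ' l = rowSet n σ l) ∧
        HoldsFamily μ x y (partialExtend μ x y F (rowSet n σ) k k') failed σ') hnB
      (fun k' σ' h => by exact h.2.2.2.2.2.input.dim)
      (fun k' σ' v h => ⟨h.1.setNat (by decide) _ _ _, ?_, ?_, ?_, ?_, ?_⟩)
      (fun k' σ₂ hk' hk4 h₂ => ?_) ⟨h₁.1, hk3, h₁.2⟩).mono fun σ' h => ?_
    · simpa [setNat_nat] using h.2.1
    · simpa [setNat_nat] using h.2.2.1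
    · simpa [setNat_nat] using h.2.2.2.1
    · exact fun l hl => (rowSet_congr fun j _ => by simp [setNat_nat]).trans (h.2.2.2.2.1 l hl)
    · refine h.2.2.2.2.2.congr ?_ ?_ ?_ rfl rfl rfl rfl <;> · funext i j; simp [setNat_nat]
    · obtain ⟨hF, h3, h5, hcc, hrow, hH⟩ := h₂
      refine (runs_itemProgram hH hnB hmB (i := ⟨k', hk'⟩) h3 (hk.trans_le hcc) hk4).mono
        fun σ₃ ⟨hF₃, hc₃, hrow₃, hH₃⟩ => ⟨?_, hF.trans hF₃ (by decide) (by decide) (by decide)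
          (by decide), ?_, ?_, hcc.trans hc₃, fun l hl => ?_, ?_⟩
      · rw [hF₃.1 4 (by decide), hk4]
      · rw [hF₃.1 3 (by decide), h3]
      · rw [hF₃.1 5 (by decide), h5]
      · rw [hrow₃ l (hl.trans_le hcc), hrow l hl]
      · rw [hrow k hk] at hH₃
        have := partialExtend_succ (μ := μ) (x := x) (y := y) (F := F) (rowSet n σ) k ⟨k', hk'⟩
        simp only at this
        rw [this]
        exact hH₃
    · rw [partialExtend_dim] at h
      exact ⟨h.2.1, h.1, h.2.2⟩
  · simp [setNat_nat, NatExpr.eval, countE, hc]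
  · simp [setNat_nat, hc]
  · exact fun l hl => rowSet_congr fun j _ => by simp [setNat_nat]
  · rw [partialExtend_zero]
    refine h.congr ?_ ?_ ?_ rfl rfl rfl rfl <;> · funext i j; simp [setNat_nat]

end

/-- The square of the `i`-th entry of the mean vector. -/
def meanSqE : RealExpr :=
  .mul (.get 0 (natVar 14) (.const 0)) (.get 0 (natVar 14) (.const 0))

theorem meanSqE_eval : meanSqE.eval σ = σ.real 0 (σ.nat 14 0 0) 0 ^ 2 := (sq _).symm

/-- Compute the normalizing affine forms and the largest absolute value of the mean vector. -/
def normalizeProgram : Program :=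
  forTo 14 dimE
    (.seq
      (.setReal 4 (natVar 14) (.const 0)
        (.div (.ofNat (.const 1)) (.sqrt (.sub (.ofNat (.const 1)) meanSqE))))
      (.seq
        (.setReal 4 (natVar 14) (.const 1)
          (.sub (.ofNat (.const 0))
            (.mul (.get 0 (natVar 14) (.const 0)) (.get 4 (natVar 14) (.const 0)))))
        (.ite (.realLe (realVar 7) (.sqrt meanSqE)) (setRealVar 7 (.sqrt meanSqE)) .skip)))

theorem runs_normalizeProgram {n : ℕ} (hn : σ.nat 0 0 0 = n) (hnB : n ≤ B)
    (h7 : σ.real 7 0 0 = 0) : Runs B normalizeProgram σ fun σ' => Frame {14} {4, 7} σ σ' ∧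
      (∀ i < n, σ'.real 4 i 0 = 1 / Real.sqrt (1 - σ.real 0 i 0 ^ 2) ∧
        σ'.real 4 i 1 = -(σ.real 0 i 0 * (1 / Real.sqrt (1 - σ.real 0 i 0 ^ 2)))) ∧
      (∀ i < n, |σ.real 0 i 0| ≤ σ'.real 7 0 0) ∧
      (σ'.real 7 0 0 = 0 ∨ ∃ i < n, σ'.real 7 0 0 = |σ.real 0 i 0|) := by
  refine runs_forTo (fun k σ' => Frame {14} {4, 7} σ σ' ∧
      (∀ i < k, σ'.real 4 i 0 = 1 / Real.sqrt (1 - σ.real 0 i 0 ^ 2) ∧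
        σ'.real 4 i 1 = -(σ.real 0 i 0 * (1 / Real.sqrt (1 - σ.real 0 i 0 ^ 2)))) ∧
      (∀ i < k, |σ.real 0 i 0| ≤ σ'.real 7 0 0) ∧
      (σ'.real 7 0 0 = 0 ∨ ∃ i < k, σ'.real 7 0 0 = |σ.real 0 i 0|)) hnB
    (fun k σ' h => ?_) (fun k σ' v h => ⟨h.1.setNat (by decide) _ _ _, h.2⟩)
    (fun k σ₁ hk hk14 h₁ => ?_) ⟨Frame.refl _ _ _, by simp, by simp, Or.inl h7⟩
  · simp [dimE, NatExpr.eval, h.1.1 0 (by decide), hn]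
  · obtain ⟨hF, h4, hle, hmax⟩ := h₁
    have h0 : σ₁.real 0 = σ.real 0 := hF.2 0 (by decide)
    refine runs_seq (runs_setReal (runs_seq (runs_setReal ?_)))
    simp only [NatExpr.eval, RealExpr.eval, natVar_eval, setReal_nat, setReal_real, hk14, meanSqE_eval, h0,
      if_true, show ¬ ((0 : ℕ) = 4) by decide, false_and, if_false, Nat.cast_one,
      Nat.cast_zero, zero_sub, and_self]
    set σ₂ := (σ₁.setReal 4 k 0 (1 / Real.sqrt (1 - σ.real 0 k 0 ^ 2))).setReal 4 k 1
      (-(σ.real 0 k 0 * (1 / Real.sqrt (1 - σ.real 0 k 0 ^ 2)))) with hσ₂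
    have hF₂ : Frame {14} {4, 7} σ σ₂ :=
      (hF.setReal (by decide) _ _ _).setReal (by decide) _ _ _
    have h14 : σ₂.nat 14 0 0 = k := hk14
    have h02 : σ₂.real 0 = σ.real 0 := hF₂.2 0 (by decide)
    have h72 : σ₂.real 7 0 0 = σ₁.real 7 0 0 := by simp [hσ₂, setReal_real]
    have h42 : ∀ i < k + 1, σ₂.real 4 i 0 = 1 / Real.sqrt (1 - σ.real 0 i 0 ^ 2) ∧
        σ₂.real 4 i 1 = -(σ.real 0 i 0 * (1 / Real.sqrt (1 - σ.real 0 i 0 ^ 2))) := fun i hi => by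
      rcases Nat.lt_succ_iff_lt_or_eq.1 hi with hi | rfl
      · simpa [hσ₂, setReal_real, hi.ne] using h4 i hi
      · simp [hσ₂, setReal_real]
    have hsq : RealExpr.eval σ₂ (.sqrt meanSqE) = |σ.real 0 k 0| := by
      rw [RealExpr.eval, meanSqE_eval, h14, h02, Real.sqrt_sq_eq_abs]
    have htest : Test.Holds σ₂ (.realLe (realVar 7) (.sqrt meanSqE)) ↔
        σ₁.real 7 0 0 ≤ |σ.real 0 k 0| := by
      rw [Test.Holds, hsq, realVar_eval, h72]
    refine runs_ite (fun hb => runs_setReal ?_) fun hb => runs_skip ?_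
    · rw [htest] at hb
      rw [hsq]
      refine ⟨h14, hF₂.setReal (by decide) _ _ _, fun i hi => ?_, fun i hi => ?_,
        Or.inr ⟨k, Nat.lt_succ_self k, ?_⟩⟩
      · simpa [setReal_real, NatExpr.eval] using h42 i hi
      · simp only [setReal_real, NatExpr.eval, and_self, if_true]
        rcases Nat.lt_succ_iff_lt_or_eq.1 hi with hi | rfl
        · exact (hle i hi).trans hb
        · exact le_rfl
      · simp [setReal_real, NatExpr.eval]
    · rw [htest, not_le] at hb
      refine ⟨h14, hF₂, h42, fun i hi => ?_, ?_⟩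
      · rw [h72]
        rcases Nat.lt_succ_iff_lt_or_eq.1 hi with hi | rfl
        · exact hle i hi
        · exact hb.le
      · rw [h72]
        exact hmax.imp id fun ⟨i, hi, h⟩ => ⟨i, Nat.lt_succ_of_lt hi, h⟩

/-- The bound on the number of rounds. -/
def roundBoundE : RealExpr :=
  .mul (.div (.log (.ofNat sampleE)) (.ofNat (.const 12))) (.sub (.ofNat (.const 1)) (realVar 7))

/-- Algorithm L. -/
def learnProgram : Program :=
  .seq normalizeProgram
    (.seq estimateProgram
      (.seq (.setNat 1 (.const 0) (.const 1) (.const 1))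
        (.seq (.setNat 1 (.const 0) (.const 0) (.const 1))
          (.seq (setNatVar 13 (.const 1))
            (.loop (.realLe (.ofNat (natVar 13)) roundBoundE)
              (.seq roundProgram (setNatVar 13 (.add (natVar 13) (.const 1)))))))))

section

variable {n m : ℕ} {μ : Fin n → ℝ} {x : Fin m → Fin n → ℝ} {y : Fin m → ℤˣ}

theorem rounds_le (m : ℕ) (hm : 1 ≤ m) (μ : Fin n → ℝ) : rounds m μ ≤ m := by
  refine Nat.floor_le_of_le ?_
  have hm' : (1 : ℝ) ≤ m := by exact_mod_cast hm
  have h1 := Real.log_le_sub_one_of_pos (show (0 : ℝ) < m by linarith)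
  have h2 := Real.log_nonneg hm'
  have h3 : 0 ≤ ⨆ i, |μ i| := Real.iSup_nonneg fun i => abs_nonneg _
  nlinarith

/-- The memory after `k` rounds. -/
def AfterRounds (μ : Fin n → ℝ) (x : Fin m → Fin n → ℝ) (y : Fin m → ℤˣ) (k : ℕ) (σ : Store) :
    Prop :=
  σ.nat 13 0 0 = k + 1 ∧ σ.real 7 0 0 = ⨆ i, |μ i| ∧
    ∃ F, HoldsFamily μ x y F (features μ x y k = none) σ ∧
      ∀ G, features μ x y k = some G → F = G ∧ G.card ≤ m

theorem AfterRounds.runs_roundProgram {k : ℕ} (h : AfterRounds μ x y k σ) (hnB : n ≤ B)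
    (hmB : m ≤ B) : Runs B (.seq roundProgram (setNatVar 13 (.add (natVar 13) (.const 1)))) σ
      (AfterRounds μ x y (k + 1)) := by
  obtain ⟨h13, h7, F, hF, hG⟩ := h
  refine runs_seq ((RealRAM.runs_roundProgram hF hnB hmB).mono fun σ₁ ⟨hF₁, h₁⟩ => runs_setNat ?_)
  set F' := partialExtend μ x y F (rowSet n σ) (σ.nat 1 0 1) 0 with hF'
  have e13 : σ₁.nat 13 0 0 = k + 1 := by rw [hF₁.1 13 (by decide), h13]
  have e7 : σ₁.real 7 0 0 = ⨆ i, |μ i| := by rw [hF₁.2 7 (by decide), h7]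
  refine ⟨by simp [setNat_nat, NatExpr.eval, e13], e7, F', ?_⟩
  have hstep : HoldsFamily μ x y F' (features μ x y (k + 1) = none) σ₁ ∧
      ∀ G, features μ x y (k + 1) = some G → F' = G ∧ G.card ≤ m := by
    rcases hk : features μ x y k with _ | G
    · have hnone : features μ x y (k + 1) = none := by rw [features, hk]; rfl
      rw [hk] at h₁
      rw [hnone]
      exact ⟨h₁, by simp⟩
    · obtain ⟨rfl, hcard⟩ := hG G hk
      have hf : σ.nat 1 0 0 ≠ 0 := fun hf =>
        (hF.of_zero hf).elim (by simp [hk]) fun h => absurd hcard (not_le.2 h)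
      have hext : F' = extend μ x y F := partialExtend_count hF hf
      have hfeat : features μ x y (k + 1) =
          if m < (extend μ x y F).card then none else some (extend μ x y F) := by
        rw [features, hk]; rfl
      rw [hfeat, ← hext]
      rw [hk] at h₁
      constructor
      · refine ⟨h₁.input, h₁.count_pos, h₁.count_le, h₁.entry_le, h₁.coefficient, fun hf₁ => ?_,
          h₁.mem_iff, h₁.injective, fun hf₁ => Or.inl ?_⟩
        · have := h₁.card_eq hf₁
          have := h₁.count_le
          rw [if_neg (by omega)]
          simp
        · rw [if_pos ((h₁.of_zero hf₁).resolve_left (by simp))]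
      · intro G hG
        split_ifs at hG with hm
        · obtain rfl := Option.some.inj hG
          exact ⟨rfl, not_lt.1 hm⟩
  refine ⟨hstep.1.congr ?_ ?_ ?_ rfl rfl rfl rfl, hstep.2⟩ <;> · funext i j; simp [setNat_nat]

theorem runs_learnProgram (hn : 1 ≤ n) (hm : 1 ≤ m) (hnB : n ≤ B) (hmB : m ≤ B) :
    Runs B learnProgram (inputStore μ x y) (AfterRounds μ x y (rounds m μ)) := by
  set σ := inputStore μ x y with hσ
  have hσn : σ.nat 0 0 0 = n := by simp [hσ, inputStore]
  have hσm : σ.nat 0 0 1 = m := by simp [hσ, inputStore]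
  have hσμ : ∀ i : Fin n, σ.real 0 i 0 = μ i := fun i => by simp [hσ, inputStore]
  have hNe : Nonempty (Fin n) := ⟨⟨0, hn⟩⟩
  refine runs_seq ((runs_normalizeProgram hσn hnB (by simp [hσ, inputStore])).mono
    fun σ₁ ⟨hF₁, h4, hle, hmax⟩ => runs_seq ?_)
  have hI₁ : HoldsInput μ x y σ₁ := by
    refine ⟨?_, ?_, fun j i => ?_, fun j => ?_, fun i => ?_, fun i => ?_⟩
    · rw [hF₁.1 0 (by decide), hσn]
    · rw [hF₁.1 0 (by decide), hσm]
    · rw [hF₁.2 1 (by decide)]; simp [hσ, inputStore]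
    · rw [hF₁.2 2 (by decide)]; simp [hσ, inputStore]
    · rw [(h4 i i.2).1, hσμ]
    · rw [(h4 i i.2).2, hσμ]
  have h7 : σ₁.real 7 0 0 = ⨆ i, |μ i| := by
    refine le_antisymm ?_ (ciSup_le fun i => by rw [← hσμ]; exact hle i i.2)
    rcases hmax with h | ⟨i, hi, h⟩
    · rw [h]; exact Real.iSup_nonneg fun i => abs_nonneg _
    · rw [h, hσμ ⟨i, hi⟩]
      exact le_ciSup (f := fun i => |μ i|) (Set.finite_range _).bddAbove ⟨i, hi⟩
  refine (runs_estimateProgram hI₁.dim hI₁.sample hnB hmB).mono fun σ₂ ⟨hF₂, h₂⟩ => ?_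
  have hI₂ : HoldsInput μ x y σ₂ := hI₁.congr (hF₂.1 0 (by decide)) (hF₂.2 1 (by decide))
    (hF₂.2 2 (by decide)) (hF₂.2 4 (by decide))
  have hσ1 : σ₁.nat 1 0 1 = 0 := by rw [hF₁.1 1 (by decide)]; simp [hσ, inputStore]
  have hrows : ∀ l j, σ₂.nat 2 l j = 0 := fun l j => by
    rw [hF₂.1 2 (by decide), hF₁.1 2 (by decide)]; simp [hσ, inputStore]
  refine runs_seq (runs_setNat (runs_seq (runs_setNat (runs_seq (runs_setNat ?_)))))
  refine runs_loop (AfterRounds μ x y) ((rounds_le m hm μ).trans hmB)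
    (fun k σ' hk h => ⟨?_, h.runs_roundProgram hnB hmB⟩) (fun σ' h => ?_) ?_
  · obtain ⟨h13, h7, F, hF, -⟩ := h
    have := (Nat.le_floor_iff' (Nat.succ_ne_zero k)).1 (Nat.succ_le_of_lt hk)
    simpa [Test.Holds, RealExpr.eval, NatExpr.eval, roundBoundE, sampleE, h13, h7, hF.input.sample]
      using this
  · obtain ⟨h13, h7, F, hF, -⟩ := h
    intro hb
    have hb' : ((rounds m μ + 1 : ℕ) : ℝ) ≤ Real.log m / 12 * (1 - ⨆ i, |μ i|) := by
      simpa [Test.Holds, RealExpr.eval, NatExpr.eval, roundBoundE, sampleE, h13, h7,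
        hF.input.sample] using hb
    have := (Nat.le_floor_iff' (Nat.succ_ne_zero _)).2 hb'
    exact absurd this (Nat.not_succ_le_self _)
  · have hempty : ∀ σ' : Store, (∀ j, σ'.nat 2 0 j = 0) → rowSet n σ' 0 = ∅ := fun σ' h => by
      simp [rowSet, h]
    refine ⟨by simp [setNat_nat, NatExpr.eval], ?_, {∅}, ⟨?_, ?_, ?_, ?_, ?_, ?_, ?_, ?_, ?_⟩, ?_⟩
    · simp only [setNat_real]
      rw [hF₂.2 7 (by decide), h7]
    · refine hI₂.congr ?_ rfl rfl rfl
      funext i j; simp [setNat_nat]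
    · simp [setNat_nat, NatExpr.eval]
    · simpa [setNat_nat, NatExpr.eval] using hm
    · intro l j; simp [setNat_nat, hrows]
    · intro l hl
      simp only [setNat_nat, NatExpr.eval] at hl
      obtain rfl : l = 0 := by simpa using hl
      rw [hempty _ fun j => by simp [setNat_nat, hrows]]
      simp only [setNat_real]
      rw [h₂, hσ1, if_pos rfl, rawEstimate_eq hI₁, hempty]
      intro j
      rw [← hF₂.1 2 (by decide), hrows]
    · intro _; simp [features]
    · intro _ S
      simp only [setNat_nat, NatExpr.eval]
      simp [hempty, setNat_nat, hrows, eq_comm]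
    · intro _ l hl l' hl' _
      simp only [setNat_nat, NatExpr.eval] at hl hl'
      simp at hl hl'
      omega
    · intro h; simp [setNat_nat, NatExpr.eval] at h
    · intro G hG
      obtain rfl := Option.some.inj hG
      exact ⟨rfl, by simpa using hm⟩

theorem AfterRounds.readOutput_eq (h : AfterRounds μ x y (rounds m μ) σ) :
    readOutput n σ = algorithmL μ x y ∧ outputTerms σ ≤ m := by
  obtain ⟨-, -, F, hF, hG⟩ := h
  refine ⟨?_, hF.count_le⟩
  rw [readOutput, algorithmL]
  by_cases hf : σ.nat 1 0 0 = 0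
  · rw [if_pos hf]
    rcases hk : features μ x y (rounds m μ) with _ | G
    · rfl
    · obtain ⟨rfl, hcard⟩ := hG G hk
      exact absurd ((hF.of_zero hf).resolve_left (by simp [hk])) (not_lt.2 hcard)
  · rw [if_neg hf]
    obtain ⟨G, hk⟩ := Option.ne_none_iff_exists'.1 (hF.not_failed hf)
    obtain ⟨rfl, -⟩ := hG G hk
    rw [hk, Option.map_some]
    congr 1
    rw [hypothesisPoly, hF.family_eq hf, Finset.sum_image]
    · refine Finset.sum_congr rfl fun l hl => ?_
      rw [hF.coefficient l (Finset.mem_range.1 hl), ← Finset.univ_inter (rowSet n σ l),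
        ← Finset.prod_ite_mem]
      congr 1
      refine Finset.prod_congr rfl fun i _ => ?_
      simp only [rowSet, Finset.mem_filter, Finset.mem_univ, true_and, hF.input.slope,
        hF.input.offset, Nat.one_le_iff_ne_zero, ite_not, map_neg, map_mul]
      split_ifs
      · rfl
      · ring
    · intro l hl l' hl'
      exact hF.injective hf l (by simpa using hl) l' (by simpa using hl')

end

end RealRAM

open RealRAM in
theorem runsInPolynomialTime : RunsInPolynomialTime := by
  refine ⟨learnProgram, learnProgram.timePoly + Polynomial.X, fun n m hn hm μ x y _ => ?_⟩
  obtain ⟨σ, t, h1, h2, h3⟩ := runs_learnProgram (μ := μ) (x := x) (y := y) hn hm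
    (Nat.le_add_right n m) (Nat.le_add_left m n)
  obtain ⟨h4, h5⟩ := h3.readOutput_eq
  rw [Polynomial.eval_add, Polynomial.eval_X]
  exact ⟨σ, t, h1, by omega, by omega, h4⟩

end SmoothedLearning

end

theorem theorem1 :
    (∀ c : ℝ, 0 < c → c < 1 / 4 →
      ∃ q : Polynomial ℝ, ∀ (n s : ℕ), 1 ≤ n → 1 ≤ s →
        ∀ (ε δ : ℝ), 0 < ε → ε ≤ 1 → 0 < δ →
        ∀ (f : (Fin n → Bool) → ℤˣ), SmoothedLearning.ComputedByTree s f →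
        ∀ (μbar : Fin n → ℝ), (∀ i, μbar i ∈ Set.Icc (2 * c) (1 - 2 * c)) →
        ∀ m : ℕ, q.eval ((n : ℝ) * (s : ℝ) / (δ * ε)) ≤ (m : ℝ) →
          ENNReal.ofReal (1 - δ) ≤
            SmoothedLearning.smoothedProb c μbar m
              (fun Δ X => SmoothedLearning.Success f ε (μbar + Δ) X)) ∧
    SmoothedLearning.RunsInPolynomialTime := by
  exact ⟨fun _ hc hc1 => SmoothedLearning.exists_polynomial_smoothedProb_success hc hc1,
    SmoothedLearning.runsInPolynomialTime⟩
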